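/- For $U\in\mathbb{N}$, $U\ge 1$, let $\mathbb{Q}_U=\{\pm p/q : p,q\in\{1,\dots,U\}\}\cup\{0\}$ be the set of $U$-rational numbers. Two finite point multisets $A,B\subseteq\mathbb{Q}_U^2$ are \emph{congruent} if there are a rotation $\rho$ of $\mathbb{R}^2$ and a translation vector $t\in\mathbb{R}^2$ such that $a\mapsto\rho(a)+t$ maps $A$ bijectively onto $B$, preserving multiplicities (reflections are not allowed). The geometric hashing problem with parameters $n,U,m$ has as input $m$ multisets $A_1,\dots,A_m\subseteq\mathbb{Q}_U^2$ of $n$ points each, given as a stream of $mn$ labelled points $(i,z)$, meaning $z\in A_i$, in an arbitrary (adversarial, possibly interleaved) order. The goal is to output a congruence hash function of length $s$, i.e. a map $H:\{1,\dots,m\}\to\{0,1\}^s$ such that for all $i,j$: $H(i)=H(j)$ if and only if $A_i$ and $A_j$ are congruent. A \emph{$k$-pass randomized streaming algorithm} scans the stream forward $k$ times (always in the same order), processing one datum at a time, and may draw fresh uniform random numbers. It can use an earlier datum or an earlier random draw only through what it keeps in its memory. Its \emph{space} is the maximum, over its whole execution and all random choices, of the number of bits in use, including working storage, the parameters, the current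 datum and the output. \textbf{Theorem.} There are a 6-pass randomized streaming algorithm (a single one, which receives $n,U,m$ as parameters) and an absolute constant $C$ such that for all integers $n\ge 2$, $U\ge 1$, $m\ge 1$ there is a hash length $$s\le C(\log n+\log U+\log m)$$ such that, for all $m$ multisets $A_1,\dots,A_m\subseteq\mathbb{Q}_U^2$ of $n$ points each and every order of the stream, the algorithm uses at most $$C\, m\log n\,(\log n+\log U+\log m)$$ bits of space, and with probability at least $1-1/n$ over its random choices it outputs a valid congruence hash function $H:\{1,\dots,m\}\to\{0,1\}^s$. Here $\log$ is the logarithm to base $2$. -/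

import Mathlib

noncomputable section

namespace GeomHash

/-! ### Point multisets, precision, congruence -/

/-- The `U`-rational numbers `{± p / q : p, q ∈ [U]} ∪ {0}`. -/
def boundedQ (U : ℕ) : Set ℚ :=
  {x | ∃ p ∈ Finset.Icc 1 U, ∃ q ∈ Finset.Icc 1 U, x = (p : ℚ) / q ∨ x = -((p : ℚ) / q)} ∪ {0}

/-- The point `(x, y)` of the plane as the complex number `x + y i`. -/
def toComplex (z : ℚ × ℚ) : ℂ := ⟨(z.1 : ℝ), (z.2 : ℝ)⟩

/-- `A` is congruent to `B`: some rotation `z ↦ ρ z` (with `|ρ| = 1`) followed by a translation by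
`t` maps `A` onto `B` with multiplicities. -/
def Congruent (A B : Multiset (ℚ × ℚ)) : Prop :=
  ∃ ρ t : ℂ, ‖ρ‖ = 1 ∧ (A.map toComplex).map (fun z => ρ * z + t) = B.map toComplex

/-- An insertion-only stream of labelled points: the datum `(i, (x, y))` says that the point
`(x, y)` occurs (once more) in the query set with index `i`. -/
abbrev PointStream (m : ℕ) := List (Fin m × ℚ × ℚ)

/-- `σ` lists all points of all query sets, with multiplicities, in an arbitrary (possibly
interleaved) order. -/
def IsStreamOf {m : ℕ} (σ : PointStream m) (A : Fin m → Multiset (ℚ × ℚ)) : Prop :=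
  ∀ i : Fin m, (((σ.filter (fun d => d.1 = i)).map Prod.snd : List (ℚ × ℚ)) :
    Multiset (ℚ × ℚ)) = A i

/-! ### A randomized machine with bit-space accounting

Memory consists of finitely many named arrays of natural numbers. Programs are built from
assignments, uniform random draws, sequencing, branching and loops with a precomputed number of
rounds, so that every program halts on every input. -/

/-- Memory contents: `μ (a, i)` is the content of cell `i` of the array with name `a`. All but
finitely many cells are `0`. -/
abbrev Mem := (ℕ × ℕ) →₀ ℕ

/-- Number of bits of a memory: every non-zero cell is charged the binary length of its index plus
that of its content. (Array names are fixed in the program text.) -/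
def Mem.bits (μ : Mem) : ℕ := μ.sum fun k v => Nat.size k.2 + Nat.size v

/-- Arithmetic expressions over the memory cells. -/
inductive Expr : Type
  | const (c : ℕ) : Expr
  | cell (a : ℕ) (i : Expr) : Expr
  | add (x y : Expr) : Expr
  | sub (x y : Expr) : Expr
  | mul (x y : Expr) : Expr
  | div (x y : Expr) : Expr
  | mod (x y : Expr) : Expr

/-- Value of an expression (`sub` is truncated, `div` is integer division). -/
def Expr.val (μ : Mem) : Expr → ℕ
  | .const c => c
  | .cell a i => μ (a, i.val μ)
  | .add x y => x.val μ + y.val μ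
  | .sub x y => x.val μ - y.val μ
  | .mul x y => x.val μ * y.val μ
  | .div x y => x.val μ / y.val μ
  | .mod x y => x.val μ % y.val μ

/-- Work space charged for evaluating an expression: the total binary length of the values of all
its subexpressions. -/
def Expr.bits (μ : Mem) : Expr → ℕ
  | .const c => Nat.size c
  | .cell a i => i.bits μ + Nat.size ((Expr.cell a i).val μ)
  | .add x y => x.bits μ + y.bits μ + Nat.size ((Expr.add x y).val μ)
  | .sub x y => x.bits μ + y.bits μ + Nat.size ((Expr.sub x y).val μ)
  | .mul x y => x.bits μ + y.bits μ + Nat.size ((Expr.mul x y).val μ)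
  | .div x y => x.bits μ + y.bits μ + Nat.size ((Expr.div x y).val μ)
  | .mod x y => x.bits μ + y.bits μ + Nat.size ((Expr.mod x y).val μ)

/-- Programs. `assign a i e` writes the value of `e` to cell `i` of array `a`; `draw a i e` writes
a fresh uniformly random element of `{0, …, e}` there; `ite e c d` runs `c` if `e ≠ 0` and `d`
otherwise; `loop e c` evaluates `e` once and runs `c` that many times. -/
inductive Prog : Type
  | skip : Prog
  | assign (a : ℕ) (i e : Expr) : Prog
  | draw (a : ℕ) (i e : Expr) : Prog
  | seq (c d : Prog) : Prog
  | ite (e : Expr) (c d : Prog) : Prog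
  | loop (e : Expr) (c : Prog) : Prog

/-- A configuration: the memory, and the largest number of bits in use so far. -/
structure Config where
  mem : Mem
  peak : ℕ

/-- Record that, besides the memory itself, `w` further bits are in use. -/
def Config.charge (w : ℕ) (s : Config) : Config :=
  ⟨s.mem, max s.peak (w + s.mem.bits)⟩

/-- Overwrite one cell; `w` further bits are in use. -/
def Config.write (w : ℕ) (s : Config) (a i v : ℕ) : Config :=
  Config.charge w ⟨s.mem.update (a, i) v, s.peak⟩

/-- Distribution of the configuration after running a program. The argument `h` is the number of
bits held by the round counters of the enclosing loops. -/
def Prog.eval : Prog → ℕ → Config → PMF Config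
  | .skip, _, s => PMF.pure s
  | .assign a i e, h, s =>
      PMF.pure ((s.charge (h + i.bits s.mem + e.bits s.mem)).write h a (i.val s.mem) (e.val s.mem))
  | .draw a i e, h, s =>
      (PMF.uniformOfFintype (Fin (e.val s.mem + 1))).map fun r =>
        (s.charge (h + i.bits s.mem + e.bits s.mem)).write h a (i.val s.mem) r
  | .seq c d, h, s => (c.eval h s).bind (d.eval h)
  | .ite e c d, h, s =>
      if e.val s.mem ≠ 0 then c.eval h (s.charge (h + e.bits s.mem))
      else d.eval h (s.charge (h + e.bits s.mem))
  | .loop e c, h, s =>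
      (fun P : PMF Config => P.bind (c.eval (h + Nat.size (e.val s.mem))))^[e.val s.mem]
        (PMF.pure (s.charge (h + e.bits s.mem)))

/-- Write a list of numbers to cells `0, 1, 2, …` of an array. -/
def Mem.writeList (a : ℕ) (l : List ℕ) (μ : Mem) : Mem :=
  l.zipIdx.foldl (fun ν vk => ν.update (a, vk.2) vk.1) μ

/-- A rational number as sign bit, absolute value of the numerator, denominator (lowest terms). -/
def encodeRat (x : ℚ) : List ℕ := [if x < 0 then 1 else 0, x.num.natAbs, x.den]

/-- A datum as a list of seven numbers: the label and the two coordinates. -/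
def encodeDatum {m : ℕ} (d : Fin m × ℚ × ℚ) : List ℕ :=
  (d.1 : ℕ) :: (encodeRat d.2.1 ++ encodeRat d.2.2)

/-- A randomized streaming algorithm with `k` passes: `init` is run before the first pass; in pass
`j` the program `step j` is run on each datum of the stream in turn, and at the end of that pass
the program `post j` is run. -/
structure StreamAlg (k : ℕ) where
  init : Prog
  step : Fin k → Prog
  post : Fin k → Prog

/-- Read a datum: it overwrites cells `0, …, 6` of array `1`. -/
def Config.read {m : ℕ} (s : Config) (d : Fin m × ℚ × ℚ) : Config :=
  Config.charge 0 ⟨s.mem.writeList 1 (encodeDatum d), s.peak⟩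

/-- One forward scan of the stream, running `c` on every datum. -/
def scan {m : ℕ} (c : Prog) (σ : PointStream m) (P : PMF Config) : PMF Config :=
  σ.foldl (fun Q d => Q.bind fun s => c.eval 0 (s.read d)) P

/-- The start configuration: `n`, `U`, `m` stand in cells `0`, `1`, `2` of array `0`. -/
def start (n U m : ℕ) : Config :=
  Config.charge 0 ⟨Mem.writeList 0 [n, U, m] 0, 0⟩

/-- Distribution of the final configuration of a `k`-pass streaming algorithm. All passes see the
same stream. -/
def StreamAlg.run {k : ℕ} (𝒜 : StreamAlg k) (n U m : ℕ) (σ : PointStream m) : PMF Config :=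
  (List.finRange k).foldl (fun P j => (scan (𝒜.step j) σ P).bind ((𝒜.post j).eval 0))
    (𝒜.init.eval 0 (start n U m))

/-- The hash function `[m] → {0,1}^len` that a final configuration represents: the `len` bits in
cell `i` of array `2` are the hash value of the index `i`. -/
def Config.hash {m : ℕ} (s : Config) (len : ℕ) (i : Fin m) : Fin len → Bool :=
  fun b => (s.mem (2, (i : ℕ))).testBit b

/-- `H` is a congruence hash function for the query sets `A`. -/
def IsCongruenceHash {m len : ℕ} (A : Fin m → Multiset (ℚ × ℚ)) (H : Fin m → Fin len → Bool) :
    Prop :=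
  ∀ i j : Fin m, H i = H j ↔ Congruent (A i) (A j)

end GeomHash

end

/-!
The space bound concerns bits only, not time, so it is enough to find a hash function in which
every number that is ever held has `O(log n + log U + log m)` bits, with `O(1)` numbers per query
set. All searches are then done exhaustively. The point is that real coordinates are replaced by
`3`-adic ones.

*Residues.* Let `P` be a power of three with `2 n U < P ≤ 6 n U`. A `U`-rational number,
multiplied by `P`, has a residue modulo `P ^ 42`, and so every point `z` of a set with coordinate
sum `Σ` yields a vector `n z - Σ` in the Gaussian integers modulo `P ^ 42` (`resVec`). If two sets
are congruent, these vectors differ by a rotation `α / β` with Gaussian integers `α`, `β` of equal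
norm. As three is inert in the Gaussian integers, one may take `β` prime to three, so modulo
`P ^ 42` the rotation is multiplication by an element `r` of norm one
(`exists_normOne_of_congruent`).

*Canonical position.* Take the vectors not divisible by `P ^ 21`, say `k` of them, divide each by
its power of three and multiply the results: under `r` the product `d` turns into `r ^ k d` modulo
`P ^ 21`, because each quotient is still known to this precision. Multiply the set by an element
`s` of norm one for which `s ^ k d` comes first in a fixed enumeration. The first value depends
only on the congruence class (`normalizer_cong`), so for two congruent sets the choices of `s`
match up to an element `η` of norm one with `η ^ k ≡ 1` modulo `P ^ 21`. By lifting the exponent,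
as `k < P`, this leaves only the fourth roots of unity for `η` modulo `P ^ 20`; one factor `P` is
lost (`exists_cong_iunit_pow`). Hence the canonical positions of congruent sets agree modulo
`P ^ 20` up to a quarter turn (`canon_rotate`). Conversely, if they agree, then modulo `P ^ 20`
corresponding points have equal squared distances from a base point, and equal quotients of their
differences from it. After clearing denominators these are equations between rational numbers of
small height, so they hold exactly, which forces congruence (`congruent_of_rel`,
`congruent_of_canon_eq`).

*Hashing.* A multiset of residues is compressed to the value of the monic polynomial with these
roots at a random point modulo a prime `Q`; the hash is the least such value over the four quarter
turns. Congruent sets always receive equal hashes, and a union bound over all pairs of sets and of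
quarter turns controls the false coincidences (`card_bad_le`).

*Streaming.* Three passes suffice: the sums `Σ`, then the products `d` and counts `k`, then the
polynomials, where `s` is searched for anew at every datum; the other passes are idle. A randomly
drawn number occurs only in the initialization, so the passes are deterministic functions of it.
For the space bound, every number is stored modulo a clamp `B = (16 n U m) ^ 64` that exceeds all
intended values; whatever such a program computes, its memory and its work space remain within the
bound (`Prog.eval_clamped`, `StreamAlg.passes_clamped`). The two aspects are put together in
`run_spec`.
-/

namespace GeomHash

/-! ### Deterministic semantics and space bounds for clamped programs -/

/-- Memory contents as a plain function. -/
abbrev State := ℕ × ℕ → ℕ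

/-- Value of an expression in a state. -/
def Expr.ev (f : State) : Expr → ℕ
  | .const c => c
  | .cell a i => f (a, i.ev f)
  | .add x y => x.ev f + y.ev f
  | .sub x y => x.ev f - y.ev f
  | .mul x y => x.ev f * y.ev f
  | .div x y => x.ev f / y.ev f
  | .mod x y => x.ev f % y.ev f

theorem Expr.val_eq_ev (μ : Mem) (e : Expr) : e.val μ = e.ev μ := by
  induction e <;> simp_all [Expr.val, Expr.ev]

/-- Syntactic size of an expression; a constant `c` counts `c + 1`, so that the value is at most
`B ^ weight` as soon as all cells are at most `B`. -/
def Expr.weight : Expr → ℕ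
  | .const c => c + 1
  | .cell _ i => i.weight + 1
  | .add x y => x.weight + y.weight + 1
  | .sub x y => x.weight + y.weight + 1
  | .mul x y => x.weight + y.weight + 1
  | .div x y => x.weight + y.weight + 1
  | .mod x y => x.weight + y.weight + 1

theorem Expr.weight_pos (e : Expr) : 1 ≤ e.weight := by
  cases e <;> simp [Expr.weight]

theorem Expr.val_le {B : ℕ} (hB : 2 ≤ B) {μ : Mem} (hμ : ∀ k, μ k ≤ B) (e : Expr) :
    e.val μ ≤ B ^ e.weight := by
  have hB1 : 1 ≤ B := by omega
  induction e with
  | const c =>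
    calc c ≤ 2 ^ c := Nat.lt_two_pow_self.le
      _ ≤ B ^ c := Nat.pow_le_pow_left hB c
      _ ≤ B ^ (c + 1) := Nat.pow_le_pow_right hB1 (by omega)
  | cell a i _ =>
    calc μ (a, i.val μ) ≤ B ^ 1 := by simpa using hμ _
      _ ≤ B ^ (i.weight + 1) := Nat.pow_le_pow_right hB1 (by omega)
  | add x y hx hy =>
    have h1 : B ^ x.weight ≤ B ^ (x.weight + y.weight) := Nat.pow_le_pow_right hB1 (by omega)
    have h2 : B ^ y.weight ≤ B ^ (x.weight + y.weight) := Nat.pow_le_pow_right hB1 (by omega)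
    simp only [Expr.val, Expr.weight, pow_succ]
    nlinarith
  | mul x y hx hy =>
    calc x.val μ * y.val μ ≤ B ^ x.weight * B ^ y.weight := Nat.mul_le_mul hx hy
      _ = B ^ (x.weight + y.weight) := (pow_add ..).symm
      _ ≤ _ := Nat.pow_le_pow_right hB1 (by simp [Expr.weight])
  | sub x y hx hy =>
    exact (Nat.sub_le _ _).trans
      (hx.trans (Nat.pow_le_pow_right hB1 (by simp [Expr.weight]; omega)))
  | div x y hx hy =>
    exact (Nat.div_le_self _ _).trans
      (hx.trans (Nat.pow_le_pow_right hB1 (by simp [Expr.weight]; omega)))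
  | mod x y hx hy =>
    exact (Nat.mod_le _ _).trans
      (hx.trans (Nat.pow_le_pow_right hB1 (by simp [Expr.weight]; omega)))

theorem size_pow_le (B k : ℕ) (hk : 1 ≤ k) : Nat.size (B ^ k) ≤ k * Nat.size B := by
  rw [Nat.size_le, mul_comm, pow_mul]
  exact Nat.pow_lt_pow_left (Nat.lt_size_self B) (by omega)

theorem Expr.size_val_le {B : ℕ} (hB : 2 ≤ B) {μ : Mem} (hμ : ∀ k, μ k ≤ B) (e : Expr) :
    Nat.size (e.val μ) ≤ e.weight * Nat.size B :=
  (Nat.size_le_size (e.val_le hB hμ)).trans (size_pow_le _ _ e.weight_pos)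

theorem Expr.bits_le {B : ℕ} (hB : 2 ≤ B) {μ : Mem} (hμ : ∀ k, μ k ≤ B) (e : Expr) :
    e.bits μ ≤ e.weight ^ 2 * Nat.size B := by
  have hs : 1 ≤ Nat.size B := Nat.size_pos.2 (by omega)
  induction e with
  | const c =>
    have : Nat.size c ≤ c := Nat.size_le.2 Nat.lt_two_pow_self
    simp only [Expr.bits, Expr.weight]
    nlinarith
  | cell a i hi =>
    have := (Expr.cell a i).size_val_le hB hμ
    simp only [Expr.bits, Expr.weight] at *
    nlinarith
  | add x y hx hy =>
    have := (Expr.add x y).size_val_le hB hμ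
    simp only [Expr.bits, Expr.weight] at *
    nlinarith [Nat.zero_le (x.weight * y.weight * Nat.size B)]
  | sub x y hx hy =>
    have := (Expr.sub x y).size_val_le hB hμ
    simp only [Expr.bits, Expr.weight] at *
    nlinarith [Nat.zero_le (x.weight * y.weight * Nat.size B)]
  | mul x y hx hy =>
    have := (Expr.mul x y).size_val_le hB hμ
    simp only [Expr.bits, Expr.weight] at *
    nlinarith [Nat.zero_le (x.weight * y.weight * Nat.size B)]
  | div x y hx hy =>
    have := (Expr.div x y).size_val_le hB hμ
    simp only [Expr.bits, Expr.weight] at *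
    nlinarith [Nat.zero_le (x.weight * y.weight * Nat.size B)]
  | mod x y hx hy =>
    have := (Expr.mod x y).size_val_le hB hμ
    simp only [Expr.bits, Expr.weight] at *
    nlinarith [Nat.zero_le (x.weight * y.weight * Nat.size B)]

/-- The effect of a draw-free program on the memory (a `draw` is ignored). -/
def Prog.sem : Prog → State → State
  | .skip, f => f
  | .assign a i e, f => Function.update f (a, i.ev f) (e.ev f)
  | .draw _ _ _, f => f
  | .seq c d, f => d.sem (c.sem f)
  | .ite e c d, f => if e.ev f ≠ 0 then c.sem f else d.sem f
  | .loop e c, f => c.sem^[e.ev f] f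

/-- Clamped programs draw nothing, store only values reduced modulo cell `(4, 0)`, and write only to
the first `64` cells of array `3` and, in the arrays `2` and `5, …, 15`, to the cell with the label
of the current datum, found in cell `(1, 0)`. Their memory stays small whatever they compute. -/
def Prog.Clamped : Prog → Prop
  | .skip => True
  | .assign a i e => ((a = 3 ∧ ∃ c < 64, i = .const c) ∨
      ((a = 2 ∨ 5 ≤ a ∧ a < 16) ∧ i = .cell 1 (.const 0))) ∧ ∃ x, e = .mod x (.cell 4 (.const 0))
  | .draw _ _ _ => False
  | .seq c d => c.Clamped ∧ d.Clamped
  | .ite _ c d => c.Clamped ∧ d.Clamped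
  | .loop _ c => c.Clamped

/-- A factor bounding the work space of a program in units of the cell size. -/
def Prog.cost : Prog → ℕ
  | .skip => 0
  | .assign _ i e => i.weight ^ 2 + e.weight ^ 2
  | .draw _ i e => i.weight ^ 2 + e.weight ^ 2
  | .seq c d => c.cost + d.cost
  | .ite e c d => e.weight ^ 2 + c.cost + d.cost
  | .loop e c => e.weight ^ 2 + e.weight + c.cost

/-- All cells hold at most `B`, and only cells `(a, i)` with `a < 16`, `i < 64 + m` are in use. -/
structure Small (B m : ℕ) (f : State) : Prop where
  le : ∀ k, f k ≤ B
  fst_lt : ∀ k, f k ≠ 0 → k.1 < 16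
  snd_lt : ∀ k, f k ≠ 0 → k.2 < 64 + m

/-- The memory invariant of clamped programs: the clamp `B` stands in cell `(4, 0)` and a valid
label in cell `(1, 0)`. -/
structure Inv (B m : ℕ) (f : State) : Prop extends Small B m f where
  clamp : f (4, 0) = B
  label : f (1, 0) < m

/-- Bound for the bits of a small memory. -/
def memBound (B m : ℕ) : ℕ := 16 * (64 + m) * (Nat.size (64 + m) + Nat.size B)

theorem Small.bits_le {B m : ℕ} {μ : Mem} (h : Small B m μ) : μ.bits ≤ memBound B m := by
  have hsub : μ.support ⊆ Finset.range 16 ×ˢ Finset.range (64 + m) := by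
    intro k hk
    rw [Finsupp.mem_support_iff] at hk
    simp [h.fst_lt k hk, h.snd_lt k hk]
  calc μ.bits ≤ ∑ k ∈ μ.support, (Nat.size (64 + m) + Nat.size B) := by
        refine Finset.sum_le_sum fun k hk => ?_
        rw [Finsupp.mem_support_iff] at hk
        exact Nat.add_le_add (Nat.size_le_size (h.snd_lt k hk).le) (Nat.size_le_size (h.le k))
    _ = μ.support.card * (Nat.size (64 + m) + Nat.size B) := by simp
    _ ≤ _ := by
        refine Nat.mul_le_mul_right _ ((Finset.card_le_card hsub).trans ?_)
        simp

theorem Small.update {B m : ℕ} {f : State} (h : Small B m f) {a i v : ℕ} (ha : a < 16)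
    (hi : i < 64 + m) (hv : v ≤ B) : Small B m (Function.update f (a, i) v) := by
  refine ⟨fun k => ?_, fun k => ?_, fun k => ?_⟩ <;> rw [Function.update_apply] <;>
    split_ifs with hk
  · exact hv
  · exact h.le k
  · exact fun _ => by rw [hk]; exact ha
  · exact h.fst_lt k
  · exact fun _ => by rw [hk]; exact hi
  · exact h.snd_lt k

theorem coe_update_mem (μ : Mem) (k : ℕ × ℕ) (v : ℕ) :
    ⇑(Finsupp.update μ k v) = Function.update (⇑μ) k v := by
  ext j
  simp [Function.update_apply]

/-- A clamped program runs deterministically, with the effect `Prog.sem`, and in small space. -/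
theorem Prog.eval_clamped {B m : ℕ} (hB : 2 ≤ B) (c : Prog) (hc : c.Clamped) (h : ℕ) (s : Config)
    (hs : Inv B m s.mem) : ∃ s' : Config, c.eval h s = PMF.pure s' ∧ ⇑s'.mem = c.sem s.mem ∧
      Inv B m s'.mem ∧ s'.peak ≤ max s.peak (h + c.cost * Nat.size B + memBound B m) := by
  induction c generalizing h s with
  | skip => exact ⟨s, rfl, rfl, hs, le_max_left _ _⟩
  | assign a i e =>
    obtain ⟨hi, x, rfl⟩ := hc
    have hv : (Expr.mod x (.cell 4 (.const 0))).val s.mem ≤ B := by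
      simp only [Expr.val, hs.clamp]
      exact (Nat.mod_lt _ (by omega)).le
    have hlab := hs.label
    have hidx : i.val s.mem < 64 + m ∧ a ≠ 1 ∧ a ≠ 4 ∧ a < 16 := by
      rcases hi with ⟨ha, c, hc, rfl⟩ | ⟨ha, rfl⟩ <;> simp only [Expr.val] <;> omega
    obtain ⟨hidx, ha1, ha4, ha⟩ := hidx
    have hsm := hs.toSmall.update ha hidx hv
    refine ⟨_, rfl, ?_, ?_, ?_⟩
    · simp only [Config.write, Config.charge, Prog.sem, coe_update_mem, Expr.val_eq_ev]
    · simp only [Config.write, Config.charge, coe_update_mem]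
      refine ⟨hsm, ?_, ?_⟩
      · rw [Function.update_of_ne (by simp; omega), hs.clamp]
      · rwa [Function.update_of_ne (by simp; omega)]
    · have hb1 := hs.toSmall.bits_le
      have h1 := i.bits_le hB hs.le
      have h2 := (Expr.mod x (.cell 4 (.const 0))).bits_le hB hs.le
      rw [← coe_update_mem] at hsm
      have hb2 := hsm.bits_le
      simp only [Config.write, Config.charge, Prog.cost, add_mul] at *
      omega
  | draw a i e => exact hc.elim
  | seq c d ihc ihd =>
    obtain ⟨s₁, e₁, m₁, i₁, p₁⟩ := ihc hc.1 h s hs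
    obtain ⟨s₂, e₂, m₂, i₂, p₂⟩ := ihd hc.2 h s₁ i₁
    refine ⟨s₂, ?_, ?_, i₂, ?_⟩
    · simp [Prog.eval, e₁, e₂]
    · simp [Prog.sem, m₁, m₂]
    · simp only [Prog.cost, add_mul]
      omega
  | ite e c d ihc ihd =>
    have hb1 := hs.toSmall.bits_le
    have h1 := e.bits_le hB hs.le
    by_cases he : e.val s.mem ≠ 0
    · obtain ⟨s₁, e₁, m₁, i₁, p₁⟩ := ihc hc.1 h (s.charge (h + e.bits s.mem)) hs
      refine ⟨s₁, ?_, ?_, i₁, ?_⟩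
      · simp only [Prog.eval, if_pos he, e₁]
      · rw [m₁, Prog.sem, if_pos (by rwa [← Expr.val_eq_ev])]; rfl
      · simp only [Prog.cost, add_mul, Config.charge] at *
        omega
    · obtain ⟨s₁, e₁, m₁, i₁, p₁⟩ := ihd hc.2 h (s.charge (h + e.bits s.mem)) hs
      refine ⟨s₁, ?_, ?_, i₁, ?_⟩
      · simp only [Prog.eval, if_neg he, e₁]
      · rw [m₁, Prog.sem, if_neg (by rwa [← Expr.val_eq_ev])]; rfl
      · simp only [Prog.cost, add_mul, Config.charge] at *
        omega
  | loop e c ih =>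
    have hb1 := hs.toSmall.bits_le
    have h1 := e.bits_le hB hs.le
    have h2 := e.size_val_le hB hs.le
    have key : ∀ k : ℕ, ∃ s' : Config,
        (fun P : PMF Config => P.bind (c.eval (h + Nat.size (e.val s.mem))))^[k]
          (PMF.pure (s.charge (h + e.bits s.mem))) = PMF.pure s' ∧
        ⇑s'.mem = c.sem^[k] s.mem ∧ Inv B m s'.mem ∧
        s'.peak ≤ max s.peak (h + (Prog.loop e c).cost * Nat.size B + memBound B m) := by
      intro k
      induction k with
      | zero =>
        refine ⟨_, rfl, rfl, hs, ?_⟩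
        simp only [Prog.cost, add_mul, Config.charge] at *
        omega
      | succ k ihk =>
        obtain ⟨s₁, e₁, m₁, i₁, p₁⟩ := ihk
        obtain ⟨s₂, e₂, m₂, i₂, p₂⟩ := ih hc (h + Nat.size (e.val s.mem)) s₁ i₁
        refine ⟨s₂, ?_, ?_, i₂, ?_⟩
        · rw [Function.iterate_succ_apply', e₁, PMF.pure_bind, e₂]
        · rw [m₂, m₁, Function.iterate_succ_apply']
        · simp only [Prog.cost, add_mul] at *
          omega
    obtain ⟨s', e', m', i', p'⟩ := key (e.val s.mem)
    exact ⟨s', e', by rw [m', Prog.sem, Expr.val_eq_ev], i', p'⟩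

/-- Reading a datum overwrites cells `0, …, 6` of array `1`. -/
def readState {m : ℕ} (d : Fin m × ℚ × ℚ) (f : State) : State := fun k =>
  if k.1 = 1 ∧ k.2 < 7 then (encodeDatum d).getD k.2 0 else f k

theorem coe_read {m : ℕ} (d : Fin m × ℚ × ℚ) (s : Config) :
    ⇑(s.read d).mem = readState d s.mem := by
  ext ⟨a, i⟩
  simp only [Config.read, Config.charge, Mem.writeList, encodeDatum, encodeRat, readState,
    List.cons_append, List.nil_append, List.zipIdx_cons, List.zipIdx_nil, List.foldl_cons,
    List.foldl_nil, coe_update_mem, Function.update_apply, Prod.mk.injEq]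
  by_cases ha : a = 1
  · subst ha
    by_cases hi : i < 7
    · interval_cases i <;> simp
    · have : i ≠ 0 ∧ i ≠ 1 ∧ i ≠ 2 ∧ i ≠ 3 ∧ i ≠ 4 ∧ i ≠ 5 ∧ i ≠ 6 := by omega
      simp [this, hi]
  · simp [ha]

/-- All numbers of the encoding of a datum are at most `B`. -/
def DatumLe {m : ℕ} (B : ℕ) (d : Fin m × ℚ × ℚ) : Prop := ∀ v ∈ encodeDatum d, v ≤ B

theorem Inv.read {B m : ℕ} {f : State} (h : Inv B m f) {d : Fin m × ℚ × ℚ} (hd : DatumLe B d) :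
    Inv B m (readState d f) := by
  refine ⟨⟨fun k => ?_, fun k => ?_, fun k => ?_⟩, ?_, ?_⟩
  · simp only [readState]
    split_ifs with hk
    · have hl : k.2 < (encodeDatum d).length := by simpa [encodeDatum, encodeRat] using hk.2
      rw [List.getD_eq_getElem _ _ hl]
      exact hd _ (List.getElem_mem _)
    · exact h.le k
  · simp only [readState]
    split_ifs with hk
    · intro _; omega
    · exact h.fst_lt k
  · simp only [readState]
    split_ifs with hk
    · intro _; omega
    · exact h.snd_lt k
  · simpa [readState] using h.clamp
  · simp [readState, encodeDatum]

/-- The effect of one pass on the memory. -/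
def semScan {m : ℕ} (c : Prog) (σ : PointStream m) (f : State) : State :=
  σ.foldl (fun f d => c.sem (readState d f)) f

theorem foldl_bind {α β : Type*} (G : β → α → PMF α) (l : List β) (P : PMF α) :
    l.foldl (fun Q d => Q.bind (G d)) P =
      P.bind fun s => l.foldl (fun Q d => Q.bind (G d)) (PMF.pure s) := by
  induction l generalizing P with
  | nil => simp
  | cons d l ih =>
    simp only [List.foldl_cons, PMF.pure_bind]
    rw [ih, PMF.bind_bind]
    congr 1
    ext1 s
    rw [ih (G d s)]

theorem scan_clamped {B m : ℕ} (hB : 2 ≤ B) (c : Prog) (hc : c.Clamped) (σ : PointStream m)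
    (hσ : ∀ d ∈ σ, DatumLe B d) (s : Config) (hs : Inv B m s.mem) :
    ∃ s' : Config, scan c σ (PMF.pure s) = PMF.pure s' ∧ ⇑s'.mem = semScan c σ s.mem ∧
      Inv B m s'.mem ∧ s'.peak ≤ max s.peak (c.cost * Nat.size B + memBound B m) := by
  induction σ generalizing s with
  | nil => exact ⟨s, rfl, rfl, hs, le_max_left _ _⟩
  | cons d σ ih =>
    have hr := hs.read (hσ d (by simp))
    rw [← coe_read] at hr
    obtain ⟨s₁, e₁, m₁, i₁, p₁⟩ := c.eval_clamped hB hc 0 (s.read d) hr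
    obtain ⟨s₂, e₂, m₂, i₂, p₂⟩ := ih (fun d hd => hσ d (by simp [hd])) s₁ i₁
    refine ⟨s₂, ?_, ?_, i₂, ?_⟩
    · rw [scan, List.foldl_cons, PMF.pure_bind, e₁]
      exact e₂
    · rw [m₂, m₁, coe_read]
      rfl
    · have hb := hr.toSmall.bits_le
      have : (s.read d).peak = max s.peak (0 + (s.read d).mem.bits) := rfl
      omega

/-- The effect of all passes on the memory. -/
def StreamAlg.sem {k m : ℕ} (𝒜 : StreamAlg k) (σ : PointStream m) (f : State) : State :=
  (List.finRange k).foldl (fun f j => (𝒜.post j).sem (semScan (𝒜.step j) σ f)) f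

/-- A factor bounding the work space of the passes. -/
def StreamAlg.passCost {k : ℕ} (𝒜 : StreamAlg k) : ℕ :=
  ∑ j, ((𝒜.step j).cost + (𝒜.post j).cost)

/-- Running all passes from a fixed configuration. -/
noncomputable def StreamAlg.passes {k m : ℕ} (𝒜 : StreamAlg k) (σ : PointStream m)
    (P : PMF Config) :
    PMF Config :=
  (List.finRange k).foldl (fun P j => (scan (𝒜.step j) σ P).bind ((𝒜.post j).eval 0)) P

theorem StreamAlg.passes_bind {k m : ℕ} (𝒜 : StreamAlg k) (σ : PointStream m) (P : PMF Config) :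
    𝒜.passes σ P = P.bind fun s => 𝒜.passes σ (PMF.pure s) := by
  have hG : ∀ (Q : PMF Config) (j : Fin k), (scan (𝒜.step j) σ Q).bind ((𝒜.post j).eval 0) =
      Q.bind fun s => (scan (𝒜.step j) σ (PMF.pure s)).bind ((𝒜.post j).eval 0) := by
    intro Q j
    rw [← PMF.bind_bind]
    congr 1
    exact foldl_bind _ _ _
  simp only [StreamAlg.passes]
  rw [show (fun (Q : PMF Config) (j : Fin k) =>
      (scan (𝒜.step j) σ Q).bind ((𝒜.post j).eval 0)) = _ from funext₂ hG]
  exact foldl_bind (fun j s => (scan (𝒜.step j) σ (PMF.pure s)).bind ((𝒜.post j).eval 0)) _ P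

theorem StreamAlg.passes_clamped {B k m : ℕ} (hB : 2 ≤ B) (𝒜 : StreamAlg k)
    (hstep : ∀ j, (𝒜.step j).Clamped) (hpost : ∀ j, (𝒜.post j).Clamped) (σ : PointStream m)
    (hσ : ∀ d ∈ σ, DatumLe B d) (s : Config) (hs : Inv B m s.mem) :
    ∃ s' : Config, 𝒜.passes σ (PMF.pure s) = PMF.pure s' ∧ ⇑s'.mem = 𝒜.sem σ s.mem ∧
      s'.peak ≤ max s.peak (𝒜.passCost * Nat.size B + memBound B m) := by
  have hcost : ∀ j, (𝒜.step j).cost + (𝒜.post j).cost ≤ 𝒜.passCost := fun j =>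
    Finset.single_le_sum (f := fun j => (𝒜.step j).cost + (𝒜.post j).cost)
      (fun _ _ => Nat.zero_le _) (Finset.mem_univ j)
  have key : ∀ (l : List (Fin k)) (s : Config), Inv B m s.mem → ∃ s' : Config,
      l.foldl (fun P j => (scan (𝒜.step j) σ P).bind ((𝒜.post j).eval 0)) (PMF.pure s) =
        PMF.pure s' ∧
      ⇑s'.mem = l.foldl (fun f j => (𝒜.post j).sem (semScan (𝒜.step j) σ f)) s.mem ∧
      s'.peak ≤ max s.peak (𝒜.passCost * Nat.size B + memBound B m) := by
    intro l
    induction l with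
    | nil => exact fun s _ => ⟨s, rfl, rfl, le_max_left _ _⟩
    | cons j l ih =>
      intro s hs
      obtain ⟨s₁, e₁, m₁, i₁, p₁⟩ := scan_clamped hB _ (hstep j) σ hσ s hs
      obtain ⟨s₂, e₂, m₂, i₂, p₂⟩ := (𝒜.post j).eval_clamped hB (hpost j) 0 s₁ i₁
      obtain ⟨s₃, e₃, m₃, p₃⟩ := ih s₂ i₂
      refine ⟨s₃, ?_, ?_, ?_⟩
      · rw [List.foldl_cons, e₁, PMF.pure_bind, e₂, e₃]
      · rw [m₃, m₂, m₁, List.foldl_cons]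
      · have := Nat.mul_le_mul_right (Nat.size B) (hcost j)
        rw [add_mul] at this
        omega
  exact key _ s hs

/-! ### Frame rules -/

/-- `c.avoids k`: on syntactic grounds the program `c` does not write to the cell `k`. -/
def Prog.avoids : Prog → ℕ × ℕ → Prop
  | .skip, _ => True
  | .assign a (.const i) _, k => (a, i) ≠ k
  | .assign a _ _, k => a ≠ k.1
  | .draw _ _ _, _ => True
  | .seq c d, k => c.avoids k ∧ d.avoids k
  | .ite _ c d, k => c.avoids k ∧ d.avoids k
  | .loop _ c, k => c.avoids k

theorem iterate_avoids {c : Prog} {k : ℕ × ℕ} (h : ∀ f, c.sem f k = f k) (N : ℕ) (f : State) :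
    c.sem^[N] f k = f k := by
  induction N with
  | zero => rfl
  | succ N ih => rw [Function.iterate_succ_apply', h, ih]

theorem Prog.sem_of_avoids (c : Prog) (k : ℕ × ℕ) (h : c.avoids k) (f : State) :
    c.sem f k = f k := by
  induction c generalizing f with
  | skip => rfl
  | draw a i e => rfl
  | assign a i e =>
    have : k ≠ (a, i.ev f) := by
      cases i with
      | const c => exact fun h' => h h'.symm
      | _ => exact fun h' => h (congrArg Prod.fst h').symm
    simp [Prog.sem, Function.update_of_ne this]
  | seq c d ihc ihd => rw [Prog.sem, ihd h.2, ihc h.1]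
  | ite e c d ihc ihd =>
    rw [Prog.sem]
    split_ifs
    exacts [ihc h.1 f, ihd h.2 f]
  | loop e c ih => exact iterate_avoids (fun f => ih h f) _ f

/-- A clamped program leaves the arrays `0`, `1` and `4` alone. -/
theorem Prog.sem_fixed (c : Prog) (hc : c.Clamped) (f : State) (a i : ℕ)
    (h : a = 0 ∨ a = 1 ∨ a = 4) : c.sem f (a, i) = f (a, i) := by
  induction c generalizing f with
  | skip => rfl
  | draw _ _ _ => rfl
  | assign a' i' e =>
    refine Function.update_of_ne ?_ _ _
    rw [ne_eq, Prod.mk.injEq]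
    rcases hc.1 with ⟨ha', -⟩ | ⟨ha', -⟩ <;> omega
  | seq c d ihc ihd => rw [Prog.sem, ihd hc.2, ihc hc.1]
  | ite e c d ihc ihd =>
    rw [Prog.sem]
    split_ifs
    exacts [ihc hc.1 f, ihd hc.2 f]
  | loop e c ih => exact iterate_avoids (fun f => ih hc f) _ f

/-- Outside the scratch array `3`, a clamped program leaves the cells of other labels alone. -/
theorem Prog.sem_other (c : Prog) (hc : c.Clamped) (f : State) (a i : ℕ) (ha : a ≠ 3)
    (h : i ≠ f (1, 0)) : c.sem f (a, i) = f (a, i) := by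
  induction c generalizing f with
  | skip => rfl
  | draw _ _ _ => rfl
  | assign a' i' e =>
    refine Function.update_of_ne ?_ _ _
    rw [ne_eq, Prod.mk.injEq]
    rcases hc.1 with ⟨ha', -⟩ | ⟨ha', rfl⟩
    · omega
    · exact fun hai => h hai.2
  | seq c d ihc ihd =>
    rw [Prog.sem, ihd hc.2 _ (by rwa [c.sem_fixed hc.1 f 1 0 (by simp)]), ihc hc.1 f h]
  | ite e c d ihc ihd =>
    rw [Prog.sem]
    split_ifs
    exacts [ihc hc.1 f h, ihd hc.2 f h]
  | loop e c ih =>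
    rw [Prog.sem]
    induction e.ev f with
    | zero => rfl
    | succ N ihN =>
      rw [Function.iterate_succ_apply', ih hc _ ?_, ihN]
      rwa [iterate_avoids (fun f => c.sem_fixed hc f 1 0 (by simp))]

/-- Loop rule: an invariant indexed by the number of rounds; cells that the body does not write
keep their values throughout. -/
theorem Prog.loop_rule {e : Expr} {c : Prog} {f : State} (I : ℕ → State → Prop) (h0 : I 0 f)
    (hstep : ∀ k g, k < e.ev f → (∀ x, c.avoids x → g x = f x) → I k g → I (k + 1) (c.sem g)) :
    I (e.ev f) ((Prog.loop e c).sem f) := by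
  have key : ∀ N ≤ e.ev f, I N (c.sem^[N] f) := by
    intro N hN
    induction N with
    | zero => exact h0
    | succ N ih =>
      rw [Function.iterate_succ_apply']
      exact hstep N _ hN (fun x hx => iterate_avoids (c.sem_of_avoids x hx) N f) (ih (by omega))
  exact key _ le_rfl

/-! ### Congruences of Gaussian integers modulo powers of three -/

/-- Congruence of Gaussian integers modulo a natural number. -/
def Cong (M : ℕ) (a b : GaussianInt) : Prop := (M : GaussianInt) ∣ a - b

namespace Cong

variable {M : ℕ} {a b c d : GaussianInt}

theorem refl (M : ℕ) (a : GaussianInt) : Cong M a a := by simp [Cong]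

theorem symm (h : Cong M a b) : Cong M b a := by
  obtain ⟨u, hu⟩ := h
  exact ⟨-u, by linear_combination -hu⟩

theorem trans (h : Cong M a b) (h' : Cong M b c) : Cong M a c := by
  obtain ⟨u, hu⟩ := h
  obtain ⟨v, hv⟩ := h'
  exact ⟨u + v, by linear_combination hu + hv⟩

theorem add (h : Cong M a b) (h' : Cong M c d) : Cong M (a + c) (b + d) := by
  obtain ⟨u, hu⟩ := h
  obtain ⟨v, hv⟩ := h'
  exact ⟨u + v, by linear_combination hu + hv⟩

theorem sub (h : Cong M a b) (h' : Cong M c d) : Cong M (a - c) (b - d) := by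
  obtain ⟨u, hu⟩ := h
  obtain ⟨v, hv⟩ := h'
  exact ⟨u - v, by linear_combination hu - hv⟩

theorem mul (h : Cong M a b) (h' : Cong M c d) : Cong M (a * c) (b * d) := by
  obtain ⟨u, hu⟩ := h
  obtain ⟨v, hv⟩ := h'
  exact ⟨u * c + b * v, by linear_combination c * hu + b * hv⟩

theorem mul_left (c : GaussianInt) (h : Cong M a b) : Cong M (c * a) (c * b) :=
  (refl M c).mul h

theorem mul_right (c : GaussianInt) (h : Cong M a b) : Cong M (a * c) (b * c) :=
  h.mul (refl M c)

theorem pow (h : Cong M a b) (k : ℕ) : Cong M (a ^ k) (b ^ k) :=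
  Dvd.dvd.trans h (sub_dvd_pow_sub_pow a b k)

theorem star (h : Cong M a b) : Cong M (star a) (star b) := by
  obtain ⟨u, hu⟩ := h
  refine ⟨Star.star u, ?_⟩
  rw [← star_sub, hu, star_mul', star_natCast]

theorem of_dvd {M' : ℕ} (hd : M' ∣ M) (h : Cong M a b) : Cong M' a b :=
  (Nat.cast_dvd_cast hd).trans h

end Cong

theorem natCast_dvd_iff (M : ℕ) (a : GaussianInt) :
    (M : GaussianInt) ∣ a ↔ (M : ℤ) ∣ a.re ∧ (M : ℤ) ∣ a.im := by
  simpa using Zsqrtd.intCast_dvd (M : ℤ) a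

theorem natCast_dvd_natCast_gaussian (a b : ℕ) : (a : GaussianInt) ∣ b ↔ a ∣ b := by
  rw [natCast_dvd_iff]
  simp [Int.natCast_dvd_natCast]

theorem natCast_dvd_intCast_gaussian (a : ℕ) (b : ℤ) : (a : GaussianInt) ∣ b ↔ (a : ℤ) ∣ b := by
  rw [natCast_dvd_iff]
  simp

/-- Three is inert in the Gaussian integers. -/
theorem prime_three : Prime (3 : GaussianInt) := by
  have : Fact (Nat.Prime 3) := ⟨Nat.prime_three⟩
  exact_mod_cast GaussianInt.prime_of_nat_prime_of_mod_four_eq_three 3 rfl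

theorem norm_coe (a : GaussianInt) : ((a.norm : ℤ) : GaussianInt) = a * star a :=
  Zsqrtd.norm_eq_mul_conj a

theorem cong_norm_iff {M : ℕ} {a : GaussianInt} :
    (M : ℤ) ∣ a.norm - 1 ↔ Cong M (a * star a) 1 := by
  rw [Cong, ← norm_coe, ← natCast_dvd_intCast_gaussian]
  push_cast
  rfl

theorem pow_dvd_of_not_pow_dvd {R : Type*} [CommRing R] [IsDomain R] {π : R} (hπ : Prime π)
    (a b : ℕ) (k x : R) (hk : ¬ π ^ a ∣ k) (h : π ^ (a + b) ∣ k * x) : π ^ b ∣ x := by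
  induction a generalizing k with
  | zero => simp at hk
  | succ a ih =>
    by_cases hd : π ∣ k
    · obtain ⟨k', rfl⟩ := hd
      refine ih k' (fun hc => hk ?_) ?_
      · rw [pow_succ']; exact mul_dvd_mul_left _ hc
      · rw [show a + 1 + b = (a + b) + 1 by ring, pow_succ', mul_assoc] at h
        exact (mul_dvd_mul_iff_left hπ.ne_zero).1 h
    · exact (pow_dvd_pow π (by omega)).trans (hπ.pow_dvd_of_dvd_mul_left _ hd h)

/-- Lifting the exponent: if `x ≡ 1` modulo `3` then `x ^ k - 1` is no more divisible by `3` than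
`k * (x - 1)`. -/
theorem three_pow_dvd_of_dvd_pow_sub_one (x : GaussianInt) (hx : (3 : GaussianInt) ∣ x - 1)
    (k e : ℕ) (hk : 1 ≤ k) (h : (3 : GaussianInt) ^ e ∣ x ^ k - 1) :
    (3 : GaussianInt) ^ e ∣ k * (x - 1) := by
  induction k using Nat.strong_induction_on generalizing e with
  | _ k ih =>
    by_cases h3 : 3 ∣ k
    · obtain ⟨j, rfl⟩ := h3
      obtain _ | e := e
      · simp
      obtain ⟨c, hc⟩ : (3 : GaussianInt) ∣ x ^ j - 1 :=
        hx.trans (by simpa using sub_dvd_pow_sub_pow x 1 j)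
      -- with `y = x ^ j = 1 + 3 c` one has `y ^ 3 - 1 = 3 (y - 1) (1 + 3 (c + c ^ 2))`
      have hfac : x ^ (3 * j) - 1 = (1 + 3 * (c + c ^ 2)) * (3 * (x ^ j - 1)) := by
        have hy : x ^ j = 1 + 3 * c := by linear_combination hc
        rw [mul_comm 3 j, pow_mul, hy]
        ring
      have hu : ¬ (3 : GaussianInt) ∣ 1 + 3 * (c + c ^ 2) := fun hd =>
        prime_three.not_dvd_one ((Nat.cast_ofNat (R := GaussianInt) (n := 3)) ▸
          (dvd_add_left (Dvd.intro _ rfl)).1 hd)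
      rw [hfac] at h
      have h' := prime_three.pow_dvd_of_dvd_mul_left _ hu h
      rw [pow_succ', mul_dvd_mul_iff_left prime_three.ne_zero] at h'
      have := ih j (by omega) e (by omega) h'
      rw [pow_succ']
      push_cast
      rw [mul_assoc]
      exact mul_dvd_mul_left _ this
    · obtain ⟨c, hc⟩ : (x - 1) ∣ (∑ i ∈ Finset.range k, x ^ i) - k := by
        rw [show ((k : ℕ) : GaussianInt) = ∑ i ∈ Finset.range k, 1 ^ i by simp,
          ← Finset.sum_sub_distrib]
        exact Finset.dvd_sum fun i _ => sub_dvd_pow_sub_pow x 1 i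
      have hu : ¬ (3 : GaussianInt) ∣ ∑ i ∈ Finset.range k, x ^ i := by
        intro hd
        rw [show ∑ i ∈ Finset.range k, x ^ i = k + (x - 1) * c by linear_combination hc,
          dvd_add_left (hx.mul_right c)] at hd
        exact h3 ((natCast_dvd_natCast_gaussian 3 k).1 (by exact_mod_cast hd))
      rw [← geom_sum_mul] at h
      exact (prime_three.pow_dvd_of_dvd_mul_left _ hu h).mul_left _

/-- The imaginary unit. -/
def iunit : GaussianInt := ⟨0, 1⟩

theorem iunit_sq : iunit * iunit = -1 := by ext <;> simp [iunit]

theorem iunit_pow_four : iunit ^ 4 = 1 := by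
  linear_combination (iunit * iunit - 1) * iunit_sq

theorem exists_iunit_pow_of_norm {η : GaussianInt} (h : (3 : ℤ) ∣ η.norm - 1) :
    ∃ t < 4, (3 : GaussianInt) ∣ η - iunit ^ t := by
  have key : ∀ t, (3 : GaussianInt) ∣ η - iunit ^ t ↔
      (3 : ℤ) ∣ η.re - (iunit ^ t).re ∧ (3 : ℤ) ∣ η.im - (iunit ^ t).im := fun t => by
    simpa using natCast_dvd_iff 3 (η - iunit ^ t)
  rw [Zsqrtd.norm_def] at h
  have h2 : iunit ^ 2 = -1 := by rw [sq, iunit_sq]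
  have h3 : iunit ^ 3 = -iunit := by rw [pow_succ, h2]; ring
  have hm : (η.re * η.re + η.im * η.im - 1) % 3 = 0 :=
    Int.emod_eq_zero_of_dvd (by convert h using 1; ring)
  have h0 := key 0
  have h1 := key 1
  rw [pow_zero] at h0
  rw [pow_one] at h1
  have h2' := key 2
  have h3' := key 3
  rw [h2] at h2'
  rw [h3] at h3'
  simp only [iunit, Zsqrtd.re_one, Zsqrtd.im_one, Zsqrtd.re_neg, Zsqrtd.im_neg] at h0 h1 h2' h3'
  have hr : η.re % 3 = 0 ∨ η.re % 3 = 1 ∨ η.re % 3 = 2 := by omega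
  have hi : η.im % 3 = 0 ∨ η.im % 3 = 1 ∨ η.im % 3 = 2 := by omega
  rcases hr with hr | hr | hr <;> rcases hi with hi | hi | hi <;>
    simp [Int.sub_emod, Int.add_emod, Int.mul_emod, hr, hi] at hm
  · exact ⟨1, by norm_num, by rw [pow_one]; exact h1.2 (by omega)⟩
  · exact ⟨3, by norm_num, by rw [h3]; exact h3'.2 (by omega)⟩
  · exact ⟨0, by norm_num, by rw [pow_zero]; exact h0.2 (by omega)⟩
  · exact ⟨2, by norm_num, by rw [h2]; exact h2'.2 (by omega)⟩

theorem cast_three_pow (p c : ℕ) : (((3 ^ p) ^ c : ℕ) : GaussianInt) = 3 ^ (c * p) := by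
  push_cast
  rw [← pow_mul, mul_comm]

/-- An element of norm one with `η ^ k = 1`, `k < 3 ^ p`, is a fourth root of unity; taken modulo a
power of three, `p` digits of precision are lost. -/
theorem exists_cong_iunit_pow {p : ℕ} (hp : 1 ≤ p) {η : GaussianInt} {k : ℕ} (hk : 1 ≤ k)
    (hkP : k < 3 ^ p) (hn : Cong ((3 ^ p) ^ 21) (η * star η) 1)
    (h : Cong ((3 ^ p) ^ 21) (η ^ k) 1) :
    ∃ t < 4, Cong ((3 ^ p) ^ 20) η (iunit ^ t) := by
  have h3 : (3 : ℤ) ∣ η.norm - 1 :=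
    Dvd.dvd.trans (by push_cast; exact dvd_pow (dvd_pow_self _ (by omega)) (by omega))
      (cong_norm_iff.2 hn)
  obtain ⟨t, ht, htd⟩ := exists_iunit_pow_of_norm h3
  refine ⟨t, ht, ?_⟩
  have hinv : iunit ^ t * iunit ^ (4 - t) = 1 := by
    rw [← pow_add, show t + (4 - t) = 4 by omega, iunit_pow_four]
  set x := η * iunit ^ (4 - t) with hx
  have hx1 : (3 : GaussianInt) ∣ x - 1 := by
    have : x - 1 = (η - iunit ^ t) * iunit ^ (4 - t) := by rw [hx]; linear_combination hinv
    rw [this]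
    exact htd.mul_right _
  have hxk : (3 : GaussianInt) ^ (21 * p) ∣ x ^ (4 * k) - 1 := by
    have h4 : x ^ (4 * k) = (η ^ k) ^ 4 := by
      rw [hx, mul_pow, ← pow_mul, show (4 - t) * (4 * k) = 4 * ((4 - t) * k) by ring,
        pow_mul iunit, iunit_pow_four, one_pow, mul_one, ← pow_mul, mul_comm k]
    rw [h4, ← cast_three_pow]
    simpa [Cong] using h.pow 4
  have hdvd := three_pow_dvd_of_dvd_pow_sub_one x hx1 (4 * k) (21 * p) (by omega) hxk
  have hnk : ¬ (3 : GaussianInt) ^ p ∣ ((4 * k : ℕ) : GaussianInt) := by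
    intro hd
    have h' : 3 ^ p ∣ 4 * k := (natCast_dvd_natCast_gaussian _ _).1 (by push_cast at hd ⊢; exact hd)
    have h'' : 3 ^ p ∣ k := (Nat.Coprime.pow_left p (by norm_num)).dvd_of_dvd_mul_left h'
    exact absurd (Nat.le_of_dvd (by omega) h'') (by omega)
  have hfin := pow_dvd_of_not_pow_dvd prime_three p (20 * p) _ _ hnk
    (by rwa [show p + 20 * p = 21 * p by ring])
  rw [Cong, cast_three_pow]
  have : η - iunit ^ t = (x - 1) * iunit ^ t := by
    rw [hx]; linear_combination (-η) * hinv
  rw [this]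
  exact hfin.mul_right _

/-! ### Reduced residues -/

/-- A pair of natural numbers as a Gaussian integer. -/
def toG (x : ℕ × ℕ) : GaussianInt := ⟨x.1, x.2⟩

/-- The reduced residue of a Gaussian integer, as a pair of natural numbers below `M`. -/
def red (M : ℕ) (a : GaussianInt) : ℕ × ℕ := ((a.re % M).toNat, (a.im % M).toNat)

theorem toG_red {M : ℕ} (hM : 0 < M) (a : GaussianInt) : Cong M (toG (red M a)) a := by
  have h1 := Int.emod_nonneg a.re (by omega : (M : ℤ) ≠ 0)
  have h2 := Int.emod_nonneg a.im (by omega : (M : ℤ) ≠ 0)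
  rw [Cong, natCast_dvd_iff]
  simp only [toG, red, Zsqrtd.re_sub, Zsqrtd.im_sub, Int.toNat_of_nonneg h1, Int.toNat_of_nonneg h2]
  exact ⟨⟨-(a.re / M), by linear_combination Int.mul_ediv_add_emod a.re M⟩,
    ⟨-(a.im / M), by linear_combination Int.mul_ediv_add_emod a.im M⟩⟩

theorem red_eq_red {M : ℕ} (hM : 0 < M) {a b : GaussianInt} : red M a = red M b ↔ Cong M a b := by
  have h1 := Int.emod_nonneg a.re (by omega : (M : ℤ) ≠ 0)
  have h2 := Int.emod_nonneg a.im (by omega : (M : ℤ) ≠ 0)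
  have h3 := Int.emod_nonneg b.re (by omega : (M : ℤ) ≠ 0)
  have h4 := Int.emod_nonneg b.im (by omega : (M : ℤ) ≠ 0)
  rw [Cong, natCast_dvd_iff, Zsqrtd.re_sub, Zsqrtd.im_sub,
    Int.dvd_iff_emod_eq_zero, Int.dvd_iff_emod_eq_zero, ← Int.emod_eq_emod_iff_emod_sub_eq_zero,
    ← Int.emod_eq_emod_iff_emod_sub_eq_zero, red, red, Prod.mk.injEq]
  omega

theorem red_lt {M : ℕ} (hM : 0 < M) (a : GaussianInt) : (red M a).1 < M ∧ (red M a).2 < M := by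
  have h1 := Int.emod_lt_of_pos a.re (by omega : (0 : ℤ) < M)
  have h2 := Int.emod_lt_of_pos a.im (by omega : (0 : ℤ) < M)
  have h3 := Int.emod_nonneg a.re (by omega : (M : ℤ) ≠ 0)
  have h4 := Int.emod_nonneg a.im (by omega : (M : ℤ) ≠ 0)
  simp only [red]
  omega

theorem red_toG {M : ℕ} {x : ℕ × ℕ} (h1 : x.1 < M) (h2 : x.2 < M) : red M (toG x) = x := by
  simp only [red, toG, ← Int.natCast_mod, Int.toNat_natCast, Nat.mod_eq_of_lt h1,
    Nat.mod_eq_of_lt h2]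

/-! ### The rotation normalizer -/

/-- Position of a reduced residue in the enumeration of all of them. -/
def code (M : ℕ) (x : ℕ × ℕ) : ℕ := x.1 + M * x.2

theorem code_injective {M : ℕ} {x y : ℕ × ℕ} (hx : x.1 < M) (hy : y.1 < M)
    (h : code M x = code M y) : x = y := by
  have h1 := congrArg (· % M) h
  simp only [code, Nat.add_mul_mod_self_left, Nat.mod_eq_of_lt hx, Nat.mod_eq_of_lt hy] at h1
  have h2 : M * x.2 = M * y.2 := by simp only [code] at h; omega
  exact Prod.ext h1 (Nat.eq_of_mul_eq_mul_left (by omega) h2)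

theorem code_lt {M : ℕ} {x : ℕ × ℕ} (h1 : x.1 < M) (h2 : x.2 < M) : code M x < M ^ 2 := by
  simp only [code]
  nlinarith

/-- The residue at position `c` of the enumeration. -/
def uncode (M c : ℕ) : ℕ × ℕ := (c % M, c / M)

/-- `x` has norm one modulo `M`. -/
def NormOne (M : ℕ) (x : ℕ × ℕ) : Prop := (x.1 * x.1 + x.2 * x.2) % M = 1

instance (M : ℕ) (x : ℕ × ℕ) : Decidable (NormOne M x) := inferInstanceAs (Decidable (_ = _))

theorem normOne_iff {M : ℕ} (hM : 1 < M) (x : ℕ × ℕ) :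
    NormOne M x ↔ Cong M (toG x * star (toG x)) 1 := by
  rw [← cong_norm_iff, NormOne, Zsqrtd.norm_def, toG]
  have : ((x.1 : ℤ) * x.1 - -1 * x.2 * x.2 - 1) = ((x.1 * x.1 + x.2 * x.2 : ℕ) : ℤ) - 1 := by
    push_cast; ring
  rw [this]
  have h' := Nat.modEq_iff_dvd (n := M) (a := 1) (b := x.1 * x.1 + x.2 * x.2)
  rw [Nat.cast_one] at h'
  rw [← h', Nat.ModEq, Nat.mod_eq_of_lt hM, eq_comm]

/-- The value minimized by the normalizer: the position of `s ^ k * d` for the residue `s` at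
position `c`. -/
def score (M k : ℕ) (d : ℕ × ℕ) (c : ℕ) : ℕ :=
  code M (red M (toG (uncode M c) ^ k * toG d))

/-- Linear search for the first position of norm one with least score; the state is the least
score so far (`M ^ 2` if none) and the position where it is attained. -/
def search (M k : ℕ) (d : ℕ × ℕ) : ℕ → ℕ × ℕ
  | 0 => (M ^ 2, 1)
  | c + 1 =>
    if NormOne M (uncode M c) ∧ score M k d c < (search M k d c).1 then (score M k d c, c)
    else search M k d c

/-- The element `s` of norm one for which `s ^ k * d` comes first in the enumeration. -/
def normalizer (M k : ℕ) (d : ℕ × ℕ) : ℕ × ℕ := uncode M (search M k d (M ^ 2)).2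

theorem score_lt {M : ℕ} (hM : 0 < M) (k : ℕ) (d : ℕ × ℕ) (c : ℕ) : score M k d c < M ^ 2 :=
  code_lt (red_lt hM _).1 (red_lt hM _).2

theorem search_spec {M : ℕ} (hM : 1 < M) (k : ℕ) (d : ℕ × ℕ) (N : ℕ) (hN : N ≤ M ^ 2) :
    (∀ c < N, NormOne M (uncode M c) → (search M k d N).1 ≤ score M k d c) ∧
    NormOne M (uncode M (search M k d N).2) ∧ (search M k d N).2 < M ^ 2 ∧
    ((search M k d N).1 = M ^ 2 ∨ (search M k d N).1 = score M k d (search M k d N).2) := by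
  induction N with
  | zero =>
    refine ⟨by simp, ?_, ?_, Or.inl rfl⟩
    · simp [search, NormOne, uncode, Nat.mod_eq_of_lt hM, Nat.div_eq_of_lt hM]
    · simp only [search]; nlinarith
  | succ N ih =>
    obtain ⟨h1, h2, h3, h4⟩ := ih (by omega)
    rw [search]
    split_ifs with hc
    · refine ⟨fun c hcN hc' => ?_, hc.1, by simp only []; omega, Or.inr rfl⟩
      rcases Nat.lt_succ_iff_lt_or_eq.1 hcN with hlt | rfl
      · exact hc.2.le.trans (h1 c hlt hc')
      · exact le_rfl
    · refine ⟨fun c hcN hc' => ?_, h2, h3, h4⟩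
      rcases Nat.lt_succ_iff_lt_or_eq.1 hcN with hlt | rfl
      · exact h1 c hlt hc'
      · by_contra hlt
        exact hc ⟨hc', by omega⟩

theorem uncode_code {M : ℕ} {x : ℕ × ℕ} (hx : x.1 < M) : uncode M (code M x) = x := by
  have hM : 0 < M := by omega
  simp [uncode, code, Nat.add_mul_div_left _ _ hM, Nat.div_eq_of_lt hx, Nat.mod_eq_of_lt hx]

theorem normalizer_normOne {M : ℕ} (hM : 1 < M) (k : ℕ) (d : ℕ × ℕ) :
    NormOne M (normalizer M k d) :=
  (search_spec hM k d _ le_rfl).2.1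

/-- The normalizer is optimal among all elements of norm one. -/
theorem normalizer_le {M : ℕ} (hM : 1 < M) (k : ℕ) (d : ℕ × ℕ) {s : GaussianInt}
    (hs : Cong M (s * star s) 1) :
    code M (red M (toG (normalizer M k d) ^ k * toG d)) ≤ code M (red M (s ^ k * toG d)) := by
  have hM0 : 0 < M := by omega
  obtain ⟨h1, h2, h3, h4⟩ := search_spec hM k d _ le_rfl
  have hr := toG_red hM0 s
  have hlt := red_lt hM0 s
  have hn : NormOne M (red M s) := (normOne_iff hM _).2 ((hr.mul hr.star).trans hs)
  have hle := h1 (code M (red M s)) (code_lt hlt.1 hlt.2) (by rwa [uncode_code hlt.1])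
  have hsc : score M k d (code M (red M s)) = code M (red M (s ^ k * toG d)) := by
    rw [score, uncode_code hlt.1, (red_eq_red hM0).2 ((hr.pow k).mul_right _)]
  have hlt' := score_lt hM0 k d (code M (red M s))
  rw [← hsc]
  change score M k d (search M k d (M ^ 2)).2 ≤ _
  rcases h4 with h4 | h4 <;> omega

/-- If `d'` differs from `d` by the `k`-th power of an element of norm one, then the normalizers
bring both to the same residue. -/
theorem normalizer_cong {M : ℕ} (hM : 1 < M) (k : ℕ) {d d' : ℕ × ℕ} {r : GaussianInt}
    (hr : Cong M (r * star r) 1) (hd : Cong M (toG d') (r ^ k * toG d)) :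
    Cong M (toG (normalizer M k d') ^ k * toG d') (toG (normalizer M k d) ^ k * toG d) := by
  have hM0 : 0 < M := by omega
  set s := toG (normalizer M k d)
  set s' := toG (normalizer M k d')
  have hs : Cong M (s * star s) 1 := (normOne_iff hM _).1 (normalizer_normOne hM k d)
  have hs' : Cong M (s' * star s') 1 := (normOne_iff hM _).1 (normalizer_normOne hM k d')
  have hd' : Cong M (toG d) (star r ^ k * toG d') := by
    have h1 := hd.mul_left (star r ^ k)
    have h2 := (hr.pow k).mul_right (toG d)
    rw [one_pow, one_mul] at h2
    refine (h1.trans ?_).symm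
    convert h2 using 1
    rw [mul_pow]; ring
  have hone : ∀ a b : GaussianInt, Cong M (a * star a) 1 → Cong M (b * star b) 1 →
      Cong M (a * b * star (a * b)) 1 := by
    intro a b ha hb
    have := ha.mul hb
    rw [one_mul] at this
    convert this using 1
    rw [star_mul']; ring
  have le1 := normalizer_le hM k d (hone s' r hs' hr)
  have le2 := normalizer_le hM k d' (hone s (star r) hs (by rwa [star_star, mul_comm]))
  have e1 : Cong M ((s' * r) ^ k * toG d) (s' ^ k * toG d') := by
    rw [mul_pow, mul_assoc]; exact (hd.symm).mul_left _
  have e2 : Cong M ((s * star r) ^ k * toG d') (s ^ k * toG d) := by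
    rw [mul_pow, mul_assoc]; exact (hd'.symm).mul_left _
  rw [(red_eq_red hM0).2 e1] at le1
  rw [(red_eq_red hM0).2 e2] at le2
  exact (red_eq_red hM0).1
    (code_injective (red_lt hM0 _).1 (red_lt hM0 _).1 (le_antisymm le2 le1))

/-! ### Canonical position up to quarter turns -/

/-- Divide both coordinates by `3` if possible. -/
def strip (x : ℕ × ℕ) : ℕ × ℕ := if x.1 % 3 = 0 ∧ x.2 % 3 = 0 then (x.1 / 3, x.2 / 3) else x

/-- The part prime to `3` of a residue that is not divisible by `P ^ 21`; here and below `P` is a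
power of three. -/
def unitPart (P : ℕ) (x : ℕ × ℕ) : ℕ × ℕ := strip^[P ^ 21] x

/-- The residue is not divisible by `P ^ 21`. -/
def Live (P : ℕ) (x : ℕ × ℕ) : Prop := x.1 % P ^ 21 + x.2 % P ^ 21 ≠ 0

instance (P : ℕ) : DecidablePred (Live P) := fun _ => inferInstanceAs (Decidable (_ ≠ _))

/-- Number of residues not divisible by `P ^ 21`. -/
def liveCount (P : ℕ) (W : Multiset (ℕ × ℕ)) : ℕ := (W.filter (Live P)).card

/-- Product of the parts prime to `3` of the residues not divisible by `P ^ 21`. -/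
def unitProd (P : ℕ) (W : Multiset (ℕ × ℕ)) : GaussianInt :=
  ((W.filter (Live P)).map fun x => toG (unitPart P x)).prod

/-- The element of norm one that turns a multiset of residues into canonical position. -/
def turn (P : ℕ) (W : Multiset (ℕ × ℕ)) : ℕ × ℕ :=
  normalizer (P ^ 21) (liveCount P W) (red (P ^ 21) (unitProd P W))

/-- The multiset of residues in canonical position, followed by `t` quarter turns, to the
precision `P ^ 20`. -/
def canon (P t : ℕ) (W : Multiset (ℕ × ℕ)) : Multiset (ℕ × ℕ) :=
  W.map fun w => red (P ^ 20) (iunit ^ t * toG (turn P W) * toG w)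

theorem three_dvd_toG (x : ℕ × ℕ) : (3 : GaussianInt) ∣ toG x ↔ x.1 % 3 = 0 ∧ x.2 % 3 = 0 := by
  have := natCast_dvd_iff 3 (toG x)
  simp only [toG] at *
  rw [show (3 : GaussianInt) = ((3 : ℕ) : GaussianInt) by norm_num, this]
  omega

theorem toG_strip (x : ℕ × ℕ) (h : (3 : GaussianInt) ∣ toG x) : toG x = 3 * toG (strip x) := by
  rw [three_dvd_toG] at h
  rw [strip, if_pos h]
  ext
  · simp [toG]; omega
  · simp [toG]; omega

theorem strip_iterate (x : ℕ × ℕ) (N : ℕ) : ∃ c, toG x = 3 ^ c * toG (strip^[N] x) ∧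
    (¬ (3 : GaussianInt) ∣ toG (strip^[N] x) ∨ c = N) := by
  induction N with
  | zero => exact ⟨0, by simp, Or.inr rfl⟩
  | succ N ih =>
    obtain ⟨c, h1, h2⟩ := ih
    rw [Function.iterate_succ_apply']
    by_cases h3 : (3 : GaussianInt) ∣ toG (strip^[N] x)
    · refine ⟨c + 1, ?_, Or.inr (by simpa [h3] using h2)⟩
      rw [h1, toG_strip _ h3, pow_succ]
      ring
    · refine ⟨c, ?_, Or.inl ?_⟩ <;> rw [strip, if_neg (by rwa [← three_dvd_toG])]
      exacts [h1, h3]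

theorem live_iff (P : ℕ) (x : ℕ × ℕ) : Live P x ↔ ¬ ((P ^ 21 : ℕ) : GaussianInt) ∣ toG x := by
  rw [natCast_dvd_iff]
  change _ ↔ ¬ (((P ^ 21 : ℕ) : ℤ) ∣ (x.1 : ℤ) ∧ ((P ^ 21 : ℕ) : ℤ) ∣ (x.2 : ℤ))
  rw [Int.natCast_dvd_natCast, Int.natCast_dvd_natCast, Nat.dvd_iff_mod_eq_zero,
    Nat.dvd_iff_mod_eq_zero, Live, Ne, Nat.add_eq_zero_iff]

theorem unitPart_spec {p : ℕ} {x : ℕ × ℕ} (h : Live (3 ^ p) x) :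
    ∃ c < 21 * p, toG x = 3 ^ c * toG (unitPart (3 ^ p) x) ∧
      ¬ (3 : GaussianInt) ∣ toG (unitPart (3 ^ p) x) := by
  obtain ⟨c, h1, h2⟩ := strip_iterate x ((3 ^ p) ^ 21)
  rw [live_iff, cast_three_pow] at h
  have hc : c < 21 * p := by
    by_contra hc
    exact h (by rw [h1]; exact (pow_dvd_pow 3 (by omega)).mul_right _)
  refine ⟨c, hc, h1, h2.resolve_right ?_⟩
  have : 21 * p < (3 ^ p) ^ 21 := by
    rw [← pow_mul, mul_comm p]; exact Nat.lt_pow_self (by norm_num)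
  omega

section Rotation

variable {p : ℕ} (hp : 1 ≤ p) {r : GaussianInt} (hr : Cong ((3 ^ p) ^ 42) (r * star r) 1)

include hp hr in
theorem not_three_dvd_of_normOne : ¬ (3 : GaussianInt) ∣ r := by
  intro h
  have h1 : (3 : GaussianInt) ∣ r * star r - 1 := by
    refine Dvd.dvd.trans ?_ hr
    rw [cast_three_pow]
    exact dvd_pow_self 3 (by omega)
  have h2 : (3 : GaussianInt) ∣ 1 := by
    have := dvd_sub (h.mul_right (star r)) h1
    rwa [sub_sub_cancel] at this
  exact prime_three.not_dvd_one h2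

include hp hr in
theorem live_rotate {w w' : ℕ × ℕ} (h : Cong ((3 ^ p) ^ 42) (toG w') (r * toG w)) :
    Live (3 ^ p) w' ↔ Live (3 ^ p) w := by
  rw [live_iff, live_iff, not_iff_not]
  have h' : Cong ((3 ^ p) ^ 21) (toG w') (r * toG w) := h.of_dvd (pow_dvd_pow _ (by norm_num))
  rw [dvd_iff_dvd_of_dvd_sub h']
  rw [cast_three_pow]
  exact ⟨fun hd => prime_three.pow_dvd_of_dvd_mul_left _ (not_three_dvd_of_normOne hp hr) hd,
    fun hd => hd.mul_left _⟩

include hp hr in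
theorem unitPart_rotate {w w' : ℕ × ℕ} (h : Cong ((3 ^ p) ^ 42) (toG w') (r * toG w))
    (hw : Live (3 ^ p) w) :
    Cong ((3 ^ p) ^ 21) (toG (unitPart (3 ^ p) w')) (r * toG (unitPart (3 ^ p) w)) := by
  obtain ⟨c, hc, e, hu⟩ := unitPart_spec hw
  obtain ⟨c', hc', e', hu'⟩ := unitPart_spec ((live_rotate hp hr h).2 hw)
  set u := toG (unitPart (3 ^ p) w)
  set u' := toG (unitPart (3 ^ p) w')
  have hr3 := not_three_dvd_of_normOne hp hr
  obtain ⟨t, ht⟩ := h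
  rw [cast_three_pow, e, e'] at ht
  have hsplit : (3 : GaussianInt) ^ (42 * p) = 3 ^ (21 * p) * 3 ^ (21 * p) := by
    rw [← pow_add]; congr 1; ring
  rw [hsplit] at ht
  obtain ⟨j, hj⟩ := Nat.exists_eq_add_of_lt hc
  obtain ⟨j', hj'⟩ := Nat.exists_eq_add_of_lt hc'
  have e1 : (3 : GaussianInt) ^ (21 * p) = 3 ^ c * (3 * 3 ^ j) := by
    rw [hj, pow_succ, pow_add]; ring
  have e2 : (3 : GaussianInt) ^ (21 * p) = 3 ^ c' * (3 * 3 ^ j') := by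
    rw [hj', pow_succ, pow_add]; ring
  have h3 : ∀ n : ℕ, (3 : GaussianInt) ^ n ≠ 0 := fun n => pow_ne_zero n prime_three.ne_zero
  -- both sides have the same exponent of `3`
  have hcc : c = c' := by
    rcases lt_trichotomy c c' with hlt | heq | hgt
    · exfalso
      obtain ⟨i, hi⟩ := Nat.exists_eq_add_of_lt hlt
      have : r * u = 3 * (3 ^ i * u' - 3 ^ j * 3 ^ (21 * p) * t) := by
        refine mul_left_cancel₀ (h3 c) ?_
        have hci : (3 : GaussianInt) ^ c' = 3 ^ c * (3 * 3 ^ i) := by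
          rw [hi, pow_succ, pow_add]; ring
        rw [hci] at ht
        nth_rewrite 1 [e1] at ht
        linear_combination -ht
      exact (prime_three.dvd_or_dvd (Dvd.intro _ this.symm)).elim hr3 hu
    · exact heq
    · exfalso
      obtain ⟨i, hi⟩ := Nat.exists_eq_add_of_lt hgt
      have : u' = 3 * (3 ^ i * r * u + 3 ^ j' * 3 ^ (21 * p) * t) := by
        refine mul_left_cancel₀ (h3 c') ?_
        have hci : (3 : GaussianInt) ^ c = 3 ^ c' * (3 * 3 ^ i) := by
          rw [hi, pow_succ, pow_add]; ring
        rw [hci] at ht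
        nth_rewrite 1 [e2] at ht
        linear_combination ht
      exact hu' (Dvd.intro _ this.symm)
  subst hcc
  refine ⟨3 * 3 ^ j * t, ?_⟩
  rw [cast_three_pow]
  refine mul_left_cancel₀ (h3 c) ?_
  nth_rewrite 1 [e1] at ht
  linear_combination ht

include hp hr in
theorem liveCount_rotate (W : Multiset (ℕ × ℕ)) :
    liveCount (3 ^ p) (W.map fun w => red ((3 ^ p) ^ 42) (r * toG w)) = liveCount (3 ^ p) W ∧
    Cong ((3 ^ p) ^ 21) (unitProd (3 ^ p) (W.map fun w => red ((3 ^ p) ^ 42) (r * toG w)))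
      (r ^ liveCount (3 ^ p) W * unitProd (3 ^ p) W) := by
  induction W using Multiset.induction with
  | empty => simp [liveCount, unitProd, Cong.refl]
  | cons w W ih =>
    obtain ⟨ih1, ih2⟩ := ih
    have hw := toG_red (M := (3 ^ p) ^ 42) (by positivity) (r * toG w)
    rw [Multiset.map_cons]
    by_cases hl : Live (3 ^ p) w
    · have hl' := (live_rotate hp hr hw).2 hl
      simp only [liveCount, unitProd, Multiset.filter_cons_of_pos _ hl,
        Multiset.filter_cons_of_pos _ hl', Multiset.card_cons, Multiset.map_cons,
        Multiset.prod_cons] at *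
      refine ⟨by rw [ih1], ?_⟩
      have := (unitPart_rotate hp hr hw hl).mul ih2
      convert this using 1
      rw [pow_succ]; ring
    · have hl' := mt (live_rotate hp hr hw).1 hl
      simp only [liveCount, unitProd, Multiset.filter_cons_of_neg _ hl,
        Multiset.filter_cons_of_neg _ hl'] at *
      exact ⟨ih1, ih2⟩

theorem not_three_dvd_unitProd (p : ℕ) (W : Multiset (ℕ × ℕ)) :
    ¬ (3 : GaussianInt) ∣ unitProd (3 ^ p) W := by
  induction W using Multiset.induction with
  | empty => simpa [unitProd] using prime_three.not_dvd_one
  | cons w W ih =>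
    by_cases hl : Live (3 ^ p) w
    · simp only [unitProd, Multiset.filter_cons_of_pos _ hl, Multiset.map_cons,
        Multiset.prod_cons] at *
      obtain ⟨_, _, _, hu⟩ := unitPart_spec hl
      exact fun h => (prime_three.dvd_or_dvd h).elim hu ih
    · simpa only [unitProd, Multiset.filter_cons_of_neg _ hl] using ih

include hp hr in
/-- The canonical positions of a multiset of fewer than `P` residues and of its image under an
element of norm one agree up to quarter turns: the two turns differ by a `k`-th root of unity,
`k < P`, and modulo `P ^ 20` these are fourth roots of unity. -/
theorem canon_rotate (W : Multiset (ℕ × ℕ)) (hW : W.card < 3 ^ p) :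
    ∃ t < 4, ∀ u, canon (3 ^ p) u (W.map fun w => red ((3 ^ p) ^ 42) (r * toG w)) =
      canon (3 ^ p) (t + u) W := by
  set P := 3 ^ p with hP
  set W' := W.map fun w => red (P ^ 42) (r * toG w) with hW'
  have hP1 : 1 < P := Nat.one_lt_pow (by omega) (by norm_num)
  have hM1 : 1 < P ^ 21 := Nat.one_lt_pow (by omega) hP1
  have hM0 : 0 < P ^ 21 := by omega
  have hr1 : Cong (P ^ 21) (r * star r) 1 := hr.of_dvd (pow_dvd_pow _ (by norm_num))
  obtain ⟨hk, hd⟩ := liveCount_rotate hp hr W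
  rw [← hW', ← hP] at hk hd
  set s := toG (turn P W) with hs
  set s' := toG (turn P W') with hs'
  have hsn : Cong (P ^ 21) (s * star s) 1 := (normOne_iff hM1 _).1 (normalizer_normOne hM1 _ _)
  have hsn' : Cong (P ^ 21) (s' * star s') 1 := (normOne_iff hM1 _).1 (normalizer_normOne hM1 _ _)
  -- it suffices to compare the two turns point by point
  suffices h : ∃ t < 4, ∀ w ∈ W, Cong (P ^ 20) (s' * r * toG w) (iunit ^ t * s * toG w) by
    obtain ⟨t, ht, h⟩ := h
    refine ⟨t, ht, fun u => ?_⟩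
    rw [canon, canon, hW', Multiset.map_map]
    refine Multiset.map_congr rfl fun w hw => ?_
    rw [Function.comp_apply, red_eq_red (by positivity), ← hW', ← hs', ← hs]
    have h1 : Cong (P ^ 20) (toG (red (P ^ 42) (r * toG w))) (r * toG w) :=
      (toG_red (by positivity) _).of_dvd (pow_dvd_pow _ (by norm_num))
    refine (h1.mul_left _).trans ?_
    have h2 := (h w hw).mul_left (iunit ^ u)
    convert h2 using 1 <;> ring
  by_cases hk0 : liveCount P W = 0
  · refine ⟨0, by norm_num, fun w hw => ?_⟩
    have hnl : ¬ Live P w := by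
      rw [liveCount, Multiset.card_eq_zero, Multiset.filter_eq_nil] at hk0
      exact hk0 w hw
    rw [live_iff, not_not] at hnl
    have hnl' : ((P ^ 20 : ℕ) : GaussianInt) ∣ toG w :=
      (Nat.cast_dvd_cast (pow_dvd_pow _ (by norm_num))).trans hnl
    exact dvd_sub (hnl'.mul_left _) (hnl'.mul_left _)
  · have hred : Cong (P ^ 21) (toG (red (P ^ 21) (unitProd P W')))
        (r ^ liveCount P W * toG (red (P ^ 21) (unitProd P W))) :=
      ((toG_red hM0 _).trans hd).trans ((toG_red hM0 _).symm.mul_left _)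
    have hc := normalizer_cong hM1 (liveCount P W) hr1 hred
    have hc1 : Cong (P ^ 21) ((s' * r) ^ liveCount P W * unitProd P W)
        (s ^ liveCount P W * unitProd P W) := by
      have a1 : Cong (P ^ 21) (s ^ liveCount P W * toG (red (P ^ 21) (unitProd P W)))
        (s ^ liveCount P W * unitProd P W) := (toG_red hM0 _).mul_left _
      have a2 : Cong (P ^ 21) (s' ^ liveCount P W * toG (red (P ^ 21) (unitProd P W')))
          (s' ^ liveCount P W * (r ^ liveCount P W * unitProd P W)) :=
        ((toG_red hM0 _).trans hd).mul_left _
      rw [mul_pow, mul_assoc]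
      refine a2.symm.trans (Cong.trans ?_ a1)
      rw [hs', hs, turn, turn, hk]
      exact hc
    -- cancel the product of unit parts, which is prime to `3`
    have hc2 : Cong (P ^ 21) ((s' * r) ^ liveCount P W) (s ^ liveCount P W) := by
      rw [Cong, ← sub_mul, hP, cast_three_pow, mul_comm _ (unitProd _ _)] at hc1
      rw [Cong, hP, cast_three_pow]
      exact prime_three.pow_dvd_of_dvd_mul_left _ (not_three_dvd_unitProd p W) hc1
    have hη : Cong (P ^ 21) ((s' * r * star s) ^ liveCount P W) 1 := by
      rw [mul_pow]
      refine (hc2.mul_right _).trans ?_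
      rw [← mul_pow]
      simpa using hsn.pow (liveCount P W)
    have hηn : Cong (P ^ 21) (s' * r * star s * star (s' * r * star s)) 1 := by
      have := (hsn'.mul hr1).mul hsn
      rw [one_mul, one_mul] at this
      convert this using 1
      simp only [star_mul', star_star]; ring
    have hkP : liveCount P W < 3 ^ p :=
      (Multiset.card_le_card (Multiset.filter_le _ _)).trans_lt hW
    obtain ⟨t, ht, hcong⟩ := exists_cong_iunit_pow hp (Nat.one_le_iff_ne_zero.2 hk0) hkP hηn hη
    refine ⟨t, ht, fun w _ => Cong.mul_right _ ?_⟩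
    have h1 := hcong.mul_right s
    have h2 := ((hsn.of_dvd (pow_dvd_pow P (by norm_num : 20 ≤ 21))).mul_left (s' * r)).symm
    rw [mul_one] at h2
    refine h2.trans ?_
    convert h1 using 1; ring

end Rotation

theorem canon_add_four (P t : ℕ) (W : Multiset (ℕ × ℕ)) : canon P (t + 4) W = canon P t W := by
  simp [canon, pow_add, iunit_pow_four]

/-! ### Three-adic residues of bounded rational numbers -/

theorem boundedQ_bounds {U : ℕ} (hU : 1 ≤ U) {x : ℚ} (hx : x ∈ boundedQ U) :
    x.den ≤ U ∧ x.num.natAbs ≤ U := by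
  have pos : ∀ p ∈ Finset.Icc 1 U, ∀ q ∈ Finset.Icc 1 U,
      ((p : ℚ) / q).den ≤ U ∧ ((p : ℚ) / q).num.natAbs ≤ U := by
    intro p hp q hq
    rw [Finset.mem_Icc] at hp hq
    have h1 := Rat.den_dvd (p : ℤ) (q : ℤ)
    have h2 := Rat.num_dvd (p : ℤ) (b := (q : ℤ)) (by omega)
    rw [Rat.divInt_eq_div] at h1 h2
    push_cast at h1 h2
    constructor
    · exact (Nat.le_of_dvd (by omega) (Int.natCast_dvd_natCast.1 h1)).trans hq.2
    · have := Int.natAbs_dvd_natAbs.2 h2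
      exact (Nat.le_of_dvd (by omega) (by simpa using this)).trans hp.2
  rcases hx with ⟨p, hp, q, hq, rfl | rfl⟩ | rfl
  · exact pos p hp q hq
  · simpa [Rat.neg_den, Rat.neg_num] using pos p hp q hq
  · simpa using hU

/-- The part of `U!` prime to `3`: a common denominator, as far as `3` is not concerned. -/
def denomPart (U : ℕ) : ℕ := ordCompl[3] U.factorial

theorem not_three_dvd_denomPart (U : ℕ) : ¬ 3 ∣ denomPart U :=
  Nat.not_dvd_ordCompl Nat.prime_three U.factorial_ne_zero

/-- `x` times the common denominator `denomPart U * P`. -/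
def scaled (U P : ℕ) (x : ℚ) : ℤ := ((denomPart U : ℚ) * P * x).num

theorem scaled_cast {U p : ℕ} (hU : 1 ≤ U) (hUP : U < 3 ^ p) {x : ℚ} (hx : x ∈ boundedQ U) :
    ((scaled U (3 ^ p) x : ℤ) : ℚ) = denomPart U * (3 ^ p : ℕ) * x := by
  have hden := (boundedQ_bounds hU hx).1
  have hd : x.den ∣ denomPart U * 3 ^ p := by
    rw [← Nat.ordProj_mul_ordCompl_eq_self x.den 3, mul_comm]
    refine mul_dvd_mul ?_ (pow_dvd_pow 3 ?_)
    · exact Nat.ordCompl_dvd_ordCompl_of_dvd (Nat.dvd_factorial x.den_pos hden) 3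
    · have := Nat.le_of_dvd x.den_pos (Nat.ordProj_dvd x.den 3)
      exact ((Nat.pow_lt_pow_iff_right (by norm_num)).1 (this.trans_lt (hden.trans_lt hUP))).le
  obtain ⟨c, hc⟩ := hd
  have hx' : (denomPart U : ℚ) * (3 ^ p : ℕ) * x = ((c * x.num : ℤ) : ℚ) := by
    rw [← Nat.cast_mul, hc]
    nth_rewrite 2 [← Rat.num_div_den x]
    have := x.den_ne_zero
    push_cast
    field_simp
  rw [scaled, hx', Rat.num_intCast]

/-- The residue of `P * x` modulo `P ^ 42` for a rational `x` with denominator at most `U < P`,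
where `P` is a power of three. -/
def resN (U P : ℕ) (x : ℚ) : ℕ :=
  (((denomPart U : ZMod (P ^ 42)))⁻¹ * ((scaled U P x : ℤ) : ZMod (P ^ 42))).val

theorem coprime_denomPart (U p k : ℕ) : (denomPart U).Coprime ((3 ^ p) ^ k) :=
  Nat.Coprime.pow_right _ (Nat.Coprime.pow_right _
    ((Nat.Prime.coprime_iff_not_dvd Nat.prime_three).2 (not_three_dvd_denomPart U)).symm)

theorem resN_spec (U p : ℕ) (x : ℚ) :
    (((3 ^ p) ^ 42 : ℕ) : ℤ) ∣ denomPart U * resN U (3 ^ p) x - scaled U (3 ^ p) x := by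
  rw [← ZMod.intCast_zmod_eq_zero_iff_dvd]
  have h := ZMod.coe_mul_inv_eq_one _ (coprime_denomPart U p 42)
  push_cast
  rw [resN, ZMod.natCast_zmod_val, ← mul_assoc, h]
  ring

theorem resN_lt (U p : ℕ) (x : ℚ) : resN U (3 ^ p) x < (3 ^ p) ^ 42 := ZMod.val_lt _

theorem resN_unique {U p : ℕ} {x : ℚ} {y : ℕ} (hy : y < (3 ^ p) ^ 42)
    (h : (((3 ^ p) ^ 42 : ℕ) : ℤ) ∣ denomPart U * y - scaled U (3 ^ p) x) :
    y = resN U (3 ^ p) x := by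
  have h1 := dvd_sub h (resN_spec U p x)
  rw [sub_sub_sub_cancel_right, ← mul_sub] at h1
  have h2 := (Nat.isCoprime_iff_coprime.2 (coprime_denomPart U p 42).symm).dvd_of_dvd_mul_left h1
  have h3 : resN U (3 ^ p) x ≡ y [MOD (3 ^ p) ^ 42] := Nat.modEq_iff_dvd.2 h2
  exact (h3.eq_of_lt_of_lt (resN_lt U p x) hy).symm

theorem scaled_neg (U P : ℕ) (x : ℚ) : scaled U P (-x) = - scaled U P x := by
  simp [scaled]

theorem resN_neg (U p : ℕ) (x : ℚ) :
    resN U (3 ^ p) (-x) = ((3 ^ p) ^ 42 - resN U (3 ^ p) x) % (3 ^ p) ^ 42 := by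
  have hpos : 0 < (3 ^ p) ^ 42 := by positivity
  refine (resN_unique (Nat.mod_lt _ hpos) ?_).symm
  have hlt := resN_lt U p x
  obtain ⟨u, hu⟩ := resN_spec U p x
  rw [scaled_neg]
  set M := (3 ^ p) ^ 42
  set y := resN U (3 ^ p) x
  have hmod := Nat.div_add_mod (M - y) M
  refine ⟨denomPart U * (1 - ((M - y) / M : ℕ)) - u, ?_⟩
  have hz : (M : ℤ) * ((M - y) / M : ℕ) + ((M - y) % M : ℕ) = M - y := by
    rw [← Nat.cast_sub hlt.le]
    exact_mod_cast hmod
  linear_combination (denomPart U : ℤ) * hz - hu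

/-- A solution `y` of `x.den * y ≡ P * |x.num|` modulo `P ^ 43` yields the residue of `|x|`. -/
theorem resN_abs_of_modEq {U p : ℕ} (hU : 1 ≤ U) (hUP : U < 3 ^ p) {x : ℚ} (hx : x ∈ boundedQ U)
    {y : ℕ} (hy : x.den * y ≡ 3 ^ p * x.num.natAbs [MOD (3 ^ p) ^ 43]) (ha : |x| ∈ boundedQ U) :
    y % (3 ^ p) ^ 42 = resN U (3 ^ p) |x| := by
  refine resN_unique (Nat.mod_lt _ (by positivity)) ?_
  have hs : (x.den : ℤ) * scaled U (3 ^ p) |x| = denomPart U * (3 ^ p : ℕ) * x.num.natAbs := by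
    have := scaled_cast hU hUP ha
    have hxa : |x| * x.den = (x.num.natAbs : ℚ) := by
      rw [Nat.cast_natAbs, Int.cast_abs, ← Rat.mul_den_eq_num x, abs_mul, Nat.abs_cast]
    have h' : (x.den : ℚ) * ((scaled U (3 ^ p) |x| : ℤ) : ℚ) =
        denomPart U * (3 ^ p : ℕ) * (x.num.natAbs : ℚ) := by
      rw [this, ← hxa]; push_cast; ring
    refine Int.cast_injective (α := ℚ) ?_
    rw [Nat.cast_natAbs] at h'
    push_cast at h' ⊢
    exact h'
  have hdvd : (3 : ℤ) ^ (p + 42 * p) ∣ x.den * (denomPart U * y - scaled U (3 ^ p) |x|) := by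
    obtain ⟨u, hu⟩ := Nat.modEq_iff_dvd.1 hy
    refine ⟨-(denomPart U * u), ?_⟩
    have e : (3 : ℤ) ^ (p + 42 * p) = (((3 ^ p) ^ 43 : ℕ) : ℤ) := by
      push_cast; rw [← pow_mul]; congr 1; ring
    rw [e]
    push_cast at hu hs ⊢
    linear_combination (-(denomPart U : ℤ)) * hu - hs
  have hnd : ¬ (3 : ℤ) ^ p ∣ x.den := by
    intro h
    have h' : 3 ^ p ∣ x.den := by exact_mod_cast h
    have := Nat.le_of_dvd x.den_pos h'
    have := (boundedQ_bounds hU hx).1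
    omega
  have h1 := pow_dvd_of_not_pow_dvd Int.prime_three p (42 * p) _ _ hnd hdvd
  have e : (((3 ^ p) ^ 42 : ℕ) : ℤ) = 3 ^ (42 * p) := by
    push_cast; rw [← pow_mul, mul_comm]
  rw [e]
  have h2 : (3 : ℤ) ^ (42 * p) ∣ (denomPart U : ℤ) * ((y : ℤ) - ((y % (3 ^ p) ^ 42 : ℕ) : ℤ)) := by
    refine Dvd.dvd.mul_left ⟨((y / (3 ^ p) ^ 42 : ℕ) : ℤ), ?_⟩ _
    rw [← e]
    have := Nat.div_add_mod y ((3 ^ p) ^ 42)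
    have h3 : (((3 ^ p) ^ 42 : ℕ) : ℤ) * ((y / (3 ^ p) ^ 42 : ℕ) : ℤ) +
      ((y % (3 ^ p) ^ 42 : ℕ) : ℤ) = y := by exact_mod_cast this
    linear_combination -h3
  rw [show (denomPart U : ℤ) * ((y % (3 ^ p) ^ 42 : ℕ) : ℤ) - scaled U (3 ^ p) |x| =
    (denomPart U * y - scaled U (3 ^ p) |x|) -
      denomPart U * ((y : ℤ) - ((y % (3 ^ p) ^ 42 : ℕ) : ℤ)) by ring]
  exact dvd_sub h1 h2

theorem exists_modEq_residue {U p : ℕ} (hU : 1 ≤ U) (hUP : U < 3 ^ p) {x : ℚ}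
    (hx : x ∈ boundedQ U) :
    ∃ y < (3 ^ p) ^ 43, x.den * y ≡ 3 ^ p * x.num.natAbs [MOD (3 ^ p) ^ 43] := by
  have hden := (boundedQ_bounds hU hx).1
  -- write the denominator as `3 ^ b * q` with `q` prime to `3` and `b < p`
  have hq : (ordCompl[3] x.den).Coprime ((3 ^ p) ^ 43) :=
    Nat.Coprime.pow_right _ (Nat.Coprime.pow_right _
      (Nat.coprime_ordCompl Nat.prime_three x.den_ne_zero).symm)
  obtain ⟨i, -, hi⟩ := Nat.exists_mul_mod_eq_one_of_coprime hq
    (Nat.one_lt_pow (by norm_num) (by omega))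
  have hb : ordProj[3] x.den ∣ 3 ^ p := by
    refine pow_dvd_pow 3 ?_
    have := Nat.le_of_dvd x.den_pos (Nat.ordProj_dvd x.den 3)
    exact ((Nat.pow_lt_pow_iff_right (by norm_num)).1 (this.trans_lt (hden.trans_lt hUP))).le
  obtain ⟨c, hc⟩ := hb
  refine ⟨(c * x.num.natAbs * i) % (3 ^ p) ^ 43, Nat.mod_lt _ (by positivity), ?_⟩
  have h1 : x.den * (c * x.num.natAbs * i) =
      3 ^ p * x.num.natAbs * (ordCompl[3] x.den * i) := by
    nth_rewrite 1 [← Nat.ordProj_mul_ordCompl_eq_self x.den 3]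
    rw [hc]
    ring
  have h2 : ordCompl[3] x.den * i ≡ 1 [MOD (3 ^ p) ^ 43] := by
    rw [Nat.ModEq, hi, Nat.mod_eq_of_lt (Nat.one_lt_pow (by norm_num) (by omega))]
  calc x.den * ((c * x.num.natAbs * i) % (3 ^ p) ^ 43)
      ≡ x.den * (c * x.num.natAbs * i) [MOD (3 ^ p) ^ 43] := (Nat.mod_modEq _ _).mul_left _
    _ = 3 ^ p * x.num.natAbs * (ordCompl[3] x.den * i) := h1
    _ ≡ 3 ^ p * x.num.natAbs * 1 [MOD (3 ^ p) ^ 43] := h2.mul_left _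
    _ = _ := by ring

/-! ### Residues of centered points -/

/-- All coordinates are `U`-rational. -/
def BoundedPts (U : ℕ) (A : Multiset (ℚ × ℚ)) : Prop :=
  ∀ z ∈ A, z.1 ∈ boundedQ U ∧ z.2 ∈ boundedQ U

/-- The point `z`, multiplied by the common denominator, as a Gaussian integer. -/
def scaledPt (U P : ℕ) (z : ℚ × ℚ) : GaussianInt := ⟨scaled U P z.1, scaled U P z.2⟩

/-- The residue of `P * z` modulo `P ^ 42`. -/
def resPt (U P : ℕ) (z : ℚ × ℚ) : ℕ × ℕ := (resN U P z.1, resN U P z.2)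

/-- The vector from the centroid of `A` to `z`, multiplied by `A.card` and the common
denominator. -/
def centered (U P : ℕ) (A : Multiset (ℚ × ℚ)) (z : ℚ × ℚ) : GaussianInt :=
  A.card * scaledPt U P z - (A.map (scaledPt U P)).sum

/-- The residue of the vector from the centroid of `A` to `z`, multiplied by `P * A.card`. -/
def resVec (U P : ℕ) (A : Multiset (ℚ × ℚ)) (z : ℚ × ℚ) : ℕ × ℕ :=
  red (P ^ 42) (A.card * toG (resPt U P z) - (A.map fun z => toG (resPt U P z)).sum)

theorem resPt_spec (U p : ℕ) (z : ℚ × ℚ) :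
    Cong ((3 ^ p) ^ 42) (denomPart U * toG (resPt U (3 ^ p) z)) (scaledPt U (3 ^ p) z) := by
  rw [Cong, natCast_dvd_iff]
  simpa [toG, resPt, scaledPt] using And.intro (resN_spec U p z.1) (resN_spec U p z.2)

theorem Cong.multiset_sum {ι : Type*} {M : ℕ} {f g : ι → GaussianInt} (h : ∀ i, Cong M (f i) (g i))
    (s : Multiset ι) : Cong M (s.map f).sum (s.map g).sum := by
  induction s using Multiset.induction with
  | empty => exact Cong.refl _ _
  | cons a s ih => simpa using (h a).add ih

theorem resVec_spec (U p : ℕ) (A : Multiset (ℚ × ℚ)) (z : ℚ × ℚ) :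
    Cong ((3 ^ p) ^ 42) (denomPart U * toG (resVec U (3 ^ p) A z)) (centered U (3 ^ p) A z) := by
  refine ((toG_red (by positivity) _).mul_left _).trans ?_
  have h1 := (resPt_spec U p z).mul_left (A.card : GaussianInt)
  have h2 := Cong.multiset_sum (resPt_spec U p) A
  rw [Multiset.sum_map_mul_left] at h2
  have h3 := h1.sub h2
  rw [centered]
  convert h3 using 1
  ring

theorem toComplex_scaledPt {U p : ℕ} (hU : 1 ≤ U) (hUP : U < 3 ^ p) {z : ℚ × ℚ}
    (hz : z.1 ∈ boundedQ U ∧ z.2 ∈ boundedQ U) :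
    GaussianInt.toComplex (scaledPt U (3 ^ p) z) =
      (denomPart U * (3 ^ p : ℕ) : ℂ) * GeomHash.toComplex z := by
  have h1 := congrArg (Rat.cast (K := ℝ)) (scaled_cast hU hUP hz.1)
  have h2 := congrArg (Rat.cast (K := ℝ)) (scaled_cast hU hUP hz.2)
  rw [← Nat.cast_mul] at h1 h2
  rw [GaussianInt.toComplex_def₂, ← Nat.cast_mul]
  generalize denomPart U * 3 ^ p = c at h1 h2
  push_cast at h1 h2
  apply Complex.ext
  · simpa [scaledPt, GeomHash.toComplex] using h1
  · simpa [scaledPt, GeomHash.toComplex] using h2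

theorem toComplex_centered {U p : ℕ} (hU : 1 ≤ U) (hUP : U < 3 ^ p) {A : Multiset (ℚ × ℚ)}
    (hA : BoundedPts U A) {z : ℚ × ℚ} (hz : z ∈ A) :
    GaussianInt.toComplex (centered U (3 ^ p) A z) = (denomPart U * (3 ^ p : ℕ) : ℂ) *
      (A.card * GeomHash.toComplex z - (A.map GeomHash.toComplex).sum) := by
  have hs : GaussianInt.toComplex ((A.map (scaledPt U (3 ^ p))).sum) =
      (denomPart U * (3 ^ p : ℕ) : ℂ) * (A.map GeomHash.toComplex).sum := by
    rw [map_multiset_sum, Multiset.map_map, ← Multiset.sum_map_mul_left]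
    exact congrArg _ (Multiset.map_congr rfl fun w hw => toComplex_scaledPt hU hUP (hA w hw))
  rw [centered, map_sub, map_mul, map_natCast, hs, toComplex_scaledPt hU hUP (hA z hz)]
  ring

theorem map_eq_map_iff_rel {α β γ : Type*} {f : α → γ} {g : β → γ} {s : Multiset α}
    {t : Multiset β} : s.map f = t.map g ↔ Multiset.Rel (fun a b => f a = g b) s t := by
  rw [← Multiset.rel_eq, Multiset.rel_map]

/-- Congruent sets have centered vectors that differ by a quotient `α / β` of Gaussian integers of
equal norm. -/
theorem exists_rotation_of_congruent {U p : ℕ} (hU : 1 ≤ U) (hUP : U < 3 ^ p)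
    {A B : Multiset (ℚ × ℚ)} (hA : BoundedPts U A) (hB : BoundedPts U B) (h : Congruent A B) :
    ∃ α β : GaussianInt, β ≠ 0 ∧ α * star α = β * star β ∧
      A.map (fun z => α * centered U (3 ^ p) A z) =
        B.map (fun z => β * centered U (3 ^ p) B z) := by
  obtain ⟨ρ, t, hρ, h⟩ := h
  have hcard : A.card = B.card := by simpa using congrArg Multiset.card h
  have hsum : ρ * (A.map GeomHash.toComplex).sum + A.card * t =
      (B.map GeomHash.toComplex).sum := by
    rw [← h, Multiset.sum_map_add, Multiset.sum_map_mul_left, Multiset.map_id']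
    simp
  rw [Multiset.map_map, map_eq_map_iff_rel] at h
  have hrel : Multiset.Rel (fun a b => ρ * GaussianInt.toComplex (centered U (3 ^ p) A a) =
      GaussianInt.toComplex (centered U (3 ^ p) B b)) A B := by
    refine h.mono fun a ha b hb hab => ?_
    rw [toComplex_centered hU hUP hA ha, toComplex_centered hU hUP hB hb, ← hab, ← hsum, ← hcard]
    simp only [Function.comp_apply]
    ring
  by_cases h0 : ∀ a ∈ A, centered U (3 ^ p) A a = 0
  · refine ⟨1, 1, one_ne_zero, rfl, map_eq_map_iff_rel.2 (hrel.mono fun a ha b hb hab => ?_)⟩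
    rw [h0 a ha, map_zero, mul_zero, eq_comm, GaussianInt.toComplex_eq_zero] at hab
    rw [h0 a ha, hab]
  · push Not at h0
    obtain ⟨a, ha, ha0⟩ := h0
    obtain ⟨b, hb, hab⟩ := Multiset.exists_mem_of_rel_of_mem hrel ha
    refine ⟨centered U (3 ^ p) B b, centered U (3 ^ p) A a, ha0, ?_, ?_⟩
    · rw [← norm_coe, ← norm_coe]
      congr 1
      have : ((Zsqrtd.norm (centered U (3 ^ p) B b) : ℤ) : ℝ) =
          (Zsqrtd.norm (centered U (3 ^ p) A a) : ℤ) := by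
        rw [GaussianInt.intCast_real_norm, GaussianInt.intCast_real_norm, ← hab,
          Complex.normSq_mul, Complex.normSq_eq_norm_sq, hρ]
        simp
      exact_mod_cast this
    · refine map_eq_map_iff_rel.2 (hrel.mono fun a' _ b' _ hab' => ?_)
      apply GaussianInt.toComplex_injective
      rw [map_mul, map_mul, ← hab, ← hab']
      ring

theorem three_dvd_star {a : GaussianInt} : (3 : GaussianInt) ∣ star a → (3 : GaussianInt) ∣ a := by
  rintro ⟨b, hb⟩
  refine ⟨star b, ?_⟩
  rw [← star_star a, hb, star_mul', star_ofNat]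

theorem exists_eq_mul_coprime (a : GaussianInt) {b : GaussianInt} (hb : b ≠ 0) :
    ∃ g a' b' : GaussianInt, g ≠ 0 ∧ a = g * a' ∧ b = g * b' ∧ IsCoprime a' b' := by
  have hg : EuclideanDomain.gcd a b ≠ 0 := fun h0 => hb (EuclideanDomain.gcd_eq_zero_iff.1 h0).2
  have hab := EuclideanDomain.gcd_eq_gcd_ab a b
  obtain ⟨a', ha'⟩ := EuclideanDomain.gcd_dvd_left a b
  obtain ⟨b', hb'⟩ := EuclideanDomain.gcd_dvd_right a b
  generalize EuclideanDomain.gcd a b = g at *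
  refine ⟨g, a', b', hg, ha', hb', EuclideanDomain.gcdA a b, EuclideanDomain.gcdB a b,
    mul_left_cancel₀ hg ?_⟩
  linear_combination -hab - EuclideanDomain.gcdA a b * ha' - EuclideanDomain.gcdB a b * hb'

/-- Modulo a power of three, the centered vectors of congruent sets differ by an element of norm
one: three is inert, so it does not divide the denominator of the rotation. -/
theorem exists_normOne_of_congruent {U p : ℕ} (hU : 1 ≤ U) (hUP : U < 3 ^ p)
    {A B : Multiset (ℚ × ℚ)} (hA : BoundedPts U A) (hB : BoundedPts U B) (h : Congruent A B) :
    ∃ r : GaussianInt, Cong ((3 ^ p) ^ 42) (r * star r) 1 ∧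
      B.map (resVec U (3 ^ p) B) =
        (A.map (resVec U (3 ^ p) A)).map fun w => red ((3 ^ p) ^ 42) (r * toG w) := by
  obtain ⟨α₀, β₀, hβ₀, hn₀, hAB₀⟩ := exists_rotation_of_congruent hU hUP hA hB h
  obtain ⟨α, β, hβ3, hn, hAB⟩ : ∃ α β : GaussianInt, ¬ (3 : GaussianInt) ∣ β ∧
      α * star α = β * star β ∧ A.map (fun z => α * centered U (3 ^ p) A z) =
        B.map (fun z => β * centered U (3 ^ p) B z) := by
    obtain ⟨g, α, β, hg, hα, hβ, hcop⟩ := exists_eq_mul_coprime α₀ hβ₀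
    have hg' : star g ≠ 0 := by simpa using hg
    have hn : α * star α = β * star β := by
      refine mul_left_cancel₀ hg (mul_left_cancel₀ hg' ?_)
      rw [hα, hβ, star_mul', star_mul'] at hn₀
      linear_combination hn₀
    refine ⟨α, β, fun h3 => ?_, hn, ?_⟩
    · have h3α : (3 : GaussianInt) ∣ α := by
        have : (3 : GaussianInt) ∣ α * star α := by rw [hn]; exact h3.mul_right _
        exact (prime_three.dvd_or_dvd this).elim id three_dvd_star
      exact prime_three.not_isUnit (hcop.isUnit_of_dvd' h3α h3)
    · rw [map_eq_map_iff_rel] at hAB₀ ⊢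
      refine hAB₀.mono fun a _ b _ hab => mul_left_cancel₀ hg ?_
      rw [hα, hβ] at hab
      linear_combination hab
  have hM : ((((3 ^ p) ^ 42 : ℕ)) : GaussianInt) = 3 ^ (42 * p) := cast_three_pow p 42
  have hc : IsCoprime ((3 : GaussianInt) ^ (42 * p)) β :=
    ((prime_three.irreducible.coprime_iff_not_dvd).2 hβ3).pow_left
  obtain ⟨u, v, huv⟩ := hc
  have hv : Cong ((3 ^ p) ^ 42) (v * β) 1 := ⟨-u, by rw [hM]; linear_combination huv⟩
  refine ⟨α * v, ?_, ?_⟩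
  · have h1 := hv.mul hv.star
    rw [star_one, one_mul] at h1
    convert h1 using 1
    rw [star_mul', star_mul']
    linear_combination (v * star v) * hn
  · rw [Multiset.map_map]
    refine Eq.symm ?_
    rw [map_eq_map_iff_rel] at hAB ⊢
    refine hAB.mono fun a _ b _ hab => ?_
    have hb : resVec U (3 ^ p) B b = red ((3 ^ p) ^ 42) (toG (resVec U (3 ^ p) B b)) :=
      (red_toG (red_lt (by positivity) _).1 (red_lt (by positivity) _).2).symm
    rw [hb, Function.comp_apply, red_eq_red (by positivity)]
    have h1 := (resVec_spec U p A a).mul_left (α * v)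
    have h2 := resVec_spec U p B b
    have h3 : Cong ((3 ^ p) ^ 42) (α * v * centered U (3 ^ p) A a) (centered U (3 ^ p) B b) := by
      have := hv.mul_right (centered U (3 ^ p) B b)
      rw [one_mul] at this
      convert this using 1
      linear_combination v * hab
    have h4 := h1.trans (h3.trans h2.symm)
    have hD : ¬ (3 : GaussianInt) ∣ (denomPart U : GaussianInt) := fun hd =>
      not_three_dvd_denomPart U ((natCast_dvd_natCast_gaussian 3 _).1 (by exact_mod_cast hd))
    rw [Cong, hM] at h4 ⊢
    refine prime_three.pow_dvd_of_dvd_mul_left _ hD ?_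
    convert h4 using 1
    ring

/-! ### Heights -/

/-- `x` is a fraction with numerator and denominator of absolute value at most `H`. -/
def HeightLe (H : ℕ) (x : ℚ) : Prop :=
  ∃ a b : ℤ, b ≠ 0 ∧ |a| ≤ H ∧ |b| ≤ H ∧ x = a / b

namespace HeightLe

variable {H K : ℕ} {x y : ℚ}

theorem mul (hx : HeightLe H x) (hy : HeightLe K y) : HeightLe (H * K) (x * y) := by
  obtain ⟨a, b, hb, ha', hb', rfl⟩ := hx
  obtain ⟨c, d, hd, hc', hd', rfl⟩ := hy
  refine ⟨a * c, b * d, mul_ne_zero hb hd, ?_, ?_, by push_cast; rw [div_mul_div_comm]⟩ <;>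
    rw [abs_mul] <;> push_cast <;> gcongr

theorem neg (hx : HeightLe H x) : HeightLe H (-x) := by
  obtain ⟨a, b, hb, ha', hb', rfl⟩ := hx
  exact ⟨-a, b, hb, by rwa [abs_neg], hb', by push_cast; ring⟩

theorem add (hx : HeightLe H x) (hy : HeightLe K y) : HeightLe (2 * (H * K)) (x + y) := by
  obtain ⟨a, b, hb, ha', hb', rfl⟩ := hx
  obtain ⟨c, d, hd, hc', hd', rfl⟩ := hy
  refine ⟨a * d + b * c, b * d, mul_ne_zero hb hd, ?_, ?_, ?_⟩
  · have h1 : |a * d| ≤ H * K := by rw [abs_mul]; gcongr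
    have h2 : |b * c| ≤ H * K := by rw [abs_mul]; gcongr
    have := abs_add_le (a * d) (b * c)
    push_cast
    linarith
  · have h1 : |b * d| ≤ H * K := by rw [abs_mul]; gcongr
    have := abs_nonneg (b * d)
    push_cast
    linarith
  · have : (b : ℚ) ≠ 0 := by exact_mod_cast hb
    have : (d : ℚ) ≠ 0 := by exact_mod_cast hd
    push_cast
    field_simp

theorem sub (hx : HeightLe H x) (hy : HeightLe K y) : HeightLe (2 * (H * K)) (x - y) := by
  rw [sub_eq_add_neg]
  exact hx.add hy.neg

theorem of_boundedQ {U : ℕ} (hU : 1 ≤ U) {x : ℚ} (hx : x ∈ boundedQ U) : HeightLe U x := by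
  obtain ⟨h1, h2⟩ := boundedQ_bounds hU hx
  refine ⟨x.num, x.den, by exact_mod_cast x.den_ne_zero, ?_, ?_, ?_⟩
  · rw [Int.abs_eq_natAbs]; exact_mod_cast h2
  · rw [Nat.abs_cast]; exact_mod_cast h1
  · exact_mod_cast (Rat.num_div_den x).symm

end HeightLe

/-- A rational of small height vanishes if a large power of three divides `n` times its scaled
value. -/
theorem eq_zero_of_dvd {U p n H : ℕ} (hn : 1 ≤ n) {x : ℚ} (hx : HeightLe H x) {Y : ℤ}
    (hY : (Y : ℚ) = (denomPart U * (3 ^ p : ℕ)) ^ 2 * x)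
    (hd : (((3 ^ p) ^ 20 : ℕ) : ℤ) ∣ n * Y) (hH : n * (3 ^ p) ^ 2 * H < (3 ^ p) ^ 20) : x = 0 := by
  obtain ⟨a, b, hb, ha', -, rfl⟩ := hx
  have hbq : (b : ℚ) ≠ 0 := by exact_mod_cast hb
  have h1 : Y * b = (denomPart U * (3 ^ p : ℕ)) ^ 2 * a := by
    refine Int.cast_injective (α := ℚ) ?_
    push_cast at hY ⊢
    rw [hY]
    field_simp
  have h2 : (((3 ^ p) ^ 20 : ℕ) : ℤ) ∣ ((denomPart U ^ 2 : ℕ) : ℤ) * (n * (3 ^ p) ^ 2 * a) := by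
    have : ((denomPart U ^ 2 : ℕ) : ℤ) * (n * (3 ^ p) ^ 2 * a) = n * Y * b := by
      push_cast at h1 ⊢
      linear_combination -(n : ℤ) * h1
    rw [this]
    exact hd.mul_right _
  have h3 := (Nat.isCoprime_iff_coprime.2
    ((coprime_denomPart U p 20).pow_left 2).symm).dvd_of_dvd_mul_left h2
  have h4 : (n * (3 ^ p) ^ 2 * a : ℤ) = 0 := by
    refine Int.eq_zero_of_abs_lt_dvd h3 ?_
    rw [abs_mul, abs_of_nonneg (by positivity)]
    calc (n * (3 ^ p) ^ 2 * |a| : ℤ) ≤ n * (3 ^ p) ^ 2 * H := by gcongr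
      _ < _ := by exact_mod_cast hH
  have : a = 0 := by
    have h3p : ((3 : ℤ) ^ p) ^ 2 ≠ 0 := by positivity
    have hn0 : (n : ℤ) ≠ 0 := by omega
    exact (mul_eq_zero.1 h4).resolve_left (mul_ne_zero hn0 h3p)
  simp [this]

/-! ### Equal canonical positions force congruence -/

theorem HeightLe.two_mul_sub_two_mul {K : ℕ} {a b c d a' b' c' d' : ℚ} (ha : HeightLe K a)
    (hb : HeightLe K b) (hc : HeightLe K c) (hd : HeightLe K d) (ha' : HeightLe K a')
    (hb' : HeightLe K b') (hc' : HeightLe K c') (hd' : HeightLe K d') :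
    HeightLe (8 * K ^ 8) ((a * b + c * d) - (a' * b' + c' * d')) := by
  have := ((ha.mul hb).add (hc.mul hd)).sub ((ha'.mul hb').add (hc'.mul hd'))
  convert this using 1
  ring

section Soundness

variable {U p n : ℕ} {A B : Multiset (ℚ × ℚ)}

/-- If two multisets of residues match up to elements of norm one modulo a large power of three,
then the multisets of points are congruent: all relevant polynomials in the coordinates of the
points have small height, so they vanish as soon as they vanish modulo that power. -/
theorem congruent_of_rel (hU : 1 ≤ U) (hUP : U < 3 ^ p) (hn : 1 ≤ n)
    (hbound : n * (3 ^ p) ^ 2 * (8 * (2 * (U * U)) ^ 8) < (3 ^ p) ^ 20)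
    (hA : BoundedPts U A) (hB : BoundedPts U B) (hcA : A.card = n) (hcB : B.card = n)
    {σ σ' : GaussianInt} (hσ : Cong ((3 ^ p) ^ 20) (σ * star σ) 1)
    (hσ' : Cong ((3 ^ p) ^ 20) (σ' * star σ') 1)
    (hrel : Multiset.Rel (fun a b => Cong ((3 ^ p) ^ 20) (σ * toG (resVec U (3 ^ p) A a))
      (σ' * toG (resVec U (3 ^ p) B b))) A B) : Congruent A B := by
  set M := (3 ^ p) ^ 20
  set Z := scaledPt U (3 ^ p)
  set τ := star σ * σ'
  have hτ : Cong M (τ * star τ) 1 := by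
    have := hσ.mul hσ'
    rw [one_mul] at this
    convert this using 1
    simp only [τ, star_mul', star_star]; ring
  set R := fun a b => Cong ((3 ^ p) ^ 20) (σ * toG (resVec U (3 ^ p) A a))
      (σ' * toG (resVec U (3 ^ p) B b)) with hRdef
  have hMM : M ∣ (3 ^ p) ^ 42 := pow_dvd_pow _ (by norm_num)
  have hdiff : ∀ a b a' b', R a b → R a' b' →
      Cong M (n * (Z a - Z a')) (n * τ * (Z b - Z b')) := by
    have hc : ∀ a b, R a b → Cong M (σ * centered U (3 ^ p) A a) (σ' * centered U (3 ^ p) B b) := by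
      intro a b hab
      have h1 := ((resVec_spec U p A a).of_dvd hMM).mul_left σ
      have h2 := ((resVec_spec U p B b).of_dvd hMM).mul_left σ'
      have h3 := Cong.mul_left (denomPart U : GaussianInt) hab
      refine h1.symm.trans (Cong.trans ?_ h2)
      convert h3 using 1 <;> ring
    intro a b a' b' hab hab'
    have h1 := ((hc a b hab).sub (hc a' b' hab')).mul_left (star σ)
    have h2 := hσ.mul_right (n * (Z a - Z a'))
    rw [one_mul] at h2
    refine h2.symm.trans ?_
    simp only [centered, hcA, hcB] at h1
    convert h1 using 1 <;> simp only [Z, τ] <;> ring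
  have hne : A ≠ 0 := by rintro rfl; simp at hcA; omega
  obtain ⟨a₁, ha₁⟩ := Multiset.exists_mem_of_ne_zero hne
  obtain ⟨b₁, hb₁, h₁⟩ := Multiset.exists_mem_of_rel_of_mem hrel ha₁
  have hZ : ∀ {C : Multiset (ℚ × ℚ)}, BoundedPts U C → ∀ z ∈ C,
      (((Z z).re : ℤ) : ℚ) = denomPart U * (3 ^ p : ℕ) * z.1 ∧
      (((Z z).im : ℤ) : ℚ) = denomPart U * (3 ^ p : ℕ) * z.2 := fun hC z hz =>
    ⟨scaled_cast hU hUP (hC z hz).1, scaled_cast hU hUP (hC z hz).2⟩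
  have hH : ∀ {C : Multiset (ℚ × ℚ)}, BoundedPts U C → ∀ z ∈ C, ∀ z' ∈ C,
      HeightLe (2 * (U * U)) (z.1 - z'.1) ∧ HeightLe (2 * (U * U)) (z.2 - z'.2) :=
    fun hC z hz z' hz' =>
    ⟨(HeightLe.of_boundedQ hU (hC z hz).1).sub (HeightLe.of_boundedQ hU (hC z' hz').1),
      (HeightLe.of_boundedQ hU (hC z hz).2).sub (HeightLe.of_boundedQ hU (hC z' hz').2)⟩
  have hz1 := hZ hA a₁ ha₁
  have hw1 := hZ hB b₁ hb₁
  -- the differences have equal norms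
  have hnorm : ∀ a ∈ A, ∀ b ∈ B, R a b →
      (a.1 - a₁.1) * (a.1 - a₁.1) + (a.2 - a₁.2) * (a.2 - a₁.2) =
      (b.1 - b₁.1) * (b.1 - b₁.1) + (b.2 - b₁.2) * (b.2 - b₁.2) := by
    intro a ha b hb hab
    have h := hdiff a b a₁ b₁ hab h₁
    have hd : (M : GaussianInt) ∣ ((n * ((Z a - Z a₁).norm - (Z b - Z b₁).norm) : ℤ) :
        GaussianInt) := by
      have e1 := h.mul_right (star (Z a - Z a₁))
      have e2 := h.star.mul_left (τ * (Z b - Z b₁))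
      have e3 := hτ.mul_left (n * ((Z b - Z b₁) * star (Z b - Z b₁)))
      have e4 : Cong M (n * (Z a - Z a₁) * star (Z a - Z a₁))
          (n * ((Z b - Z b₁) * star (Z b - Z b₁)) * 1) := by
        refine e1.trans (Cong.trans ?_ e3)
        convert e2 using 1 <;> simp only [star_mul', star_natCast] <;> ring
      push_cast [norm_coe]
      unfold Cong at e4
      convert e4 using 1
      ring
    rw [natCast_dvd_intCast_gaussian] at hd
    have hz := hZ hA a ha
    have hw := hZ hB b hb
    have hh := hH hA a ha a₁ ha₁
    have hh' := hH hB b hb b₁ hb₁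
    refine sub_eq_zero.1 (eq_zero_of_dvd (U := U) hn (HeightLe.two_mul_sub_two_mul hh.1 hh.1 hh.2
      hh.2 hh'.1 hh'.1 hh'.2 hh'.2) ?_ hd hbound)
    push_cast [Zsqrtd.norm_def, Zsqrtd.re_sub, Zsqrtd.im_sub] at hz hw hz1 hw1 ⊢
    rw [hz.1, hz.2, hw.1, hw.2, hz1.1, hz1.2, hw1.1, hw1.2]
    ring
  -- the quotients of corresponding differences agree
  have hmul : ∀ a ∈ A, ∀ b ∈ B, ∀ a₂ ∈ A, ∀ b₂ ∈ B, R a b → R a₂ b₂ →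
      ((a.1 - a₁.1) * (b₂.1 - b₁.1) + (b.2 - b₁.2) * (a₂.2 - a₁.2) =
        (b.1 - b₁.1) * (a₂.1 - a₁.1) + (a.2 - a₁.2) * (b₂.2 - b₁.2)) ∧
      (a.1 - a₁.1) * (b₂.2 - b₁.2) + (a.2 - a₁.2) * (b₂.1 - b₁.1) =
        (b.1 - b₁.1) * (a₂.2 - a₁.2) + (b.2 - b₁.2) * (a₂.1 - a₁.1) := by
    intro a ha b hb a₂ ha₂ b₂ hb₂ hab hab₂
    have h := (hdiff a b a₁ b₁ hab h₁).mul_right (Z b₂ - Z b₁)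
    have h' := (hdiff a₂ b₂ a₁ b₁ hab₂ h₁).mul_left (Z b - Z b₁)
    have hd : (M : GaussianInt) ∣
        n * ((Z a - Z a₁) * (Z b₂ - Z b₁) - (Z b - Z b₁) * (Z a₂ - Z a₁)) := by
      have e : Cong M (n * (Z a - Z a₁) * (Z b₂ - Z b₁)) ((Z b - Z b₁) * (n * (Z a₂ - Z a₁))) := by
        refine h.trans (Cong.trans ?_ h'.symm)
        convert Cong.refl M _ using 1
        ring
      unfold Cong at e
      convert e using 1
      ring
    rw [natCast_dvd_iff] at hd
    simp only [Zsqrtd.re_mul, Zsqrtd.im_mul, Zsqrtd.re_sub, Zsqrtd.im_sub, Zsqrtd.re_natCast,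
      Zsqrtd.im_natCast, zero_mul, mul_zero, add_zero] at hd
    have hz := hZ hA a ha
    have hw := hZ hB b hb
    have hz2 := hZ hA a₂ ha₂
    have hw2 := hZ hB b₂ hb₂
    have hh := hH hA a ha a₁ ha₁
    have hh' := hH hB b hb b₁ hb₁
    have hk := hH hA a₂ ha₂ a₁ ha₁
    have hk' := hH hB b₂ hb₂ b₁ hb₁
    constructor
    · refine sub_eq_zero.1 (eq_zero_of_dvd (U := U) hn (HeightLe.two_mul_sub_two_mul hh.1 hk'.1
        hh'.2 hk.2 hh'.1 hk.1 hh.2 hk'.2) ?_ hd.1 hbound)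
      push_cast at hz hw hz1 hw1 hz2 hw2 ⊢
      rw [hz.1, hz.2, hw.1, hw.2, hz1.1, hz1.2, hw1.1, hw1.2, hz2.1, hz2.2, hw2.1, hw2.2]
      ring
    · refine sub_eq_zero.1 (eq_zero_of_dvd (U := U) hn (HeightLe.two_mul_sub_two_mul hh.1 hk'.2
        hh.2 hk'.1 hh'.1 hk.2 hh'.2 hk.1) ?_ hd.2 hbound)
      push_cast at hz hw hz1 hw1 hz2 hw2 ⊢
      rw [hz.1, hz.2, hw.1, hw.2, hz1.1, hz1.2, hw1.1, hw1.2, hz2.1, hz2.2, hw2.1, hw2.2]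
      ring
  suffices hgoal : ∃ ρ t : ℂ, ‖ρ‖ = 1 ∧ ∀ a ∈ A, ∀ b ∈ B, R a b →
      ρ * GeomHash.toComplex a + t = GeomHash.toComplex b by
    obtain ⟨ρ, t, hρ, hall⟩ := hgoal
    refine ⟨ρ, t, hρ, ?_⟩
    rw [Multiset.map_map, map_eq_map_iff_rel]
    exact hrel.mono fun a ha b hb hab => hall a ha b hb hab
  by_cases hall : ∀ a ∈ A, a = a₁
  · refine ⟨1, GeomHash.toComplex b₁ - GeomHash.toComplex a₁, by simp, fun a ha b hb hab => ?_⟩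
    have h := hnorm a ha b hb hab
    rw [hall a ha] at h ⊢
    have hb1 : b.1 - b₁.1 = 0 := by nlinarith [sq_nonneg (b.1 - b₁.1), sq_nonneg (b.2 - b₁.2)]
    have hb2 : b.2 - b₁.2 = 0 := by nlinarith [sq_nonneg (b.1 - b₁.1), sq_nonneg (b.2 - b₁.2)]
    rw [show b = b₁ from Prod.ext (sub_eq_zero.1 hb1) (sub_eq_zero.1 hb2)]
    ring
  · push Not at hall
    obtain ⟨a₂, ha₂, hne₂⟩ := hall
    obtain ⟨b₂, hb₂, h₂⟩ := Multiset.exists_mem_of_rel_of_mem hrel ha₂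
    set C := GeomHash.toComplex
    have hCinj : C a₂ - C a₁ ≠ 0 := by
      intro h0
      apply hne₂
      have := sub_eq_zero.1 h0
      simp only [C, GeomHash.toComplex, Complex.mk.injEq, Rat.cast_inj] at this
      exact Prod.ext this.1 this.2
    have hn2 : ‖C b₂ - C b₁‖ = ‖C a₂ - C a₁‖ := by
      have h := congrArg (Rat.cast (K := ℝ)) (hnorm a₂ ha₂ b₂ hb₂ h₂)
      push_cast at h
      rw [Complex.norm_def, Complex.norm_def]
      congr 1
      rw [Complex.normSq_apply, Complex.normSq_apply]
      simpa [C, GeomHash.toComplex] using h.symm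
    refine ⟨(C b₂ - C b₁) / (C a₂ - C a₁), C b₁ - (C b₂ - C b₁) / (C a₂ - C a₁) * C a₁, ?_, ?_⟩
    · rw [norm_div, hn2, div_self]
      exact norm_ne_zero_iff.2 hCinj
    · intro a ha b hb hab
      have h := hmul a ha b hb a₂ ha₂ b₂ hb₂ hab h₂
      have hre := congrArg (Rat.cast (K := ℝ)) h.1
      have him := congrArg (Rat.cast (K := ℝ)) h.2
      push_cast at hre him
      have hc : (C a - C a₁) * (C b₂ - C b₁) = (C b - C b₁) * (C a₂ - C a₁) := by
        apply Complex.ext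
        · simp only [C, GeomHash.toComplex, Complex.mul_re, Complex.sub_re, Complex.sub_im]
          linarith
        · simp only [C, GeomHash.toComplex, Complex.mul_im, Complex.sub_re, Complex.sub_im]
          linarith
      field_simp
      linear_combination hc

/-- Sets whose canonical positions agree modulo `P ^ 20`, up to quarter turns, are congruent. -/
theorem congruent_of_canon_eq {t u : ℕ} (hp : 1 ≤ p) (hU : 1 ≤ U) (hUP : U < 3 ^ p) (hn : 1 ≤ n)
    (hbound : n * (3 ^ p) ^ 2 * (8 * (2 * (U * U)) ^ 8) < (3 ^ p) ^ 20)
    (hA : BoundedPts U A) (hB : BoundedPts U B) (hcA : A.card = n) (hcB : B.card = n)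
    (h : canon (3 ^ p) t (A.map (resVec U (3 ^ p) A)) =
      canon (3 ^ p) u (B.map (resVec U (3 ^ p) B))) : Congruent A B := by
  rw [canon, canon, Multiset.map_map, Multiset.map_map, map_eq_map_iff_rel] at h
  have hunit : ∀ (t : ℕ) (W : Multiset (ℕ × ℕ)), Cong ((3 ^ p) ^ 20)
      (iunit ^ t * toG (turn (3 ^ p) W) * star (iunit ^ t * toG (turn (3 ^ p) W))) 1 := by
    intro t W
    have hP : 1 < (3 ^ p) ^ 21 :=
      Nat.one_lt_pow (by omega) (Nat.one_lt_pow (by omega) (by norm_num))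
    have h1 := ((normOne_iff hP _).1 (normalizer_normOne hP (liveCount (3 ^ p) W)
      (red ((3 ^ p) ^ 21) (unitProd (3 ^ p) W)))).of_dvd
      (pow_dvd_pow (3 ^ p) (by norm_num : 20 ≤ 21))
    have hi : iunit * star iunit = 1 := by ext <;> simp [iunit]
    convert h1 using 1
    rw [star_mul', star_pow, turn]
    have : iunit ^ t * star iunit ^ t = 1 := by rw [← mul_pow, hi, one_pow]
    linear_combination (toG (normalizer ((3 ^ p) ^ 21) (liveCount (3 ^ p) W)
      (red ((3 ^ p) ^ 21) (unitProd (3 ^ p) W))) * star (toG (normalizer ((3 ^ p) ^ 21)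
      (liveCount (3 ^ p) W) (red ((3 ^ p) ^ 21) (unitProd (3 ^ p) W))))) * this
  refine congruent_of_rel hU hUP hn hbound hA hB hcA hcB
    (hunit t (A.map (resVec U (3 ^ p) A))) (hunit u (B.map (resVec U (3 ^ p) B))) (h.mono ?_)
  intro a _ b _ hab
  simpa only [Function.comp_apply, red_eq_red (show 0 < (3 ^ p) ^ 20 by positivity)] using hab

end Soundness

/-! ### Fingerprints -/

/-- The fingerprint of a multiset of residues modulo `M`: the monic polynomial with the negated
codes of its members as roots, evaluated at `x` modulo `Q`. -/
def fingerprint (Q M x : ℕ) (W : Multiset (ℕ × ℕ)) : ℕ :=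
  (W.map fun w => x + code M w).prod % Q

open Polynomial in
/-- Two different multisets have the same fingerprint for few points of evaluation only. -/
theorem card_fingerprint_eq_le {Q M n : ℕ} (hQ : Q.Prime) (hMQ : M ^ 2 ≤ Q)
    {W W' : Multiset (ℕ × ℕ)} (hW : ∀ w ∈ W, w.1 < M ∧ w.2 < M) (hW' : ∀ w ∈ W', w.1 < M ∧ w.2 < M)
    (hc : W.card = n) (hc' : W'.card = n) (hne : W ≠ W') :
    (Finset.univ.filter fun x : Fin Q =>
      fingerprint Q M x W = fingerprint Q M x W').card ≤ n := by
  have : Fact Q.Prime := ⟨hQ⟩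
  set F : Multiset (ℕ × ℕ) → (ZMod Q)[X] := fun W =>
    ((W.map fun w => -(code M w : ZMod Q)).map fun a => X - C a).prod with hF
  have hdeg : ∀ W, (F W).natDegree = W.card := fun W => by
    simp only [hF]
    rw [natDegree_multiset_prod_X_sub_C_eq_card, Multiset.card_map]
  have heval : ∀ (W : Multiset (ℕ × ℕ)) (x : ℕ),
      (F W).eval (x : ZMod Q) = (fingerprint Q M x W : ℕ) := by
    intro W x
    rw [fingerprint, ZMod.natCast_mod]
    simp only [hF]
    rw [Multiset.map_map, eval_multiset_prod, Multiset.map_map,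
      Nat.cast_multiset_prod, Multiset.map_map]
    congr 1
    refine Multiset.map_congr rfl fun w _ => ?_
    simp
  have hFne : F W - F W' ≠ 0 := by
    intro h
    apply hne
    have hr := congrArg roots (sub_eq_zero.1 h)
    simp only [hF, roots_multiset_prod_X_sub_C] at hr
    rw [map_eq_map_iff_rel] at hr
    rw [← Multiset.rel_eq]
    refine hr.mono fun a ha b hb hab => ?_
    have ha' := hW a ha
    have hb' := hW' b hb
    have hab' := (ZMod.natCast_eq_natCast_iff _ _ _).1 (neg_injective hab)
    exact code_injective ha'.1 hb'.1 (hab'.eq_of_lt_of_lt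
      ((code_lt ha'.1 ha'.2).trans_le hMQ) ((code_lt hb'.1 hb'.2).trans_le hMQ))
  calc _ ≤ (F W - F W').roots.toFinset.card := by
        refine Finset.card_le_card_of_injOn (fun x : Fin Q => ((x : ℕ) : ZMod Q)) ?_ ?_
        · intro x hx
          have hx' := (Finset.mem_filter.1 hx).2
          rw [Finset.mem_coe, Multiset.mem_toFinset, mem_roots hFne, IsRoot, eval_sub, heval, heval,
            hx', sub_self]
        · intro x _ y _ hxy
          exact Fin.ext (((ZMod.natCast_eq_natCast_iff _ _ _).1 hxy).eq_of_lt_of_lt x.2 y.2)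
    _ ≤ (F W - F W').roots.card := Multiset.toFinset_card_le _
    _ ≤ (F W - F W').natDegree := card_roots' _
    _ ≤ n := (natDegree_sub_le _ _).trans (by rw [hdeg, hdeg, hc, hc', max_self])

/-- The hash value of a multiset of residues: the least fingerprint of its canonical position up
to quarter turns. -/
def hashVal (Q P x : ℕ) (W : Multiset (ℕ × ℕ)) : ℕ :=
  min (min (min (fingerprint Q (P ^ 20) x (canon P 0 W)) (fingerprint Q (P ^ 20) x (canon P 1 W)))
    (fingerprint Q (P ^ 20) x (canon P 2 W))) (fingerprint Q (P ^ 20) x (canon P 3 W))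

theorem hashVal_le (Q P x : ℕ) (W : Multiset (ℕ × ℕ)) {t : ℕ} (ht : t < 4) :
    hashVal Q P x W ≤ fingerprint Q (P ^ 20) x (canon P t W) := by
  interval_cases t <;> simp [hashVal]

theorem exists_hashVal_eq (Q P x : ℕ) (W : Multiset (ℕ × ℕ)) :
    ∃ t < 4, hashVal Q P x W = fingerprint Q (P ^ 20) x (canon P t W) := by
  unfold hashVal
  set f := fun t => fingerprint Q (P ^ 20) x (canon P t W)
  change ∃ t < 4, min (min (min (f 0) (f 1)) (f 2)) (f 3) = f t
  rcases min_choice (min (min (f 0) (f 1)) (f 2)) (f 3) with h | h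
  · rcases min_choice (min (f 0) (f 1)) (f 2) with h' | h'
    · rcases min_choice (f 0) (f 1) with h'' | h''
      · exact ⟨0, by norm_num, by rw [h, h', h'']⟩
      · exact ⟨1, by norm_num, by rw [h, h', h'']⟩
    · exact ⟨2, by norm_num, by rw [h, h']⟩
  · exact ⟨3, by norm_num, h⟩

/-- The four fingerprints of `W'` are among those of `W` if their canonical positions agree up to
quarter turns. -/
theorem hashVal_le_of_canon {Q P x : ℕ} {W W' : Multiset (ℕ × ℕ)} {t : ℕ}
    (h : ∀ u, canon P u W' = canon P (t + u) W) : hashVal Q P x W ≤ hashVal Q P x W' := by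
  obtain ⟨u, -, hu⟩ := exists_hashVal_eq Q P x W'
  have hmod : ∀ k, canon P (k % 4) W = canon P k W := by
    intro k
    conv_rhs => rw [← Nat.mod_add_div k 4]
    generalize k / 4 = q
    induction q with
    | zero => rfl
    | succ q ih => rw [ih, Nat.mul_succ, ← add_assoc, canon_add_four]
  rw [hu, h, ← hmod]
  exact hashVal_le _ _ _ _ (Nat.mod_lt _ (by norm_num))

open Classical in
/-- For all but a small fraction of the points of evaluation, hash values are equal if and only if
the multisets are congruent. -/
theorem card_bad_le {U p n m Q : ℕ} (hp : 1 ≤ p) (hU : 1 ≤ U) (hn : 1 ≤ n) (hnP : n < 3 ^ p)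
    (hUP : U < 3 ^ p) (hbound : n * (3 ^ p) ^ 2 * (8 * (2 * (U * U)) ^ 8) < (3 ^ p) ^ 20)
    (hQ : Q.Prime) (hQP : ((3 ^ p) ^ 20) ^ 2 ≤ Q) (hQm : 16 * m ^ 2 * n ^ 2 ≤ Q)
    (A : Fin m → Multiset (ℚ × ℚ)) (hA : ∀ i, BoundedPts U (A i)) (hc : ∀ i, (A i).card = n) :
    n * (Finset.univ.filter fun x : Fin Q => ¬ ∀ i j,
      (hashVal Q (3 ^ p) x ((A i).map (resVec U (3 ^ p) (A i))) =
        hashVal Q (3 ^ p) x ((A j).map (resVec U (3 ^ p) (A j))) ↔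
          Congruent (A i) (A j))).card ≤ Q := by
  set W : Fin m → Multiset (ℕ × ℕ) := fun i => (A i).map (resVec U (3 ^ p) (A i)) with hW
  have hcong : ∀ x i j, Congruent (A i) (A j) →
      hashVal Q (3 ^ p) x (W i) = hashVal Q (3 ^ p) x (W j) := by
    have hle : ∀ x i j, Congruent (A i) (A j) →
        hashVal Q (3 ^ p) x (W i) ≤ hashVal Q (3 ^ p) x (W j) := by
      intro x i j hij
      obtain ⟨r, hr, hrW⟩ := exists_normOne_of_congruent hU hUP (hA i) (hA j) hij
      obtain ⟨t, -, ht⟩ := canon_rotate hp hr (W i) (by simpa [hW, hc] using hnP)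
      exact hashVal_le_of_canon (t := t) fun u => by rw [← ht u]; exact congrArg _ hrW
    have hsymm : ∀ i j, Congruent (A i) (A j) → Congruent (A j) (A i) := by
      rintro i j ⟨ρ, t, hρ, h⟩
      have h0 : ρ ≠ 0 := norm_ne_zero_iff.1 (by rw [hρ]; norm_num)
      refine ⟨ρ⁻¹, -(ρ⁻¹ * t), by rw [norm_inv, hρ, inv_one], ?_⟩
      rw [← h, Multiset.map_map]
      conv_rhs => rw [← Multiset.map_id ((A i).map GeomHash.toComplex)]
      refine Multiset.map_congr rfl fun z _ => ?_
      simp only [Function.comp_apply, id]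
      field_simp
      ring
    exact fun x i j hij => le_antisymm (hle x i j hij) (hle x j i (hsymm i j hij))
  -- a bad point confuses two canonical positions
  have hsub : (Finset.univ.filter fun x : Fin Q => ¬ ∀ i j,
      (hashVal Q (3 ^ p) x (W i) = hashVal Q (3 ^ p) x (W j) ↔ Congruent (A i) (A j))) ⊆
      (Finset.univ : Finset ((Fin m × Fin m) × (Fin 4 × Fin 4))).biUnion fun q =>
        Finset.univ.filter fun x : Fin Q =>
          canon (3 ^ p) q.2.1 (W q.1.1) ≠ canon (3 ^ p) q.2.2 (W q.1.2) ∧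
          fingerprint Q ((3 ^ p) ^ 20) x (canon (3 ^ p) q.2.1 (W q.1.1)) =
          fingerprint Q ((3 ^ p) ^ 20) x (canon (3 ^ p) q.2.2 (W q.1.2)) := by
    intro x hx
    have hx' := (Finset.mem_filter.1 hx).2
    push Not at hx'
    obtain ⟨i, j, h | h⟩ := hx'
    · obtain ⟨t, ht, et⟩ := exists_hashVal_eq Q (3 ^ p) x (W i)
      obtain ⟨u, hu, eu⟩ := exists_hashVal_eq Q (3 ^ p) x (W j)
      refine Finset.mem_biUnion.2 ⟨((i, j), (⟨t, ht⟩, ⟨u, hu⟩)), Finset.mem_univ _,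
        Finset.mem_filter.2 ⟨Finset.mem_univ _, fun he => h.2 ?_, ?_⟩⟩
      · exact congruent_of_canon_eq hp hU hUP hn hbound (hA i) (hA j) (hc i) (hc j) he
      · rw [← et, ← eu]; exact h.1
    · exact (h.1 (hcong x i j h.2)).elim
  have hcard : ∀ q : (Fin m × Fin m) × (Fin 4 × Fin 4), (Finset.univ.filter fun x : Fin Q =>
          canon (3 ^ p) q.2.1 (W q.1.1) ≠ canon (3 ^ p) q.2.2 (W q.1.2) ∧
          fingerprint Q ((3 ^ p) ^ 20) x (canon (3 ^ p) q.2.1 (W q.1.1)) =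
          fingerprint Q ((3 ^ p) ^ 20) x (canon (3 ^ p) q.2.2 (W q.1.2))).card ≤ n := by
    intro q
    by_cases hne : canon (3 ^ p) q.2.1 (W q.1.1) = canon (3 ^ p) q.2.2 (W q.1.2)
    · simp [hne]
    · simp only [ne_eq, hne, not_false_eq_true, true_and]
      have hlt : ∀ t i, ∀ w ∈ canon (3 ^ p) t (W i), w.1 < (3 ^ p) ^ 20 ∧ w.2 < (3 ^ p) ^ 20 := by
        intro t i w hw
        obtain ⟨v, -, rfl⟩ := Multiset.mem_map.1 hw
        exact red_lt (by positivity) _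
      refine card_fingerprint_eq_le hQ hQP (hlt _ _) (hlt _ _) ?_ ?_ hne <;> simp [canon, hW, hc]
  have h1 := (Finset.card_le_card hsub).trans (Finset.card_biUnion_le.trans
    (Finset.sum_le_card_nsmul _ _ n fun q _ => hcard q))
  have h2 : (Finset.univ : Finset ((Fin m × Fin m) × (Fin 4 × Fin 4))).card • n =
      16 * m ^ 2 * n := by
    simp only [Finset.card_univ, Fintype.card_prod, Fintype.card_fin, smul_eq_mul]
    ring
  rw [h2] at h1
  calc _ ≤ n * (16 * m ^ 2 * n) := Nat.mul_le_mul_left n h1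
    _ = 16 * m ^ 2 * n ^ 2 := by ring
    _ ≤ Q := hQm

/-! ### Building blocks of programs -/

/-!
Use of the memory by the programs below. Array `0` holds the parameters, array `1` the current
datum, array `2` the output, and cell `(4, 0)` the clamp. Array `3` is scratch space; its cells `0`,
`1`, `2` keep the power of three `P`, the prime `Q`, and the random point of evaluation. The arrays
`5`, …, `14` have one cell per label: the sum of the residues (`5`, `6`), the number of live
residues (`7`) and the product of their parts prime to `3` (`8`, `9`), the four fingerprints (`10`, …,
`13`), and a mark for labels that have occurred (`14`). As all cells start with `0`, an empty
product is stored as `0` and recognized by the count or the mark.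
-/

/-- Cell `c` of the scratch array. -/
def var (c : ℕ) : Expr := .cell 3 (.const c)

/-- The cell of the array `a` that belongs to the label of the current datum. -/
def lab (a : ℕ) : Expr := .cell a (.cell 1 (.const 0))

/-- Clamped assignment to cell `c` of the scratch array. -/
def put (c : ℕ) (e : Expr) : Prog := .assign 3 (.const c) (.mod e (.cell 4 (.const 0)))

/-- Clamped assignment to the cell of the array `a` that belongs to the current label. -/
def store (a : ℕ) (e : Expr) : Prog :=
  .assign a (.cell 1 (.const 0)) (.mod e (.cell 4 (.const 0)))

/-- Powers of an expression. -/
def powE (e : Expr) : ℕ → Expr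
  | 0 => .const 1
  | k + 1 => .mul (powE e k) e

/-- Equality test: `1` if the values are equal and `0` otherwise, by truncated subtraction. -/
def eqE (a b : Expr) : Expr := .sub (.const 1) (.add (.sub a b) (.sub b a))

/-- Real part of `(a + b i) (c + d i)` modulo `M`. -/
def reE (M a b c d : Expr) : Expr :=
  .mod (.add (.mul a c) (.sub M (.mod (.mul b d) M))) M

/-- Imaginary part of `(a + b i) (c + d i)` modulo `M`. -/
def imE (M a b c d : Expr) : Expr := .mod (.add (.mul a d) (.mul b c)) M

@[simp] theorem ev_const (f : State) (c : ℕ) : (Expr.const c).ev f = c := rfl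
@[simp] theorem ev_cell (f : State) (a : ℕ) (i : Expr) : (Expr.cell a i).ev f = f (a, i.ev f) := rfl
@[simp] theorem ev_add (f : State) (a b : Expr) : (Expr.add a b).ev f = a.ev f + b.ev f := rfl
@[simp] theorem ev_sub (f : State) (a b : Expr) : (Expr.sub a b).ev f = a.ev f - b.ev f := rfl
@[simp] theorem ev_mul (f : State) (a b : Expr) : (Expr.mul a b).ev f = a.ev f * b.ev f := rfl
@[simp] theorem ev_div (f : State) (a b : Expr) : (Expr.div a b).ev f = a.ev f / b.ev f := rfl
@[simp] theorem ev_mod (f : State) (a b : Expr) : (Expr.mod a b).ev f = a.ev f % b.ev f := rfl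
@[simp] theorem ev_var (f : State) (c : ℕ) : (var c).ev f = f (3, c) := rfl
@[simp] theorem ev_lab (f : State) (a : ℕ) : (lab a).ev f = f (a, f (1, 0)) := rfl

@[simp] theorem ev_powE (f : State) (e : Expr) (k : ℕ) : (powE e k).ev f = e.ev f ^ k := by
  induction k with
  | zero => rfl
  | succ k ih => rw [powE, ev_mul, ih, pow_succ]

theorem ev_eqE_ne_zero (f : State) (a b : Expr) : (eqE a b).ev f ≠ 0 ↔ a.ev f = b.ev f := by
  simp only [eqE, ev_sub, ev_add, ev_const]
  omega

theorem sem_seq (c d : Prog) (f : State) : (Prog.seq c d).sem f = d.sem (c.sem f) := rfl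

theorem sem_ite_pos {e : Expr} {c d : Prog} {f : State} (h : e.ev f ≠ 0) :
    (Prog.ite e c d).sem f = c.sem f := if_pos h

theorem sem_ite_neg {e : Expr} {c d : Prog} {f : State} (h : ¬ e.ev f ≠ 0) :
    (Prog.ite e c d).sem f = d.sem f := if_neg h

theorem sem_put {B c v : ℕ} {e : Expr} {f : State} (hB : f (4, 0) = B) (hv : e.ev f = v)
    (h : v < B) : (put c e).sem f = Function.update f (3, c) v := by
  simp [put, Prog.sem, hB, hv, Nat.mod_eq_of_lt h]

theorem sem_store {B a v i : ℕ} {e : Expr} {f : State} (hB : f (4, 0) = B) (hi : f (1, 0) = i)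
    (hv : e.ev f = v) (h : v < B) : (store a e).sem f = Function.update f (a, i) v := by
  simp [store, Prog.sem, hB, hi, hv, Nat.mod_eq_of_lt h]

@[simp] theorem avoids_put (c : ℕ) (e : Expr) (k : ℕ × ℕ) :
    (put c e).avoids k ↔ (3, c) ≠ k := Iff.rfl

@[simp] theorem avoids_store (a : ℕ) (e : Expr) (k : ℕ × ℕ) :
    (store a e).avoids k ↔ a ≠ k.1 := Iff.rfl

@[simp] theorem avoids_seq (c d : Prog) (k : ℕ × ℕ) :
    (Prog.seq c d).avoids k ↔ c.avoids k ∧ d.avoids k := Iff.rfl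

@[simp] theorem avoids_ite (e : Expr) (c d : Prog) (k : ℕ × ℕ) :
    (Prog.ite e c d).avoids k ↔ c.avoids k ∧ d.avoids k := Iff.rfl

@[simp] theorem avoids_loop (e : Expr) (c : Prog) (k : ℕ × ℕ) :
    (Prog.loop e c).avoids k ↔ c.avoids k := Iff.rfl

@[simp] theorem avoids_skip (k : ℕ × ℕ) : Prog.skip.avoids k ↔ True := Iff.rfl

theorem clamped_put {c : ℕ} (hc : c < 64) (e : Expr) : (put c e).Clamped :=
  ⟨Or.inl ⟨rfl, c, hc, rfl⟩, e, rfl⟩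

theorem clamped_store {a : ℕ} (ha : a = 2 ∨ 5 ≤ a ∧ a < 16) (e : Expr) : (store a e).Clamped :=
  ⟨Or.inr ⟨ha, rfl⟩, e, rfl⟩

/-- The multiplication of reduced residues. -/
theorem red_mul {M : ℕ} (hM : 0 < M) (a b c d : ℕ) : red M (toG (a, b) * toG (c, d)) =
    ((a * c + (M - b * d % M)) % M, (a * d + b * c) % M) := by
  have h : ∀ x y : ℕ, x < M → y < M → (x, y) = red M (toG (x, y)) := fun x y hx hy =>
    (red_toG hx hy).symm
  rw [h _ _ (Nat.mod_lt _ hM) (Nat.mod_lt _ hM), red_eq_red hM, Cong, natCast_dvd_iff]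
  have hlt := Nat.mod_lt (b * d) hM
  have h1 := Nat.div_add_mod (a * c + (M - b * d % M)) M
  have h2 := Nat.div_add_mod (b * d) M
  have h3 := Nat.div_add_mod (a * d + b * c) M
  generalize (a * c + (M - b * d % M)) % M = r at *
  zify [hlt.le] at h1 h2 h3
  simp only [toG, Zsqrtd.re_sub, Zsqrtd.im_sub, Zsqrtd.re_mul, Zsqrtd.im_mul]
  push_cast
  constructor
  · refine ⟨(a * c + (M - b * d % M)) / M - 1 - b * d / M, ?_⟩
    linear_combination -h1 + h2
  · refine ⟨(a * d + b * c) / M, ?_⟩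
    linear_combination -h3

theorem ev_reE_imE {f : State} {M a b c d : Expr} (hM : 0 < M.ev f) :
    ((reE M a b c d).ev f, (imE M a b c d).ev f) =
      red (M.ev f) (toG (a.ev f, b.ev f) * toG (c.ev f, d.ev f)) := by
  rw [red_mul hM]
  rfl

/-- The quantities that are fixed during the passes: size `n` and precision `U` of the query sets,
exponent `p` of the power of three, clamp `B`, prime modulus `Q`, point of evaluation `x`. -/
structure Params where
  n : ℕ
  U : ℕ
  p : ℕ
  B : ℕ
  Q : ℕ
  x : ℕ
  hp : 1 ≤ p
  hU : 1 ≤ U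
  hUP : U < 3 ^ p
  hnP : n < 3 ^ p
  hPB : (3 ^ p) ^ 43 < B
  hQB : Q < B
  hQ : Q.Prime

/-- The fixed quantities stand in their cells. -/
structure Base (e : Params) (f : State) : Prop where
  n : f (0, 0) = e.n
  clamp : f (4, 0) = e.B
  P : f (3, 0) = 3 ^ e.p
  Q : f (3, 1) = e.Q
  x : f (3, 2) = e.x

theorem Base.sem {e : Params} {f : State} (h : Base e f) {c : Prog} (hc : c.Clamped)
    (h0 : c.avoids (3, 0)) (h1 : c.avoids (3, 1)) (h2 : c.avoids (3, 2)) : Base e (c.sem f) :=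
  ⟨by rw [c.sem_fixed hc _ _ _ (by simp), h.n], by rw [c.sem_fixed hc _ _ _ (by simp), h.clamp],
    by rw [c.sem_of_avoids _ h0, h.P], by rw [c.sem_of_avoids _ h1, h.Q],
    by rw [c.sem_of_avoids _ h2, h.x]⟩

theorem Params.pow_lt (e : Params) {k : ℕ} (hk : k ≤ 43) : (3 ^ e.p) ^ k < e.B :=
  (Nat.pow_le_pow_right (by positivity) hk).trans_lt e.hPB

/-- The current datum has the label `i`, and its code stands in array `1`. -/
structure HasDatum (f : State) (i : ℕ) (z : ℚ × ℚ) : Prop where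
  label : f (1, 0) = i
  sgnX : f (1, 1) = if z.1 < 0 then 1 else 0
  numX : f (1, 2) = z.1.num.natAbs
  denX : f (1, 3) = z.1.den
  sgnY : f (1, 4) = if z.2 < 0 then 1 else 0
  numY : f (1, 5) = z.2.num.natAbs
  denY : f (1, 6) = z.2.den

theorem HasDatum.sem {f : State} {i : ℕ} {z : ℚ × ℚ} (h : HasDatum f i z) {c : Prog}
    (hc : c.Clamped) : HasDatum (c.sem f) i z := by
  constructor <;> rw [c.sem_fixed hc _ _ _ (by simp)]
  exacts [h.1, h.2, h.3, h.4, h.5, h.6, h.7]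

/-! ### Residues by exhaustive search -/

/-- Computes into cell `dst` the residue of the rational in the cells `o`, `o + 1`, `o + 2` of the
input array. -/
def residProg (o dst : ℕ) : Prog :=
  .seq (put 10 (.const 0)) <| .seq (put 11 (.const 0)) <|
  .seq (.loop (powE (var 0) 43) <|
    .seq (.ite (eqE (.mod (.mul (.cell 1 (.const (o + 2))) (var 10)) (powE (var 0) 43))
        (.mod (.mul (var 0) (.cell 1 (.const (o + 1)))) (powE (var 0) 43)))
      (put 11 (var 10)) .skip) <|
    put 10 (.add (var 10) (.const 1))) <|
  .ite (.cell 1 (.const o))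
    (put dst (.mod (.sub (powE (var 0) 42) (.mod (var 11) (powE (var 0) 42))) (powE (var 0) 42)))
    (put dst (.mod (var 11) (powE (var 0) 42)))

theorem clamped_residProg {o dst : ℕ} (h : dst < 64) : (residProg o dst).Clamped :=
  ⟨clamped_put (by norm_num) _, clamped_put (by norm_num) _,
    ⟨⟨clamped_put (by norm_num) _, trivial⟩, clamped_put (by norm_num) _⟩,
    clamped_put h _, clamped_put h _⟩

theorem avoids_residProg (o dst : ℕ) (k : ℕ × ℕ) : (residProg o dst).avoids k ↔
    (3, 10) ≠ k ∧ (3, 11) ≠ k ∧ (3, dst) ≠ k := by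
  simp [residProg]
  tauto

theorem boundedQ_abs {U : ℕ} {x : ℚ} (hx : x ∈ boundedQ U) : |x| ∈ boundedQ U := by
  rcases hx with ⟨p, hp, q, hq, rfl | rfl⟩ | rfl
  · exact Or.inl ⟨p, hp, q, hq, Or.inl (abs_of_nonneg (by positivity))⟩
  · exact Or.inl ⟨p, hp, q, hq, Or.inl (by rw [abs_neg, abs_of_nonneg (by positivity)])⟩
  · exact Or.inr (by simp)

theorem sem_residProg {e : Params} {f : State} (hf : Base e f) {o dst : ℕ} {x : ℚ}
    (hx : x ∈ boundedQ e.U) (h0 : f (1, o) = if x < 0 then 1 else 0)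
    (h1 : f (1, o + 1) = x.num.natAbs) (h2 : f (1, o + 2) = x.den) :
    (residProg o dst).sem f (3, dst) = resN e.U (3 ^ e.p) x := by
  set P := 3 ^ e.p with hP
  have hPpos : 0 < P := by positivity
  have hB0 : 0 < e.B := (Nat.zero_le _).trans_lt e.hPB
  rw [residProg, sem_seq, sem_seq, sem_seq]
  rw [sem_put hf.clamp (v := 0) rfl hB0,
    sem_put (v := 0) (B := e.B) (by simpa using hf.clamp) rfl hB0]
  set f₂ := Function.update (Function.update f (3, 10) 0) (3, 11) 0 with e₂
  have hin : ∀ k, k ≠ (3, 10) → k ≠ (3, 11) → f₂ k = f k := by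
    intro k hk hk'
    rw [e₂, Function.update_of_ne hk', Function.update_of_ne hk]
  set sol : ℕ → Prop := fun c => x.den * c % P ^ 43 = P * x.num.natAbs % P ^ 43
  set body : Prog := _
  set f₃ := (Prog.loop (powE (var 0) 43) body).sem f₂
  have hcell : ∀ g : State, (∀ k, body.avoids k → g k = f₂ k) →
      g (4, 0) = e.B ∧ g (3, 0) = P ∧ g (1, o) = f (1, o) ∧ g (1, o + 1) = x.num.natAbs ∧
        g (1, o + 2) = x.den := by
    intro g hg
    refine ⟨?_, ?_, ?_, ?_, ?_⟩ <;> rw [hg _ (by simp [body]), hin _ (by simp) (by simp)]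
    exacts [hf.clamp, hf.P, h1, h2]
  have hN : (powE (var 0) 43).ev f₂ = P ^ 43 := by
    rw [ev_powE, ev_var, hin _ (by simp) (by simp), hf.P]
  have hloop := Prog.loop_rule (e := powE (var 0) 43) (c := body) (f := f₂)
    (fun k g => g (3, 10) = k ∧ ((∃ c < k, sol c) → sol (g (3, 11)))) (by simp [e₂])
    (by
      intro k g hk hg hI
      rw [hN] at hk
      obtain ⟨g4, g3, -, gn, gd⟩ := hcell g hg
      obtain ⟨hI1, hI2⟩ := hI
      have hkB : k + 1 < e.B := by have := e.hPB; rw [← hP] at this; omega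
      have hcond : (eqE (.mod (.mul (.cell 1 (.const (o + 2))) (var 10)) (powE (var 0) 43))
        (.mod (.mul (var 0) (.cell 1 (.const (o + 1)))) (powE (var 0) 43))).ev g ≠ 0 ↔ sol k := by
        rw [ev_eqE_ne_zero]
        simp [gn, gd, g3, hI1, sol]
      rw [sem_seq]
      by_cases hs : sol k
      · rw [sem_ite_pos (hcond.2 hs), sem_put g4 (v := k) (by simpa using hI1) (by omega),
          sem_put (B := e.B) (v := k + 1) (by simpa using g4) (by simpa using hI1) hkB]
        simp [hs]
      · rw [sem_ite_neg (fun h => hs (hcond.1 h)), Prog.sem,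
          sem_put (B := e.B) (v := k + 1) g4 (by simpa using hI1) hkB]
        simp only [Function.update_self, true_and]
        rintro ⟨c, hc, hcs⟩
        rw [Function.update_of_ne (by simp)]
        refine hI2 ⟨c, ?_, hcs⟩
        rcases Nat.lt_succ_iff_lt_or_eq.1 hc with h | rfl
        · exact h
        · exact (hs hcs).elim)
  rw [hN] at hloop
  have hsol : sol (f₃ (3, 11)) := hloop.2 (exists_modEq_residue e.hU e.hUP hx)
  obtain ⟨g4, g3, gs, -, -⟩ := hcell f₃ fun k hk => Prog.sem_of_avoids _ _ (by exact hk) _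
  have habs := resN_abs_of_modEq e.hU e.hUP hx hsol (boundedQ_abs hx)
  have hlt : P ^ 42 < e.B := e.pow_lt (by norm_num)
  by_cases hneg : x < 0
  · rw [sem_ite_pos (by simp [gs, h0, hneg]), sem_put (v := resN e.U P x) g4 ?_
      ((resN_lt _ _ _).trans hlt), Function.update_self]
    simp only [ev_mod, ev_sub, ev_powE, ev_var, g3]
    rw [habs, ← resN_neg, abs_of_neg hneg, neg_neg]
  · rw [sem_ite_neg (by simp [gs, h0, hneg]), sem_put (v := resN e.U P x) g4 ?_
      ((resN_lt _ _ _).trans hlt), Function.update_self]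
    simp only [ev_mod, ev_powE, ev_var, g3]
    rw [habs, abs_of_nonneg (not_lt.1 hneg)]

/-! ### The first two passes -/

theorem toG_add (a b c d : ℕ) : toG (a, b) + toG (c, d) = toG (a + c, b + d) := by
  ext <;> simp [toG]

theorem red_toG_eq_mod (M a b : ℕ) : red M (toG (a, b)) = (a % M, b % M) := by
  simp only [red, toG, ← Int.natCast_mod, Int.toNat_natCast]

theorem red_sub {M a b c d n : ℕ} (hc : c < M) (hd : d < M) :
    red M (n * toG (a, b) - toG (c, d)) = ((n * a + (M - c)) % M, (n * b + (M - d)) % M) := by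
  rw [← red_toG_eq_mod, red_eq_red (by omega), Cong, natCast_dvd_iff]
  simp only [toG, Zsqrtd.re_sub, Zsqrtd.im_sub, Zsqrtd.re_mul, Zsqrtd.im_mul, Zsqrtd.re_natCast,
    Zsqrtd.im_natCast]
  push_cast [hc.le, hd.le]
  exact ⟨⟨-1, by ring⟩, ⟨-1, by ring⟩⟩

/-- The modulus `P ^ k`. -/
def modE (k : ℕ) : Expr := powE (var 0) k

theorem Base.ev_modE {e : Params} {f : State} (h : Base e f) (k : ℕ) :
    (modE k).ev f = (3 ^ e.p) ^ k := by
  rw [modE, ev_powE, ev_var, h.P]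

/-- Both coordinates of a point are `U`-rational. -/
def BoundedPt (U : ℕ) (z : ℚ × ℚ) : Prop := z.1 ∈ boundedQ U ∧ z.2 ∈ boundedQ U

/-- The residue of the current point, in the cells `20` and `21`. -/
def pointProg : Prog := .seq (residProg 1 20) (residProg 4 21)

theorem clamped_pointProg : pointProg.Clamped :=
  ⟨clamped_residProg (by norm_num), clamped_residProg (by norm_num)⟩

theorem avoids_pointProg (k : ℕ × ℕ) : pointProg.avoids k ↔
    (3, 10) ≠ k ∧ (3, 11) ≠ k ∧ (3, 20) ≠ k ∧ (3, 21) ≠ k := by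
  simp only [pointProg, avoids_seq, avoids_residProg]
  tauto

theorem sem_pointProg {e : Params} {f : State} (hf : Base e f) {i : ℕ} {z : ℚ × ℚ}
    (hd : HasDatum f i z) (hz : BoundedPt e.U z) :
    (pointProg.sem f (3, 20), pointProg.sem f (3, 21)) = resPt e.U (3 ^ e.p) z := by
  have hc : (residProg 1 20).Clamped := clamped_residProg (by norm_num)
  have hf' : Base e ((residProg 1 20).sem f) := hf.sem hc (by simp [avoids_residProg])
    (by simp [avoids_residProg]) (by simp [avoids_residProg])
  have hd' := hd.sem hc
  rw [pointProg, sem_seq, resPt]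
  refine Prod.ext ?_ (sem_residProg hf' hz.2 hd'.sgnY hd'.numY hd'.denY)
  rw [Prog.sem_of_avoids _ _ (by simp [avoids_residProg])]
  exact sem_residProg hf hz.1 hd.sgnX hd.numX hd.denX

/-- First pass: add up the residues of the points, in the arrays `5` and `6`. -/
def sumStep : Prog :=
  .seq pointProg <| .seq (store 5 (.mod (.add (lab 5) (var 20)) (modE 42)))
    (store 6 (.mod (.add (lab 6) (var 21)) (modE 42)))

theorem clamped_sumStep : sumStep.Clamped :=
  ⟨clamped_pointProg, clamped_store (by norm_num) _, clamped_store (by norm_num) _⟩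

theorem sem_sumStep {e : Params} {f : State} (hf : Base e f) {i : ℕ} {z : ℚ × ℚ}
    (hd : HasDatum f i z) (hz : BoundedPt e.U z) {S : GaussianInt}
    (hS : (f (5, i), f (6, i)) = red ((3 ^ e.p) ^ 42) S) :
    (sumStep.sem f (5, i), sumStep.sem f (6, i)) =
      red ((3 ^ e.p) ^ 42) (S + toG (resPt e.U (3 ^ e.p) z)) ∧
    ∀ a, a ≠ 3 → a ≠ 5 → a ≠ 6 → sumStep.sem f (a, i) = f (a, i) := by
  set M := (3 ^ e.p) ^ 42 with hM
  have hM0 : 0 < M := by positivity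
  have hMB : M < e.B := e.pow_lt (by norm_num)
  have hp := sem_pointProg hf hd hz
  set g := pointProg.sem f with hg
  have hgB : Base e g := hf.sem clamped_pointProg (by simp [avoids_pointProg])
    (by simp [avoids_pointProg]) (by simp [avoids_pointProg])
  have hgd : HasDatum g i z := hd.sem clamped_pointProg
  have hga : ∀ a j, a ≠ 3 → g (a, j) = f (a, j) := fun a j ha =>
    Prog.sem_of_avoids _ _ (by simp [avoids_pointProg, ha.symm]) _
  set r := resPt e.U (3 ^ e.p) z
  have h20 : g (3, 20) = r.1 := congrArg Prod.fst hp
  have h21 : g (3, 21) = r.2 := congrArg Prod.snd hp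
  have e1 : (store 5 (.mod (.add (lab 5) (var 20)) (modE 42))).sem g =
      Function.update g (5, i) ((f (5, i) + r.1) % M) :=
    sem_store hgB.clamp hgd.label (by
      rw [ev_mod, hgB.ev_modE, ev_add, ev_lab, ev_var, hgd.label, hga _ _ (by norm_num), h20])
      ((Nat.mod_lt _ hM0).trans hMB)
  set g' := Function.update g (5, i) ((f (5, i) + r.1) % M) with hg'
  have hg'3 : ∀ k : ℕ × ℕ, k.1 ≠ 5 → g' k = g k := fun k hk =>
    Function.update_of_ne (fun h => hk (congrArg Prod.fst h)) _ _
  have e2 : (store 6 (.mod (.add (lab 6) (var 21)) (modE 42))).sem g' =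
      Function.update g' (6, i) ((f (6, i) + r.2) % M) :=
    sem_store ((hg'3 _ (by simp)).trans hgB.clamp) ((hg'3 _ (by simp)).trans hgd.label) (by
      rw [ev_mod, modE, ev_powE, ev_add, ev_lab, ev_var, ev_var, hg'3 (1, 0) (by simp),
        hg'3 _ (by simp), hg'3 (3, 21) (by simp), hg'3 (3, 0) (by simp), hgB.P, hgd.label,
        hga _ _ (by norm_num), h21])
      ((Nat.mod_lt _ hM0).trans hMB)
  have hsem : sumStep.sem f = Function.update g' (6, i) ((f (6, i) + r.2) % M) := by
    rw [sumStep, sem_seq, sem_seq, ← hg, e1, e2]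
  rw [hsem]
  constructor
  · rw [Function.update_self, Function.update_of_ne (by simp), hg', Function.update_self,
      ← red_toG_eq_mod, ← toG_add, red_eq_red hM0, hS]
    exact (toG_red hM0 S).add (Cong.refl _ _)
  · intro a h3 h5 h6
    rw [Function.update_of_ne (by simpa using h6), hg'3 _ (by simpa using h5), hga _ _ h3]

/-- The residue of the current point relative to the centroid, in the cells `22` and `23`. -/
def vecProg : Prog :=
  .seq pointProg <|
  .seq (put 22 (.mod (.add (.mul (.cell 0 (.const 0)) (var 20)) (.sub (modE 42) (lab 5)))
    (modE 42)))
  (put 23 (.mod (.add (.mul (.cell 0 (.const 0)) (var 21)) (.sub (modE 42) (lab 6))) (modE 42)))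

theorem clamped_vecProg : vecProg.Clamped :=
  ⟨clamped_pointProg, clamped_put (by norm_num) _, clamped_put (by norm_num) _⟩

theorem avoids_vecProg (k : ℕ × ℕ) : vecProg.avoids k ↔
    (3, 10) ≠ k ∧ (3, 11) ≠ k ∧ (3, 20) ≠ k ∧ (3, 21) ≠ k ∧ (3, 22) ≠ k ∧ (3, 23) ≠ k := by
  simp only [vecProg, avoids_seq, avoids_pointProg, avoids_put]
  tauto

theorem Base.vec {e : Params} {f : State} (hf : Base e f) : Base e (vecProg.sem f) :=
  hf.sem clamped_vecProg (by simp [avoids_vecProg]) (by simp [avoids_vecProg])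
    (by simp [avoids_vecProg])

theorem vecProg_of_ne (f : State) (a j : ℕ) (ha : a ≠ 3) : vecProg.sem f (a, j) = f (a, j) :=
  Prog.sem_of_avoids _ _ (by simp [avoids_vecProg, ha.symm]) _

/-- The residue of `n` times a point minus the sum `S` of all points. -/
def vecRes (e : Params) (S : GaussianInt) (z : ℚ × ℚ) : ℕ × ℕ :=
  red ((3 ^ e.p) ^ 42) (e.n * toG (resPt e.U (3 ^ e.p) z) - S)

theorem sem_vecProg {e : Params} {f : State} (hf : Base e f) {i : ℕ} {z : ℚ × ℚ}
    (hd : HasDatum f i z) (hz : BoundedPt e.U z) {S : GaussianInt}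
    (hS : (f (5, i), f (6, i)) = red ((3 ^ e.p) ^ 42) S) :
    (vecProg.sem f (3, 22), vecProg.sem f (3, 23)) = vecRes e S z := by
  set M := (3 ^ e.p) ^ 42 with hM
  have hM0 : 0 < M := by positivity
  have hMB : M < e.B := e.pow_lt (by norm_num)
  have hp := sem_pointProg hf hd hz
  rw [vecProg, sem_seq, sem_seq]
  set g := pointProg.sem f with hg
  have hgB : Base e g := hf.sem clamped_pointProg (by simp [avoids_pointProg])
    (by simp [avoids_pointProg]) (by simp [avoids_pointProg])
  have hgd : HasDatum g i z := hd.sem clamped_pointProg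
  have hga : ∀ a j, a ≠ 3 → g (a, j) = f (a, j) := fun a j ha =>
    Prog.sem_of_avoids _ _ (by simp [avoids_pointProg, ha.symm]) _
  set r := resPt e.U (3 ^ e.p) z with hr
  have h20 : g (3, 20) = r.1 := congrArg Prod.fst hp
  have h21 : g (3, 21) = r.2 := congrArg Prod.snd hp
  rw [sem_put (v := (e.n * r.1 + (M - f (5, i))) % M) hgB.clamp (by
    rw [ev_mod, hgB.ev_modE, ev_add, ev_mul, ev_sub, hgB.ev_modE, ev_lab, ev_var, ev_cell, ev_const,
      hgB.n, hgd.label, hga 5 i (by norm_num), h20]) ((Nat.mod_lt _ hM0).trans hMB)]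
  set g' := Function.update g (3, 22) ((e.n * r.1 + (M - f (5, i))) % M) with hg'
  have hg'3 : ∀ k : ℕ × ℕ, k ≠ (3, 22) → g' k = g k := fun k hk => Function.update_of_ne hk _ _
  rw [sem_put (v := (e.n * r.2 + (M - f (6, i))) % M)
    ((hg'3 _ (by simp)).trans hgB.clamp) (by
    simp only [ev_mod, modE, ev_powE, ev_add, ev_mul, ev_sub, ev_lab, ev_var, ev_cell, ev_const]
    rw [hg'3 (1, 0) (by simp), hg'3 _ (by simp), hg'3 (3, 21) (by simp), hg'3 (3, 0) (by simp),
      hg'3 _ (by simp), hgB.P, hgB.n, hgd.label, hga 6 i (by norm_num), h21])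
    ((Nat.mod_lt _ hM0).trans hMB)]
  have hlt := red_lt hM0 S
  rw [← hS] at hlt
  rw [Function.update_self, Function.update_of_ne (by simp), hg', Function.update_self,
    ← red_sub hlt.1 hlt.2, vecRes, red_eq_red hM0, hS, ← hr]
  exact (Cong.refl _ _).sub (toG_red hM0 S)

/-- Real part of the product collected so far; an empty product is stored as `0`. -/
def prodE : Expr := .add (lab 8) (.sub (.const 1) (lab 7))

/-- The loop that divides the residue in the cells `24` and `25` by `3` as often as possible. -/
def stripLoop : Prog :=
  .loop (modE 21) <|
    .ite (eqE (.add (.mod (var 24) (.const 3)) (.mod (var 25) (.const 3))) (.const 0))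
      (.seq (put 24 (.div (var 24) (.const 3))) (put 25 (.div (var 25) (.const 3)))) .skip

/-- Multiply the product in the arrays `8` and `9` by the residue in the cells `24` and `25`. -/
def collect : Prog :=
  .seq (put 26 (reE (modE 21) prodE (lab 9) (var 24) (var 25))) <|
  .seq (put 27 (imE (modE 21) prodE (lab 9) (var 24) (var 25))) <|
  .seq (store 8 (var 26)) <| .seq (store 9 (var 27)) <|
  store 7 (.add (lab 7) (.const 1))

/-- Second pass: multiply up the parts prime to `3` of the residues, in the arrays `8` and `9`, and
count them in the array `7`. -/
def prodStep : Prog :=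
  .seq vecProg <|
  .ite (.add (.mod (var 22) (modE 21)) (.mod (var 23) (modE 21)))
    (.seq (put 24 (var 22)) <| .seq (put 25 (var 23)) <| .seq stripLoop collect)
    .skip

theorem clamped_prodStep : prodStep.Clamped :=
  ⟨clamped_vecProg, ⟨clamped_put (by norm_num) _, clamped_put (by norm_num) _,
    ⟨⟨clamped_put (by norm_num) _, clamped_put (by norm_num) _⟩, trivial⟩,
    clamped_put (by norm_num) _, clamped_put (by norm_num) _, clamped_store (by norm_num) _,
    clamped_store (by norm_num) _, clamped_store (by norm_num) _⟩, trivial⟩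

theorem sem_stripLoop {e : Params} {f : State} (hf : Base e f) (h24 : f (3, 24) < e.B)
    (h25 : f (3, 25) < e.B) :
    (stripLoop.sem f (3, 24), stripLoop.sem f (3, 25)) =
      unitPart (3 ^ e.p) (f (3, 24), f (3, 25)) ∧
    ∀ k, k ≠ (3, 24) → k ≠ (3, 25) → stripLoop.sem f k = f k := by
  constructor
  · have h := Prog.loop_rule (e := modE 21) (c := .ite (eqE (.add (.mod (var 24) (.const 3))
        (.mod (var 25) (.const 3))) (.const 0)) (.seq (put 24 (.div (var 24) (.const 3)))
        (put 25 (.div (var 25) (.const 3)))) .skip) (f := f)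
      (fun k g => (g (3, 24), g (3, 25)) = strip^[k] (f (3, 24), f (3, 25)) ∧ g (3, 24) < e.B ∧
        g (3, 25) < e.B) ⟨rfl, h24, h25⟩ (by
      rintro k g hk hfr ⟨h1, h2, h3⟩
      have g4 : g (4, 0) = e.B := (hfr _ (by simp)).trans hf.clamp
      rw [Function.iterate_succ_apply', ← h1, strip]
      by_cases hc : g (3, 24) % 3 = 0 ∧ g (3, 25) % 3 = 0
      · rw [sem_ite_pos ((ev_eqE_ne_zero _ _ _).2 (by simp [hc])), if_pos hc, sem_seq,
          sem_put (v := g (3, 24) / 3) g4 rfl ((Nat.div_le_self _ _).trans_lt h2),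
          sem_put (v := g (3, 25) / 3) (B := e.B) (by simpa using g4) (by simp)
            ((Nat.div_le_self _ _).trans_lt h3)]
        have := Nat.div_le_self (g (3, 24)) 3
        have := Nat.div_le_self (g (3, 25)) 3
        simp
        omega
      · rw [sem_ite_neg (by rw [ev_eqE_ne_zero]; simpa using hc), if_neg hc]
        exact ⟨rfl, h2, h3⟩)
    rw [hf.ev_modE] at h
    exact h.1
  · intro k hk hk'
    exact Prog.sem_of_avoids _ _ (by simpa [stripLoop] using ⟨hk.symm, hk'.symm⟩) _

theorem sem_collect {e : Params} {f : State} (hf : Base e f) {i : ℕ} (hi : f (1, 0) = i)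
    (hk : f (7, i) + 1 < e.B) {v : ℕ × ℕ}
    (hv : v = red ((3 ^ e.p) ^ 21) (toG (f (8, i) + (1 - f (7, i)), f (9, i)) *
      toG (f (3, 24), f (3, 25)))) :
    collect.sem f (7, i) = f (7, i) + 1 ∧ collect.sem f (8, i) = v.1 ∧
    collect.sem f (9, i) = v.2 ∧
    ∀ a, a ≠ 3 → a ≠ 7 → a ≠ 8 → a ≠ 9 → collect.sem f (a, i) = f (a, i) := by
  have hM0 : 0 < (3 ^ e.p) ^ 21 := by positivity
  have hMB : (3 ^ e.p) ^ 21 < e.B := e.pow_lt (by norm_num)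
  have hvlt := red_lt hM0 (toG (f (8, i) + (1 - f (7, i)), f (9, i)) * toG (f (3, 24), f (3, 25)))
  rw [← hv] at hvlt
  have hf4 := hf.clamp
  have hprod : ∀ h : State, (∀ k, k ≠ (3, 26) → h k = f k) →
      ((reE (modE 21) prodE (lab 9) (var 24) (var 25)).ev h,
        (imE (modE 21) prodE (lab 9) (var 24) (var 25)).ev h) = v := by
    intro h hh
    have hM : (modE 21).ev h = (3 ^ e.p) ^ 21 := by
      rw [modE, ev_powE, ev_var, hh _ (by simp), hf.P]
    rw [ev_reE_imE (by rw [hM]; exact hM0), hM, hv]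
    simp [prodE, hh, hi]
  rw [collect, sem_seq, sem_put (v := v.1) hf4 (congrArg Prod.fst (hprod f fun _ _ => rfl))
    (hvlt.1.trans hMB)]
  have h26 : ∀ k, k ≠ (3, 26) → Function.update f (3, 26) v.1 k = f k := fun k hk =>
    Function.update_of_ne hk _ _
  rw [sem_seq, sem_put (v := v.2) ((h26 _ (by simp)).trans hf4)
    (congrArg Prod.snd (hprod _ h26)) (hvlt.2.trans hMB),
    sem_seq, sem_store (a := 8) (v := v.1) (B := e.B) (i := i) (by simpa using hf4)
      (by simpa using hi)
      (by simp) (hvlt.1.trans hMB),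
    sem_seq, sem_store (a := 9) (v := v.2) (B := e.B) (i := i) (by simpa using hf4)
      (by simpa using hi)
      (by simp) (hvlt.2.trans hMB),
    sem_store (a := 7) (v := f (7, i) + 1) (B := e.B) (i := i) (by simpa using hf4)
      (by simpa using hi) (by simp [hi]) hk]
  refine ⟨by simp, by simp, by simp, fun a h3 h7 h8 h9 => ?_⟩
  simp [h3, h7, h8, h9]

/-- The second pass keeps count and product of the live residues up to date, where the product is
read with the convention that a count of zero makes it `1`. -/
theorem sem_prodStep {e : Params} {f : State} (hf : Base e f) {i : ℕ} {z : ℚ × ℚ}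
    (hd : HasDatum f i z) (hz : BoundedPt e.U z) {S : GaussianInt}
    (hS : (f (5, i), f (6, i)) = red ((3 ^ e.p) ^ 42) S) (hk : f (7, i) + 1 < e.B)
    {W : Multiset (ℕ × ℕ)} (h7 : f (7, i) = liveCount (3 ^ e.p) W)
    (hW : (f (8, i) + (1 - f (7, i)), f (9, i)) =
      red ((3 ^ e.p) ^ 21) (unitProd (3 ^ e.p) W)) :
    prodStep.sem f (7, i) = liveCount (3 ^ e.p) (vecRes e S z ::ₘ W) ∧
    (prodStep.sem f (8, i) + (1 - prodStep.sem f (7, i)), prodStep.sem f (9, i)) =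
      red ((3 ^ e.p) ^ 21) (unitProd (3 ^ e.p) (vecRes e S z ::ₘ W)) ∧
    ∀ a, a ≠ 3 → a ≠ 7 → a ≠ 8 → a ≠ 9 → prodStep.sem f (a, i) = f (a, i) := by
  set M := (3 ^ e.p) ^ 21 with hM
  have hM0 : 0 < M := by positivity
  have hMB : M < e.B := e.pow_lt (by norm_num)
  have hw := sem_vecProg hf hd hz hS
  have hwlt : (vecRes e S z).1 < e.B ∧ (vecRes e S z).2 < e.B := by
    have := red_lt (M := (3 ^ e.p) ^ 42) (by positivity)
      (e.n * toG (resPt e.U (3 ^ e.p) z) - S)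
    have := e.pow_lt (k := 42) (by norm_num)
    unfold vecRes
    omega
  rw [prodStep, sem_seq]
  have hgB := hf.vec
  have hgd : HasDatum (vecProg.sem f) i z := hd.sem clamped_vecProg
  have hga := vecProg_of_ne f
  set g := vecProg.sem f with hg
  set w := vecRes e S z with hwdef
  have h22 : g (3, 22) = w.1 := congrArg Prod.fst hw
  have h23 : g (3, 23) = w.2 := congrArg Prod.snd hw
  by_cases hl : Live (3 ^ e.p) w
  · rw [sem_ite_pos (by
      rw [ev_add, ev_mod, ev_mod, hgB.ev_modE, ev_var, ev_var, h22, h23]; exact hl)]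
    rw [sem_seq, sem_put (v := w.1) hgB.clamp (by rw [ev_var]; exact h22) hwlt.1, sem_seq,
      sem_put (v := w.2) (B := e.B) (by simpa using hgB.clamp) (by simpa using h23) hwlt.2,
      sem_seq]
    set g₁ := Function.update (Function.update g (3, 24) w.1) (3, 25) w.2 with hg₁
    have hg₁' : ∀ k, k ≠ (3, 24) → k ≠ (3, 25) → g₁ k = g k := fun k h h' => by
      rw [hg₁, Function.update_of_ne h', Function.update_of_ne h]
    have hw₁ : g₁ (3, 24) = w.1 ∧ g₁ (3, 25) = w.2 := by simp [hg₁]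
    clear_value g₁
    have hB₁ : Base e g₁ := ⟨by rw [hg₁' _ (by simp) (by simp), hgB.n],
      by rw [hg₁' _ (by simp) (by simp), hgB.clamp], by rw [hg₁' _ (by simp) (by simp), hgB.P],
      by rw [hg₁' _ (by simp) (by simp), hgB.Q], by rw [hg₁' _ (by simp) (by simp), hgB.x]⟩
    obtain ⟨hu, hfr⟩ := sem_stripLoop hB₁ (by rw [hw₁.1]; exact hwlt.1)
      (by rw [hw₁.2]; exact hwlt.2)
    rw [hw₁.1, hw₁.2] at hu
    set g₂ := stripLoop.sem g₁
    clear_value g₂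
    have hg₂ : ∀ k, k ≠ (3, 24) → k ≠ (3, 25) → g₂ k = g k := fun k h h' => by
      rw [hfr k h h', hg₁' k h h']
    have hB₂ : Base e g₂ := ⟨by rw [hg₂ _ (by simp) (by simp), hgB.n],
      by rw [hg₂ _ (by simp) (by simp), hgB.clamp], by rw [hg₂ _ (by simp) (by simp), hgB.P],
      by rw [hg₂ _ (by simp) (by simp), hgB.Q], by rw [hg₂ _ (by simp) (by simp), hgB.x]⟩
    have hlab : g₂ (1, 0) = i := by rw [hg₂ _ (by simp) (by simp), hgd.label]
    have harr : ∀ a, a ≠ 3 → g₂ (a, i) = f (a, i) := fun a ha => by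
      rw [hg₂ _ (by simp [ha]) (by simp [ha]), hga _ _ ha]
    have h7' := harr 7 (by norm_num)
    have h8' := harr 8 (by norm_num)
    have h9' := harr 9 (by norm_num)
    obtain ⟨c7, c8, c9, cr⟩ := sem_collect hB₂ hlab (by rw [h7']; exact hk)
      (v := red M (unitProd (3 ^ e.p) (w ::ₘ W))) (by
        rw [h7', h8', h9', hu, hW, ← hM, red_eq_red hM0]
        simp only [unitProd, Multiset.filter_cons_of_pos _ hl, Multiset.map_cons,
          Multiset.prod_cons]
        rw [mul_comm]
        exact (toG_red hM0 _).symm.mul_right _)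
    refine ⟨?_, ?_, ?_⟩
    · rw [c7, h7', liveCount, Multiset.filter_cons_of_pos _ hl, Multiset.card_cons, h7, liveCount]
    · rw [c7, c8, c9, Nat.sub_eq_zero_of_le (by omega), add_zero]
    · intro a h3 h7 h8 h9
      rw [cr a h3 h7 h8 h9, harr a h3]
  · rw [sem_ite_neg (by
      rw [ev_add, ev_mod, ev_mod, hgB.ev_modE, ev_var, ev_var, h22, h23]; exact hl), Prog.sem]
    rw [hga _ _ (by norm_num), hga _ _ (by norm_num), hga _ _ (by norm_num)]
    simp only [liveCount, unitProd, Multiset.filter_cons_of_neg _ hl]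
    exact ⟨h7, hW, fun a h3 _ _ _ => hga _ _ h3⟩

/-! ### The third pass -/

/-- Multiply the residue in the cells `35` and `36` by the one in the cells `33` and `34`. -/
def mulProg : Prog :=
  .seq (put 37 (reE (modE 21) (var 35) (var 36) (var 33) (var 34))) <|
  .seq (put 38 (imE (modE 21) (var 35) (var 36) (var 33) (var 34))) <|
  .seq (put 35 (var 37)) (put 36 (var 38))

theorem clamped_mulProg : mulProg.Clamped :=
  ⟨clamped_put (by norm_num) _, clamped_put (by norm_num) _, clamped_put (by norm_num) _,
    clamped_put (by norm_num) _⟩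

theorem avoids_mulProg (k : ℕ × ℕ) : mulProg.avoids k ↔
    (3, 37) ≠ k ∧ (3, 38) ≠ k ∧ (3, 35) ≠ k ∧ (3, 36) ≠ k := Iff.rfl

theorem sem_mulProg {e : Params} {f : State} (hf : Base e f) :
    (mulProg.sem f (3, 35), mulProg.sem f (3, 36)) =
      red ((3 ^ e.p) ^ 21) (toG (f (3, 35), f (3, 36)) * toG (f (3, 33), f (3, 34))) := by
  set v := red ((3 ^ e.p) ^ 21) (toG (f (3, 35), f (3, 36)) * toG (f (3, 33), f (3, 34))) with hv
  have hM0 : 0 < (3 ^ e.p) ^ 21 := by positivity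
  have hMB : (3 ^ e.p) ^ 21 < e.B := e.pow_lt (by norm_num)
  have hvlt := red_lt hM0 (toG (f (3, 35), f (3, 36)) * toG (f (3, 33), f (3, 34)))
  rw [← hv] at hvlt
  have hf4 := hf.clamp
  have hprod : ∀ h : State, (∀ k, k ≠ (3, 37) → h k = f k) →
      ((reE (modE 21) (var 35) (var 36) (var 33) (var 34)).ev h,
        (imE (modE 21) (var 35) (var 36) (var 33) (var 34)).ev h) = v := by
    intro h hh
    have hM : (modE 21).ev h = (3 ^ e.p) ^ 21 := by
      rw [modE, ev_powE, ev_var, hh _ (by simp), hf.P]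
    rw [ev_reE_imE (by rw [hM]; exact hM0), hM, hv]
    simp [hh]
  have h37 : ∀ k, k ≠ (3, 37) → Function.update f (3, 37) v.1 k = f k := fun k hk =>
    Function.update_of_ne hk _ _
  rw [mulProg, sem_seq, sem_put (c := 37) (v := v.1) hf4
      (congrArg Prod.fst (hprod f fun _ _ => rfl)) (hvlt.1.trans hMB),
    sem_seq, sem_put (c := 38) (v := v.2) ((h37 _ (by simp)).trans hf4)
      (congrArg Prod.snd (hprod _ h37)) (hvlt.2.trans hMB),
    sem_seq, sem_put (c := 35) (v := v.1) (B := e.B) (by simpa using hf4)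
      (by simp) (hvlt.1.trans hMB),
    sem_put (c := 36) (v := v.2) (B := e.B) (by simpa using hf4)
      (by simp) (hvlt.2.trans hMB)]
  simp

/-- Multiply the residue in the cells `35` and `36` by the power of the one in the cells `33` and
`34` whose exponent stands in the array `7`. -/
def powProg : Prog := .loop (lab 7) mulProg

theorem sem_powProg {e : Params} {f : State} (hf : Base e f) {d : GaussianInt}
    (hd : (f (3, 35), f (3, 36)) = red ((3 ^ e.p) ^ 21) d) :
    (powProg.sem f (3, 35), powProg.sem f (3, 36)) =
      red ((3 ^ e.p) ^ 21) (toG (f (3, 33), f (3, 34)) ^ f (7, f (1, 0)) * d) := by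
  have hM0 : 0 < (3 ^ e.p) ^ 21 := by positivity
  refine Prog.loop_rule (e := lab 7) (c := mulProg) (f := f) (fun k g => (g (3, 35), g (3, 36)) =
    red ((3 ^ e.p) ^ 21) (toG (f (3, 33), f (3, 34)) ^ k * d)) (by simpa using hd) ?_
  intro k g _ hg hI
  have hgf : ∀ j, mulProg.avoids j → g j = f j := hg
  simp only [avoids_mulProg] at hgf
  have hB : Base e g := ⟨by rw [hgf _ (by simp), hf.n], by rw [hgf _ (by simp), hf.clamp],
    by rw [hgf _ (by simp), hf.P], by rw [hgf _ (by simp), hf.Q], by rw [hgf _ (by simp), hf.x]⟩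
  rw [sem_mulProg hB, hI, red_eq_red hM0, hgf (3, 33) (by simp), hgf (3, 34) (by simp),
    show ∀ y : GaussianInt, y ^ (k + 1) * d = y ^ k * d * y from fun y => by ring]
  exact (toG_red hM0 _).mul_right _

/-- For the position in the cell `30`: the residue `s` at this position, in the cells `33` and `34`,
and `s ^ k * d`, in the cells `35` and `36`. -/
def scoreProg : Prog :=
  .seq (put 33 (.mod (var 30) (modE 21))) <| .seq (put 34 (.div (var 30) (modE 21))) <|
  .seq (put 35 prodE) <| .seq (put 36 (lab 9)) powProg

theorem clamped_scoreProg : scoreProg.Clamped :=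
  ⟨clamped_put (by norm_num) _, clamped_put (by norm_num) _, clamped_put (by norm_num) _,
    clamped_put (by norm_num) _, clamped_mulProg⟩

theorem avoids_scoreProg (k : ℕ × ℕ) : scoreProg.avoids k ↔
    (3, 33) ≠ k ∧ (3, 34) ≠ k ∧ (3, 35) ≠ k ∧ (3, 36) ≠ k ∧ (3, 37) ≠ k ∧ (3, 38) ≠ k := by
  simp only [scoreProg, powProg, avoids_seq, avoids_loop, avoids_put, avoids_mulProg]
  tauto

theorem sem_scoreProg {e : Params} {f : State} (hf : Base e f) {i : ℕ} (hi : f (1, 0) = i) {c : ℕ}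
    (hc : f (3, 30) = c) (hcM : c < (3 ^ e.p) ^ 42) {d : GaussianInt}
    (hd : (f (8, i) + (1 - f (7, i)), f (9, i)) = red ((3 ^ e.p) ^ 21) d) :
    (scoreProg.sem f (3, 33), scoreProg.sem f (3, 34)) = uncode ((3 ^ e.p) ^ 21) c ∧
    (scoreProg.sem f (3, 35), scoreProg.sem f (3, 36)) =
      red ((3 ^ e.p) ^ 21) (toG (uncode ((3 ^ e.p) ^ 21) c) ^ f (7, i) * d) := by
  set M := (3 ^ e.p) ^ 21 with hM
  have hM0 : 0 < M := by positivity
  have hMB : M < e.B := e.pow_lt (by norm_num)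
  have hf4 := hf.clamp
  have hP := hf.P
  have hcB : c / M < e.B := (Nat.div_le_self _ _).trans_lt
    (hcM.trans (e.pow_lt (by norm_num)))
  have hdlt := red_lt hM0 d
  rw [← hd] at hdlt
  rw [scoreProg, sem_seq, sem_put (c := 33) (v := c % M) hf4 (by
      rw [ev_mod, hf.ev_modE, ev_var, hc]) ((Nat.mod_lt _ hM0).trans hMB),
    sem_seq, sem_put (c := 34) (v := c / M) (B := e.B) (by simpa using hf4)
      (by simp [modE, hP, hc, hM]) hcB,
    sem_seq, sem_put (c := 35) (v := f (8, i) + (1 - f (7, i))) (B := e.B) (by simpa using hf4)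
      (by simp [prodE, hi]) (hdlt.1.trans hMB),
    sem_seq, sem_put (c := 36) (v := f (9, i)) (B := e.B) (by simpa using hf4)
      (by simp [hi]) (hdlt.2.trans hMB)]
  set g := Function.update (Function.update (Function.update (Function.update f (3, 33) (c % M))
    (3, 34) (c / M)) (3, 35) (f (8, i) + (1 - f (7, i)))) (3, 36) (f (9, i)) with hg
  have hgB : Base e g := ⟨by simp [hg, hf.n], by simp [hg, hf4], by simp [hg, hP],
    by simp [hg, hf.Q], by simp [hg, hf.x]⟩
  have h33 : (g (3, 33), g (3, 34)) = uncode M c := by simp [hg, uncode]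
  have h35 : (g (3, 35), g (3, 36)) = red M d := by simp [hg, ← hd]
  have h7 : g (7, g (1, 0)) = f (7, i) := by simp [hg, hi]
  clear_value g
  have hpow := sem_powProg hgB h35
  rw [h33, h7] at hpow
  refine ⟨?_, hpow⟩
  rw [Prog.sem_of_avoids _ _ (by simp [powProg, avoids_mulProg]),
    Prog.sem_of_avoids _ _ (by simp [powProg, avoids_mulProg]), h33]

/-- One round of the search for the normalizer. -/
def searchBody : Prog :=
  .seq scoreProg <|
  .seq (.ite (eqE (.mod (.add (.mul (var 33) (var 33)) (.mul (var 34) (var 34))) (modE 21))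
      (.const 1))
    (.ite (.sub (var 31) (.add (var 35) (.mul (modE 21) (var 36))))
      (.seq (put 31 (.add (var 35) (.mul (modE 21) (var 36)))) (put 32 (var 30))) .skip) .skip) <|
  put 30 (.add (var 30) (.const 1))

theorem clamped_searchBody : searchBody.Clamped :=
  ⟨clamped_scoreProg, ⟨⟨⟨clamped_put (by norm_num) _, clamped_put (by norm_num) _⟩, trivial⟩,
    trivial⟩, clamped_put (by norm_num) _⟩

theorem avoids_searchBody (k : ℕ × ℕ) : searchBody.avoids k ↔
    (3, 30) ≠ k ∧ (3, 31) ≠ k ∧ (3, 32) ≠ k ∧ (3, 33) ≠ k ∧ (3, 34) ≠ k ∧ (3, 35) ≠ k ∧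
      (3, 36) ≠ k ∧ (3, 37) ≠ k ∧ (3, 38) ≠ k := by
  simp only [searchBody, avoids_seq, avoids_ite, avoids_put, avoids_skip, avoids_scoreProg]
  tauto

theorem sem_searchBody {e : Params} {f : State} (hf : Base e f) {i : ℕ} (hi : f (1, 0) = i) {c : ℕ}
    (hc : f (3, 30) = c) (hcM : c < (3 ^ e.p) ^ 42) {d : ℕ × ℕ}
    (hd : (f (8, i) + (1 - f (7, i)), f (9, i)) = d) (hdlt : d.1 < (3 ^ e.p) ^ 21)
    (hdlt' : d.2 < (3 ^ e.p) ^ 21)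
    (hs : (f (3, 31), f (3, 32)) = search ((3 ^ e.p) ^ 21) (f (7, i)) d c) :
    searchBody.sem f (3, 30) = c + 1 ∧ (searchBody.sem f (3, 31), searchBody.sem f (3, 32)) =
      search ((3 ^ e.p) ^ 21) (f (7, i)) d (c + 1) := by
  set M := (3 ^ e.p) ^ 21 with hM
  set k := f (7, i)
  have hM0 : 0 < M := by positivity
  have hM2 : M ^ 2 = (3 ^ e.p) ^ 42 := by rw [hM, ← pow_mul]
  have hMB : M ^ 2 + 1 < e.B := by
    have h1 : (3 ^ e.p) ^ 43 = (3 ^ e.p) ^ 42 * 3 ^ e.p := pow_succ _ _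
    have h2 : 3 ^ 1 ≤ 3 ^ e.p := Nat.pow_le_pow_right (by norm_num) e.hp
    have h3 := e.hPB
    have h4 : 0 < (3 ^ e.p) ^ 42 := by positivity
    rw [hM2]
    nlinarith
  rw [← hM2] at hcM
  obtain ⟨hu, hsc⟩ := sem_scoreProg hf hi hc (by rwa [← hM2]) (d := toG d)
    (by rw [hd, red_toG hdlt hdlt'])
  rw [searchBody, sem_seq, sem_seq]
  have hgB : Base e (scoreProg.sem f) := hf.sem clamped_scoreProg (by simp [avoids_scoreProg])
    (by simp [avoids_scoreProg]) (by simp [avoids_scoreProg])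
  have hg : ∀ j, scoreProg.avoids j → scoreProg.sem f j = f j := fun j hj =>
    Prog.sem_of_avoids _ _ hj _
  simp only [avoids_scoreProg] at hg
  set g := scoreProg.sem f
  clear_value g
  have g30 : g (3, 30) = c := by rw [hg _ (by simp), hc]
  have g31 : g (3, 31) = (search M k d c).1 := by rw [hg _ (by simp), ← hs]
  have g32 : g (3, 32) = (search M k d c).2 := by rw [hg _ (by simp), ← hs]
  have g4 := hgB.clamp
  have hscore : g (3, 35) + M * g (3, 36) = score M k d c := by
    change code M (g (3, 35), g (3, 36)) = _
    rw [hsc, score]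
  have hcond : (eqE (.mod (.add (.mul (var 33) (var 33)) (.mul (var 34) (var 34))) (modE 21))
      (.const 1)).ev g ≠ 0 ↔ NormOne M (uncode M c) := by
    rw [ev_eqE_ne_zero, ev_mod, hgB.ev_modE, ← hu]
    rfl
  have hlt := score_lt hM0 k d c
  rw [search]
  by_cases h1 : NormOne M (uncode M c)
  · rw [sem_ite_pos (hcond.2 h1)]
    have hev : (Expr.sub (var 31) (.add (var 35) (.mul (modE 21) (var 36)))).ev g =
        (search M k d c).1 - score M k d c := by
      rw [ev_sub, ev_add, ev_mul, hgB.ev_modE, ev_var, ev_var, ev_var, hscore, g31]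
    by_cases h2 : score M k d c < (search M k d c).1
    · rw [sem_ite_pos (by rw [hev]; omega), if_pos ⟨h1, h2⟩, sem_seq,
        sem_put (c := 31) (v := score M k d c) g4 (by
          rw [ev_add, ev_mul, hgB.ev_modE, ev_var, ev_var, hscore]) (by omega),
        sem_put (c := 32) (v := c) (B := e.B) (by simpa using g4) (by simpa using g30) (by omega),
        sem_put (c := 30) (v := c + 1) (B := e.B) (by simpa using g4) (by simpa using g30)
          (by omega)]
      simp
    · rw [sem_ite_neg (by rw [hev]; omega), if_neg (by tauto), Prog.sem,
        sem_put (c := 30) (v := c + 1) (B := e.B) g4 (by simpa using g30) (by omega)]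
      simp [g31, g32]
  · rw [sem_ite_neg (by rwa [hcond]), if_neg (by tauto), Prog.sem,
      sem_put (c := 30) (v := c + 1) (B := e.B) g4 (by simpa using g30) (by omega)]
    simp [g31, g32]

/-- The normalizer of the product in the arrays `8` and `9`, in the cells `33` and `34`. -/
def normProg : Prog :=
  .seq (put 30 (.const 0)) <| .seq (put 31 (modE 42)) <| .seq (put 32 (.const 1)) <|
  .seq (.loop (modE 42) searchBody) <|
  .seq (put 33 (.mod (var 32) (modE 21))) (put 34 (.div (var 32) (modE 21)))

theorem clamped_normProg : normProg.Clamped :=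
  ⟨clamped_put (by norm_num) _, clamped_put (by norm_num) _, clamped_put (by norm_num) _,
    clamped_searchBody, clamped_put (by norm_num) _, clamped_put (by norm_num) _⟩

theorem avoids_normProg (k : ℕ × ℕ) : normProg.avoids k ↔
    (3, 30) ≠ k ∧ (3, 31) ≠ k ∧ (3, 32) ≠ k ∧ (3, 33) ≠ k ∧ (3, 34) ≠ k ∧ (3, 35) ≠ k ∧
      (3, 36) ≠ k ∧ (3, 37) ≠ k ∧ (3, 38) ≠ k := by
  simp only [normProg, avoids_seq, avoids_loop, avoids_put, avoids_searchBody]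
  tauto

theorem sem_normProg {e : Params} {f : State} (hf : Base e f) {i : ℕ} (hi : f (1, 0) = i)
    {d : ℕ × ℕ} (hd : (f (8, i) + (1 - f (7, i)), f (9, i)) = d) (hdlt : d.1 < (3 ^ e.p) ^ 21)
    (hdlt' : d.2 < (3 ^ e.p) ^ 21) :
    (normProg.sem f (3, 33), normProg.sem f (3, 34)) =
      normalizer ((3 ^ e.p) ^ 21) (f (7, i)) d := by
  set M := (3 ^ e.p) ^ 21 with hM
  have hM0 : 0 < M := by positivity
  have hM2 : M ^ 2 = (3 ^ e.p) ^ 42 := by rw [hM, ← pow_mul]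
  have hMB : (3 ^ e.p) ^ 42 < e.B := e.pow_lt (by norm_num)
  have hMB' : M < e.B := e.pow_lt (by norm_num)
  have hf4 := hf.clamp
  have hB1 : 1 < e.B := by
    have : 0 < (3 ^ e.p) ^ 42 := by positivity
    omega
  rw [normProg, sem_seq, sem_put (c := 30) (v := 0) hf4 rfl (by omega), sem_seq,
    sem_put (c := 31) (v := M ^ 2) (B := e.B) (by simpa using hf4)
      (by simp [modE, hf.P, hM2]) (by omega), sem_seq,
    sem_put (c := 32) (v := 1) (B := e.B) (by simpa using hf4) rfl hB1, sem_seq]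
  set g := Function.update (Function.update (Function.update f (3, 30) 0) (3, 31) (M ^ 2))
    (3, 32) 1 with hg
  have hgf : ∀ j, j ≠ (3, 30) → j ≠ (3, 31) → j ≠ (3, 32) → g j = f j := fun j h0 h1 h2 => by
    rw [hg, Function.update_of_ne h2, Function.update_of_ne h1, Function.update_of_ne h0]
  have hg0 : g (3, 30) = 0 := by simp [hg]
  have hg1 : (g (3, 31), g (3, 32)) = search M (f (7, i)) d 0 := by simp [hg, search]
  clear_value g
  have hev : (modE 42).ev g = M ^ 2 := by
    rw [modE, ev_powE, ev_var, hgf _ (by simp) (by simp) (by simp), hf.P, hM2]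
  have hframe : ∀ h : State, (∀ j, searchBody.avoids j → h j = g j) →
      Base e h ∧ ∀ a, a ≠ 3 → ∀ j, h (a, j) = f (a, j) := by
    intro h hh
    have hhf : ∀ j, searchBody.avoids j → h j = f j := fun j hj => by
      rw [hh j hj]
      rw [avoids_searchBody] at hj
      exact hgf j hj.1.symm hj.2.1.symm hj.2.2.1.symm
    simp only [avoids_searchBody] at hhf
    exact ⟨⟨by rw [hhf _ (by simp), hf.n], by rw [hhf _ (by simp), hf.clamp],
      by rw [hhf _ (by simp), hf.P], by rw [hhf _ (by simp), hf.Q],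
      by rw [hhf _ (by simp), hf.x]⟩, fun a ha j => hhf _ (by simp [ha.symm])⟩
  have hloop := Prog.loop_rule (e := modE 42) (c := searchBody) (f := g) (fun c h =>
    h (3, 30) = c ∧ (h (3, 31), h (3, 32)) = search M (f (7, i)) d c) ⟨hg0, hg1⟩ (by
      rintro c h hc hh ⟨I1, I2⟩
      obtain ⟨hB, hfr⟩ := hframe h hh
      rw [hev, hM2] at hc
      have := sem_searchBody hB (i := i) (by rw [hfr 1 (by norm_num), hi]) I1 hc (d := d)
        (by rw [hfr 8 (by norm_num), hfr 7 (by norm_num), hfr 9 (by norm_num), hd]) hdlt hdlt'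
        (by rw [I2, hfr 7 (by norm_num)])
      rwa [hfr 7 (by norm_num)] at this)
  rw [hev] at hloop
  have hB' := (hframe _ fun j hj =>
    Prog.sem_of_avoids (.loop (modE 42) searchBody) j (by exact hj) g).1
  set h := (Prog.loop (modE 42) searchBody).sem g
  clear_value h
  have h32 : h (3, 32) = (search M (f (7, i)) d (M ^ 2)).2 := congrArg Prod.snd hloop.2
  have hlt := (search_spec (M := M) (Nat.one_lt_pow (by norm_num)
    (Nat.one_lt_pow (by have := e.hp; omega) (by norm_num))) (f (7, i)) d _ le_rfl).2.2.1
  have h4 := hB'.clamp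
  have hP := hB'.P
  rw [sem_seq, sem_put (c := 33) (v := (search M (f (7, i)) d (M ^ 2)).2 % M) h4 (by
      rw [ev_mod, hB'.ev_modE, ev_var, h32]) ((Nat.mod_lt _ hM0).trans hMB'),
    sem_put (c := 34) (v := (search M (f (7, i)) d (M ^ 2)).2 / M) (B := e.B) (by simpa using h4)
      (by simp [modE, hP, h32, hM]) ((Nat.div_le_self _ _).trans_lt (by omega))]
  simp [normalizer, uncode]

/-- A quarter turn of the residue in the cells `40` and `41`. -/
def rotProg : Prog :=
  .seq (put 42 (.mod (.sub (modE 20) (var 41)) (modE 20))) <|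
  .seq (put 41 (var 40)) (put 40 (var 42))

theorem clamped_rotProg : rotProg.Clamped :=
  ⟨clamped_put (by norm_num) _, clamped_put (by norm_num) _, clamped_put (by norm_num) _⟩

theorem sem_rotProg {e : Params} {f : State} (hf : Base e f) {y : GaussianInt}
    (hy : (f (3, 40), f (3, 41)) = red ((3 ^ e.p) ^ 20) y) :
    (rotProg.sem f (3, 40), rotProg.sem f (3, 41)) = red ((3 ^ e.p) ^ 20) (iunit * y) := by
  set M := (3 ^ e.p) ^ 20 with hM
  have hM0 : 0 < M := by positivity
  have hMB : M < e.B := e.pow_lt (by norm_num)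
  have hlt := red_lt hM0 y
  rw [← hy] at hlt
  have hf4 := hf.clamp
  rw [rotProg, sem_seq, sem_put (c := 42) (v := (M - f (3, 41)) % M) hf4 (by
      rw [ev_mod, ev_sub, hf.ev_modE, ev_var]) ((Nat.mod_lt _ hM0).trans hMB),
    sem_seq, sem_put (c := 41) (v := f (3, 40)) (B := e.B) (by simpa using hf4) (by simp)
      (hlt.1.trans hMB),
    sem_put (c := 40) (v := (M - f (3, 41)) % M) (B := e.B) (by simpa using hf4) (by simp)
      ((Nat.mod_lt _ hM0).trans hMB)]
  have hmod : f (3, 40) = f (3, 40) % M := (Nat.mod_eq_of_lt hlt.1).symm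
  rw [Function.update_self, Function.update_of_ne (by simp), Function.update_self, hmod,
    ← red_toG_eq_mod, red_eq_red hM0]
  refine Cong.trans ?_ ((hy ▸ toG_red hM0 y : Cong M (toG (f (3, 40), f (3, 41))) y).mul_left iunit)
  rw [Cong, natCast_dvd_iff]
  simp only [toG, iunit, Zsqrtd.re_sub, Zsqrtd.im_sub, Zsqrtd.re_mul, Zsqrtd.im_mul]
  push_cast [hlt.2.le]
  exact ⟨⟨1, by ring⟩, ⟨0, by ring⟩⟩

/-- Multiply the fingerprint in the array `10 + t` by the contribution of the residue in the cells
`40` and `41`; the fingerprint of the empty multiset is stored as `0`, and the array `14` marks the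
labels that have occurred. -/
def accumProg (t : ℕ) : Prog :=
  store (10 + t) (.mod (.mul (.add (lab (10 + t)) (.sub (.const 1) (lab 14)))
    (.add (var 2) (.add (var 40) (.mul (modE 20) (var 41))))) (var 1))

theorem clamped_accumProg {t : ℕ} (ht : t < 4) : (accumProg t).Clamped :=
  clamped_store (by omega) _

/-- A multiset of residues after multiplication by `s` and `t` quarter turns. -/
def turned (e : Params) (s : GaussianInt) (t : ℕ) (W : Multiset (ℕ × ℕ)) : Multiset (ℕ × ℕ) :=
  W.map fun w => red ((3 ^ e.p) ^ 20) (iunit ^ t * s * toG w)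

theorem sem_accumProg {e : Params} {f : State} (hf : Base e f) {i t : ℕ} (hi : f (1, 0) = i)
    {s : GaussianInt} {w : ℕ × ℕ} {W : Multiset (ℕ × ℕ)}
    (hv : (f (3, 40), f (3, 41)) = red ((3 ^ e.p) ^ 20) (iunit ^ t * s * toG w))
    (ht : f (10 + t, i) + (1 - f (14, i)) =
      fingerprint e.Q ((3 ^ e.p) ^ 20) e.x (turned e s t W)) :
    (accumProg t).sem f = Function.update f (10 + t, i)
      (fingerprint e.Q ((3 ^ e.p) ^ 20) e.x (turned e s t (w ::ₘ W))) := by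
  refine sem_store hf.clamp hi ?_ ((Nat.mod_lt _ e.hQ.pos).trans e.hQB)
  rw [ev_mod, ev_mul, ev_add, ev_sub, ev_add, ev_add, ev_mul, hf.ev_modE, ev_lab, ev_lab, ev_var,
    ev_var, ev_var, ev_var, ev_const, hi, ht, hf.x, hf.Q]
  change _ * (e.x + code _ (f (3, 40), f (3, 41))) % _ = _
  rw [hv, fingerprint, fingerprint, turned, turned, Multiset.map_cons, Multiset.map_cons,
    Multiset.prod_cons, Nat.mod_mul_mod, mul_comm]

/-- Update one of the four fingerprints and make a quarter turn. -/
def turnProg (t : ℕ) : Prog := .seq (accumProg t) rotProg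

theorem clamped_turnProg {t : ℕ} (ht : t < 4) : (turnProg t).Clamped :=
  ⟨clamped_accumProg ht, clamped_rotProg⟩

theorem sem_turnProg {e : Params} {f : State} (hf : Base e f) {i t : ℕ} (ht4 : t < 4)
    (hi : f (1, 0) = i) {s : GaussianInt} {w : ℕ × ℕ} {W : Multiset (ℕ × ℕ)}
    (hv : (f (3, 40), f (3, 41)) = red ((3 ^ e.p) ^ 20) (iunit ^ t * s * toG w))
    (ht : f (10 + t, i) + (1 - f (14, i)) =
      fingerprint e.Q ((3 ^ e.p) ^ 20) e.x (turned e s t W)) :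
    Base e ((turnProg t).sem f) ∧ (turnProg t).sem f (1, 0) = i ∧
    ((turnProg t).sem f (3, 40), (turnProg t).sem f (3, 41)) =
      red ((3 ^ e.p) ^ 20) (iunit ^ (t + 1) * s * toG w) ∧
    (turnProg t).sem f (10 + t, i) =
      fingerprint e.Q ((3 ^ e.p) ^ 20) e.x (turned e s t (w ::ₘ W)) ∧
    ∀ a, a ≠ 3 → a ≠ 10 + t → (turnProg t).sem f (a, i) = f (a, i) := by
  have hB : Base e ((accumProg t).sem f) := hf.sem (clamped_accumProg ht4)
    (by simp [accumProg]; omega) (by simp [accumProg]; omega) (by simp [accumProg]; omega)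
  have hsem := sem_accumProg hf hi hv ht
  have h3 : ∀ a j, a ≠ 3 → (turnProg t).sem f (a, j) = (accumProg t).sem f (a, j) := fun a j ha =>
    Prog.sem_of_avoids rotProg _ (by simp [rotProg, ha.symm]) _
  refine ⟨hB.sem clamped_rotProg (by simp [rotProg]) (by simp [rotProg]) (by simp [rotProg]),
    ?_, ?_, ?_, ?_⟩
  · rw [(turnProg t).sem_fixed (clamped_turnProg ht4) _ _ _ (by simp), hi]
  · rw [show iunit ^ (t + 1) * s * toG w = iunit * (iunit ^ t * s * toG w) by ring]
    refine sem_rotProg hB ?_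
    rw [hsem, Function.update_of_ne (by simp; omega), Function.update_of_ne (by simp; omega), hv]
  · rw [h3 _ _ (by omega), hsem, Function.update_self]
  · intro a ha hat
    rw [h3 _ _ ha, hsem, Function.update_of_ne (by simpa using hat)]

/-- Minimum of two expressions. -/
def minE (a b : Expr) : Expr := .sub a (.sub a b)

theorem ev_minE (f : State) (a b : Expr) : (minE a b).ev f = min (a.ev f) (b.ev f) := by
  simp only [minE, ev_sub]
  omega

/-- Third pass: accumulate the fingerprints of the turned residues in the arrays `10` to `13`; their
minimum goes to array `2`. -/
def hashStep : Prog :=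
  .seq vecProg <| .seq normProg <|
  .seq (put 40 (reE (modE 20) (var 33) (var 34) (var 22) (var 23))) <|
  .seq (put 41 (imE (modE 20) (var 33) (var 34) (var 22) (var 23))) <|
  .seq (turnProg 0) <| .seq (turnProg 1) <| .seq (turnProg 2) <| .seq (turnProg 3) <|
  .seq (store 14 (.const 1))
  (store 2 (minE (minE (minE (lab 10) (lab 11)) (lab 12)) (lab 13)))

theorem clamped_hashStep : hashStep.Clamped :=
  ⟨clamped_vecProg, clamped_normProg, clamped_put (by norm_num) _, clamped_put (by norm_num) _,
    clamped_turnProg (by norm_num), clamped_turnProg (by norm_num), clamped_turnProg (by norm_num),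
    clamped_turnProg (by norm_num), clamped_store (by norm_num) _, clamped_store (by norm_num) _⟩

/-- One datum of the third pass multiplies each of the four fingerprints by the factor of its
vector. The array `14` distinguishes a fingerprint that is still empty, to be read as `1`, from one
with the value `0`. -/
theorem sem_hashStep {e : Params} {f : State} (hf : Base e f) {i : ℕ} {z : ℚ × ℚ}
    (hd : HasDatum f i z) (hz : BoundedPt e.U z) {S : GaussianInt}
    (hS : (f (5, i), f (6, i)) = red ((3 ^ e.p) ^ 42) S) {d : ℕ × ℕ}
    (h8 : (f (8, i) + (1 - f (7, i)), f (9, i)) = d) (hdlt : d.1 < (3 ^ e.p) ^ 21)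
    (hdlt' : d.2 < (3 ^ e.p) ^ 21) {s : GaussianInt}
    (hs : s = toG (normalizer ((3 ^ e.p) ^ 21) (f (7, i)) d)) {W : Multiset (ℕ × ℕ)}
    (hF : ∀ t < 4, f (10 + t, i) + (1 - f (14, i)) =
      fingerprint e.Q ((3 ^ e.p) ^ 20) e.x (turned e s t W)) :
    hashStep.sem f (14, i) = 1 ∧
    (∀ t < 4, hashStep.sem f (10 + t, i) =
      fingerprint e.Q ((3 ^ e.p) ^ 20) e.x (turned e s t (vecRes e S z ::ₘ W))) ∧
    hashStep.sem f (2, i) = min (min (min (hashStep.sem f (10, i)) (hashStep.sem f (11, i)))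
      (hashStep.sem f (12, i))) (hashStep.sem f (13, i)) ∧
    ∀ a, a ≠ 3 → a ≠ 2 → ¬ (10 ≤ a ∧ a ≤ 14) → hashStep.sem f (a, i) = f (a, i) := by
  have hM0 : 0 < (3 ^ e.p) ^ 20 := by positivity
  have hMB : (3 ^ e.p) ^ 20 < e.B := e.pow_lt (by norm_num)
  have hB1 : 1 < e.B := by omega
  have hw := sem_vecProg hf hd hz hS
  rw [hashStep, sem_seq, sem_seq]
  have hg₁ := hf.vec
  have hg₁d : HasDatum (vecProg.sem f) i z := hd.sem clamped_vecProg
  have hg₁a := vecProg_of_ne f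
  set w := vecRes e S z
  set g₁ := vecProg.sem f
  clear_value g₁
  have hn := sem_normProg hg₁ hg₁d.label (d := d) (by
    rw [hg₁a _ _ (by norm_num), hg₁a _ _ (by norm_num), hg₁a _ _ (by norm_num), h8]) hdlt hdlt'
  rw [hg₁a _ _ (by norm_num)] at hn
  have hg₂ : Base e (normProg.sem g₁) := hg₁.sem clamped_normProg (by simp [avoids_normProg])
    (by simp [avoids_normProg]) (by simp [avoids_normProg])
  have hg₂a : ∀ k, normProg.avoids k → normProg.sem g₁ k = g₁ k := fun k hk =>
    Prog.sem_of_avoids _ _ hk _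
  simp only [avoids_normProg] at hg₂a
  set g₂ := normProg.sem g₁
  clear_value g₂
  have h22 : (g₂ (3, 22), g₂ (3, 23)) = w := by
    rw [hg₂a _ (by simp), hg₂a _ (by simp), hw]
  have hlab₂ : g₂ (1, 0) = i := by rw [hg₂a _ (by simp), hg₁d.label]
  have harr₂ : ∀ a, a ≠ 3 → g₂ (a, i) = f (a, i) := fun a ha => by
    rw [hg₂a _ (by simp [ha.symm]), hg₁a _ _ ha]
  set v := red ((3 ^ e.p) ^ 20) (s * toG w) with hv
  have hvlt := red_lt hM0 (s * toG w)
  rw [← hv] at hvlt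
  have hprod : ∀ h : State, (∀ k, k ≠ (3, 40) → h k = g₂ k) →
      ((reE (modE 20) (var 33) (var 34) (var 22) (var 23)).ev h,
        (imE (modE 20) (var 33) (var 34) (var 22) (var 23)).ev h) = v := by
    intro h hh
    have hM : (modE 20).ev h = (3 ^ e.p) ^ 20 := by
      rw [modE, ev_powE, ev_var, hh _ (by simp), hg₂.P]
    rw [ev_reE_imE (by rw [hM]; exact hM0), hM, hv, hs, ← hn, ← h22]
    simp [hh]
  have h40 : ∀ k, k ≠ (3, 40) → Function.update g₂ (3, 40) v.1 k = g₂ k := fun k hk =>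
    Function.update_of_ne hk _ _
  rw [sem_seq, sem_put (c := 40) (v := v.1) hg₂.clamp (congrArg Prod.fst (hprod g₂ fun _ _ => rfl))
      (hvlt.1.trans hMB),
    sem_seq, sem_put (c := 41) (v := v.2) ((h40 _ (by simp)).trans hg₂.clamp)
      (congrArg Prod.snd (hprod _ h40)) (hvlt.2.trans hMB)]
  set g₃ := Function.update (Function.update g₂ (3, 40) v.1) (3, 41) v.2 with hg₃
  have hg₃a : ∀ k, k ≠ (3, 40) → k ≠ (3, 41) → g₃ k = g₂ k := fun k h h' => by
    rw [hg₃, Function.update_of_ne h', Function.update_of_ne h]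
  have v₃ : (g₃ (3, 40), g₃ (3, 41)) =
      red ((3 ^ e.p) ^ 20) (iunit ^ 0 * s * toG w) := by
    rw [pow_zero, one_mul, ← hv]
    simp [hg₃]
  clear_value g₃
  have b₃ : Base e g₃ := ⟨by rw [hg₃a _ (by simp) (by simp), hg₂.n],
    by rw [hg₃a _ (by simp) (by simp), hg₂.clamp], by rw [hg₃a _ (by simp) (by simp), hg₂.P],
    by rw [hg₃a _ (by simp) (by simp), hg₂.Q], by rw [hg₃a _ (by simp) (by simp), hg₂.x]⟩
  have l₃ : g₃ (1, 0) = i := by rw [hg₃a _ (by simp) (by simp), hlab₂]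
  have a₃ : ∀ a, a ≠ 3 → g₃ (a, i) = f (a, i) := fun a ha => by
    rw [hg₃a _ (by simp [ha]) (by simp [ha]), harr₂ a ha]
  rw [sem_seq, sem_seq, sem_seq, sem_seq]
  obtain ⟨b₄, l₄, v₄, r₄, a₄⟩ := sem_turnProg b₃ (t := 0) (by norm_num) l₃ v₃ (W := W) (by
    rw [a₃ _ (by norm_num), a₃ _ (by norm_num)]; exact hF 0 (by norm_num))
  set g₄ := (turnProg 0).sem g₃
  clear_value g₄
  obtain ⟨b₅, l₅, v₅, r₅, a₅⟩ := sem_turnProg b₄ (t := 1) (by norm_num) l₄ v₄ (W := W) (by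
    rw [a₄ _ (by norm_num) (by norm_num), a₄ _ (by norm_num) (by norm_num), a₃ _ (by norm_num),
      a₃ _ (by norm_num)]
    exact hF 1 (by norm_num))
  set g₅ := (turnProg 1).sem g₄
  clear_value g₅
  obtain ⟨b₆, l₆, v₆, r₆, a₆⟩ := sem_turnProg b₅ (t := 2) (by norm_num) l₅ v₅ (W := W) (by
    rw [a₅ _ (by norm_num) (by norm_num), a₅ _ (by norm_num) (by norm_num),
      a₄ _ (by norm_num) (by norm_num), a₄ _ (by norm_num) (by norm_num), a₃ _ (by norm_num),
      a₃ _ (by norm_num)]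
    exact hF 2 (by norm_num))
  set g₆ := (turnProg 2).sem g₅
  clear_value g₆
  obtain ⟨b₇, l₇, -, r₇, a₇⟩ := sem_turnProg b₆ (t := 3) (by norm_num) l₆ v₆ (W := W) (by
    rw [a₆ _ (by norm_num) (by norm_num), a₆ _ (by norm_num) (by norm_num),
      a₅ _ (by norm_num) (by norm_num), a₅ _ (by norm_num) (by norm_num),
      a₄ _ (by norm_num) (by norm_num), a₄ _ (by norm_num) (by norm_num), a₃ _ (by norm_num),
      a₃ _ (by norm_num)]
    exact hF 3 (by norm_num))
  set g₇ := (turnProg 3).sem g₆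
  clear_value g₇
  have hF₇ : ∀ t < 4, g₇ (10 + t, i) =
      fingerprint e.Q ((3 ^ e.p) ^ 20) e.x (turned e s t (w ::ₘ W)) := by
    intro t ht
    interval_cases t
    · rw [a₇ _ (by norm_num) (by norm_num), a₆ _ (by norm_num) (by norm_num),
        a₅ _ (by norm_num) (by norm_num), r₄]
    · rw [a₇ _ (by norm_num) (by norm_num), a₆ _ (by norm_num) (by norm_num), r₅]
    · rw [a₇ _ (by norm_num) (by norm_num), r₆]
    · exact r₇
  have hFlt : ∀ t < 4, g₇ (10 + t, i) < e.B := fun t ht => by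
    rw [hF₇ t ht]
    exact (Nat.mod_lt _ e.hQ.pos).trans e.hQB
  have hmin : min (min (min (g₇ (10, i)) (g₇ (11, i))) (g₇ (12, i))) (g₇ (13, i)) < e.B :=
    (min_le_right _ _).trans_lt (hFlt 3 (by norm_num))
  rw [sem_seq, sem_store (a := 14) (v := 1) b₇.clamp l₇ rfl hB1]
  have h14 : ∀ a j, a ≠ 14 → Function.update g₇ (14, i) 1 (a, j) = g₇ (a, j) := fun a j ha =>
    Function.update_of_ne (by simp [ha]) _ _
  rw [sem_store (a := 2) (v := min (min (min (g₇ (10, i)) (g₇ (11, i))) (g₇ (12, i))) (g₇ (13, i)))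
    ((h14 _ _ (by norm_num)).trans b₇.clamp) ((h14 _ _ (by norm_num)).trans l₇) (by
      simp only [ev_minE, ev_lab]
      rw [h14 1 _ (by norm_num), l₇, h14 _ _ (by norm_num), h14 _ _ (by norm_num),
        h14 _ _ (by norm_num), h14 _ _ (by norm_num)]) hmin]
  have h2 : ∀ a, a ≠ 2 → a ≠ 14 → Function.update (Function.update g₇ (14, i) 1) (2, i)
      (min (min (min (g₇ (10, i)) (g₇ (11, i))) (g₇ (12, i))) (g₇ (13, i))) (a, i) = g₇ (a, i) :=
    fun a ha ha' => by rw [Function.update_of_ne (by simp [ha]), h14 _ _ ha']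
  refine ⟨?_, fun t ht => ?_, ?_, fun a h3 ha2 ha => ?_⟩
  · rw [Function.update_of_ne (by simp), Function.update_self]
  · rw [h2 _ (by omega) (by omega), hF₇ t ht]
  · rw [Function.update_self, h2 _ (by norm_num) (by norm_num), h2 _ (by norm_num) (by norm_num),
      h2 _ (by norm_num) (by norm_num), h2 _ (by norm_num) (by norm_num)]
  · rw [h2 a ha2 (by omega), a₇ a h3 (by omega), a₆ a h3 (by omega), a₅ a h3 (by omega),
      a₄ a h3 (by omega), a₃ a h3]

/-! ### Running the passes over the stream -/

/-- The points with the label `i` in a stream. -/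
def ptsOf {m : ℕ} (σ : PointStream m) (i : Fin m) : Multiset (ℚ × ℚ) :=
  ((σ.filter (fun d => d.1 = i)).map Prod.snd : List (ℚ × ℚ))

theorem readState_of_ne {m : ℕ} (d : Fin m × ℚ × ℚ) (f : State) {a : ℕ} (ha : a ≠ 1) (j : ℕ) :
    readState d f (a, j) = f (a, j) := if_neg fun h => ha h.1

theorem Base.readState {e : Params} {f : State} (h : Base e f) {m : ℕ} (d : Fin m × ℚ × ℚ) :
    Base e (readState d f) := by
  constructor <;> rw [readState_of_ne _ _ (by norm_num)]
  exacts [h.n, h.clamp, h.P, h.Q, h.x]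

theorem hasDatum_readState {m : ℕ} (d : Fin m × ℚ × ℚ) (f : State) :
    HasDatum (readState d f) d.1 d.2 := by
  constructor <;> simp [GeomHash.readState, encodeDatum, encodeRat]

/-- Rule for one pass: `I i Z f` says that the cells of the label `i` are as they should be after
the points `Z` of this label. -/
theorem semScan_rule {e : Params} {m : ℕ} {c : Prog} (hc : c.Clamped) (h0 : c.avoids (3, 0))
    (h1 : c.avoids (3, 1)) (h2 : c.avoids (3, 2)) (A : Fin m → Multiset (ℚ × ℚ))
    (I : Fin m → Multiset (ℚ × ℚ) → State → Prop)
    (hI : ∀ (i : Fin m) Z f g, (∀ a, a = 2 ∨ 5 ≤ a → g (a, (i : ℕ)) = f (a, (i : ℕ))) →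
      I i Z f → I i Z g)
    (hstep : ∀ (i : Fin m) Z f z, Base e f → HasDatum f i z → BoundedPt e.U z →
      z ::ₘ Z ≤ A i → I i Z f → I i (z ::ₘ Z) (c.sem f))
    {σ : PointStream m} (hσ : ∀ d ∈ σ, BoundedPt e.U d.2) (hA : ∀ i, ptsOf σ i = A i)
    {f : State} (hf : Base e f) (hf0 : ∀ i, I i 0 f) :
    Base e (semScan c σ f) ∧ ∀ i, I i (A i) (semScan c σ f) := by
  have key : ∀ (σ : PointStream m) (f : State) (Z : Fin m → Multiset (ℚ × ℚ)),
      (∀ d ∈ σ, BoundedPt e.U d.2) → (∀ i, ptsOf σ i + Z i = A i) → Base e f →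
      (∀ i, I i (Z i) f) → Base e (semScan c σ f) ∧ ∀ i, I i (A i) (semScan c σ f) := by
    intro σ
    induction σ with
    | nil =>
      intro f Z _ hZ hf hfI
      exact ⟨hf, fun i => by rw [← hZ i]; simpa [ptsOf, semScan] using hfI i⟩
    | cons d σ ih =>
      intro f Z hσ hZ hf hfI
      have hrd := hf.readState d
      have hd := hasDatum_readState d f
      have hread : ∀ i, I i (Z i) (readState d f) := fun i =>
        hI i _ _ _ (fun a ha => readState_of_ne _ _ (by omega) _) (hfI i)
      refine ih (c.sem (readState d f)) (Function.update Z d.1 (d.2 ::ₘ Z d.1))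
        (fun d hd => hσ d (by simp [hd])) (fun i => ?_) (hrd.sem hc h0 h1 h2) (fun i => ?_)
      · rw [← hZ i]
        by_cases hi : d.1 = i
        · subst hi
          simp [ptsOf, ← Multiset.cons_coe]
        · rw [Function.update_of_ne (Ne.symm hi)]
          simp [ptsOf, hi]
      · by_cases hi : i = d.1
        · subst hi
          rw [Function.update_self]
          refine hstep _ _ _ _ hrd hd (hσ d (by simp)) ?_ (hread _)
          rw [← hZ d.1]
          simp [ptsOf, ← Multiset.cons_coe]
        · rw [Function.update_of_ne hi]
          refine hI i _ _ _ (fun a ha => c.sem_other hc _ _ _ (by omega) ?_) (hread i)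
          rw [hd.label]
          exact fun h => hi (Fin.ext h)
  exact key σ f 0 hσ (by simpa using hA) hf hf0

/-- Sum of the residues of a multiset of points. -/
def resSum (e : Params) (A : Multiset (ℚ × ℚ)) : GaussianInt :=
  (A.map fun z => toG (resPt e.U (3 ^ e.p) z)).sum

/-- Result of the first pass. -/
theorem semScan_sumStep {e : Params} {m : ℕ} {A : Fin m → Multiset (ℚ × ℚ)} {σ : PointStream m}
    (hσ : ∀ d ∈ σ, BoundedPt e.U d.2) (hA : ∀ i, ptsOf σ i = A i) {f : State} (hf : Base e f)
    (hf0 : ∀ a, 5 ≤ a → ∀ i, f (a, i) = 0) :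
    Base e (semScan sumStep σ f) ∧ ∀ i : Fin m,
      (semScan sumStep σ f (5, i), semScan sumStep σ f (6, i)) =
        red ((3 ^ e.p) ^ 42) (resSum e (A i)) ∧
      ∀ a, 7 ≤ a → semScan sumStep σ f (a, i) = 0 := by
  refine semScan_rule clamped_sumStep (by simp [sumStep, avoids_pointProg])
    (by simp [sumStep, avoids_pointProg]) (by simp [sumStep, avoids_pointProg]) A
    (fun i Z g => (g (5, (i : ℕ)), g (6, (i : ℕ))) = red ((3 ^ e.p) ^ 42) (resSum e Z) ∧
      ∀ a, 7 ≤ a → g (a, (i : ℕ)) = 0) ?_ ?_ hσ hA hf ?_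
  · rintro i Z g h hgh ⟨h1, h2⟩
    refine ⟨?_, fun a ha => ?_⟩
    · rw [hgh _ (by norm_num), hgh _ (by norm_num), h1]
    · rw [hgh _ (by omega), h2 a ha]
  · rintro i Z g z hg hd hz - ⟨h1, h2⟩
    obtain ⟨hS, hfr⟩ := sem_sumStep hg hd hz h1
    refine ⟨?_, fun a ha => by rw [hfr a (by omega) (by omega) (by omega), h2 a ha]⟩
    rw [hS, resSum, resSum, Multiset.map_cons, Multiset.sum_cons, add_comm]
  · intro i
    refine ⟨?_, fun a ha => hf0 a (by omega) _⟩
    rw [hf0 _ le_rfl, hf0 _ (by norm_num)]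
    simp [resSum, red]

/-- Result of the second pass. -/
theorem semScan_prodStep {e : Params} {m : ℕ} {A : Fin m → Multiset (ℚ × ℚ)} {σ : PointStream m}
    (hσ : ∀ d ∈ σ, BoundedPt e.U d.2) (hA : ∀ i, ptsOf σ i = A i) (hcard : ∀ i, (A i).card = e.n)
    {f : State} (hf : Base e f) {S : Fin m → GaussianInt}
    (hS : ∀ i : Fin m, (f (5, i), f (6, i)) = red ((3 ^ e.p) ^ 42) (S i))
    (hf0 : ∀ a, 7 ≤ a → ∀ i : Fin m, f (a, i) = 0) :
    Base e (semScan prodStep σ f) ∧ ∀ i : Fin m,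
      (semScan prodStep σ f (5, i), semScan prodStep σ f (6, i)) = red ((3 ^ e.p) ^ 42) (S i) ∧
      semScan prodStep σ f (7, i) = liveCount (3 ^ e.p) ((A i).map (vecRes e (S i))) ∧
      (semScan prodStep σ f (8, i) + (1 - semScan prodStep σ f (7, i)),
        semScan prodStep σ f (9, i)) =
        red ((3 ^ e.p) ^ 21) (unitProd (3 ^ e.p) ((A i).map (vecRes e (S i)))) ∧
      ∀ a, 10 ≤ a → semScan prodStep σ f (a, i) = 0 := by
  refine semScan_rule clamped_prodStep
    (by simp [prodStep, avoids_vecProg, stripLoop, collect])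
    (by simp [prodStep, avoids_vecProg, stripLoop, collect])
    (by simp [prodStep, avoids_vecProg, stripLoop, collect]) A
    (fun i Z g => (g (5, (i : ℕ)), g (6, (i : ℕ))) = red ((3 ^ e.p) ^ 42) (S i) ∧
      g (7, (i : ℕ)) = liveCount (3 ^ e.p) (Z.map (vecRes e (S i))) ∧
      (g (8, (i : ℕ)) + (1 - g (7, (i : ℕ))), g (9, (i : ℕ))) =
        red ((3 ^ e.p) ^ 21) (unitProd (3 ^ e.p) (Z.map (vecRes e (S i)))) ∧
      ∀ a, 10 ≤ a → g (a, (i : ℕ)) = 0) ?_ ?_ hσ hA hf ?_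
  · rintro i Z g h hgh ⟨h1, h2, h3, h4⟩
    refine ⟨?_, ?_, ?_, fun a ha => ?_⟩
    · rw [hgh _ (by norm_num), hgh _ (by norm_num), h1]
    · rw [hgh _ (by norm_num), h2]
    · rw [hgh _ (by norm_num), hgh _ (by norm_num), hgh _ (by norm_num), h3]
    · rw [hgh _ (by omega), h4 a ha]
  · rintro i Z g z hg hd hz hle ⟨h1, h2, h3, h4⟩
    have hk : g (7, (i : ℕ)) + 1 < e.B := by
      have hc : g (7, (i : ℕ)) ≤ Z.card := by
        rw [h2, liveCount]
        exact (Multiset.card_le_card (Multiset.filter_le _ _)).trans (by simp)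
      have hle' := Multiset.card_le_card hle
      rw [Multiset.card_cons, hcard] at hle'
      have := e.hnP
      have := e.pow_lt (k := 1) (by norm_num)
      rw [pow_one] at this
      omega
    obtain ⟨h2', h3', hfr⟩ := sem_prodStep hg hd hz h1 hk h2 h3
    refine ⟨?_, ?_, ?_, fun a ha => ?_⟩
    · rw [hfr _ (by norm_num) (by norm_num) (by norm_num) (by norm_num),
        hfr _ (by norm_num) (by norm_num) (by norm_num) (by norm_num), h1]
    · rw [h2', Multiset.map_cons]
    · rw [h3', Multiset.map_cons]
    · rw [hfr a (by omega) (by omega) (by omega) (by omega), h4 a ha]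
  · intro i
    refine ⟨hS i, ?_, ?_, fun a ha => hf0 a (by omega) _⟩
    · rw [hf0 _ le_rfl]
      simp [liveCount]
    · rw [hf0 _ le_rfl, hf0 _ (by norm_num), hf0 _ (by norm_num)]
      have : 1 < (3 ^ e.p) ^ 21 := Nat.one_lt_pow (by norm_num)
        (Nat.one_lt_pow (by have := e.hp; omega) (by norm_num))
      have h1 : red ((3 ^ e.p) ^ 21) (toG (1, 0)) = (1, 0) := red_toG this (by omega)
      simp only [Multiset.map_zero, unitProd, Multiset.filter_zero, Multiset.prod_zero]
      rw [show (1 : GaussianInt) = toG (1, 0) from rfl, h1]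

/-- Result of the third pass. No set is empty, so the output cell of each label has been written. -/
theorem semScan_hashStep {e : Params} {m : ℕ} {A : Fin m → Multiset (ℚ × ℚ)} {σ : PointStream m}
    (hσ : ∀ d ∈ σ, BoundedPt e.U d.2) (hA : ∀ i, ptsOf σ i = A i) (hne : ∀ i, A i ≠ 0)
    {f : State} (hf : Base e f) {S : Fin m → GaussianInt}
    (hS : ∀ i : Fin m, (f (5, i), f (6, i)) = red ((3 ^ e.p) ^ 42) (S i))
    (h7 : ∀ i : Fin m, f (7, i) = liveCount (3 ^ e.p) ((A i).map (vecRes e (S i))))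
    (h8 : ∀ i : Fin m, (f (8, i) + (1 - f (7, i)), f (9, i)) =
        red ((3 ^ e.p) ^ 21) (unitProd (3 ^ e.p) ((A i).map (vecRes e (S i)))))
    (hf0 : ∀ a, 10 ≤ a → ∀ i : Fin m, f (a, i) = 0) (i : Fin m) :
    semScan hashStep σ f (2, i) = hashVal e.Q (3 ^ e.p) e.x ((A i).map (vecRes e (S i))) := by
  set W : Fin m → Multiset (ℕ × ℕ) := fun i => (A i).map (vecRes e (S i))
  have hav : ∀ j, j = 0 ∨ j = 1 ∨ j = 2 → hashStep.avoids (3, j) := by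
    intro j hj
    simp [hashStep, avoids_vecProg, avoids_normProg, turnProg, accumProg, rotProg]
    omega
  have h := (semScan_rule clamped_hashStep (hav 0 (by simp)) (hav 1 (by simp)) (hav 2 (by simp)) A
    (fun i Z g => (g (5, (i : ℕ)), g (6, (i : ℕ))) = red ((3 ^ e.p) ^ 42) (S i) ∧
      g (7, (i : ℕ)) = liveCount (3 ^ e.p) (W i) ∧
      (g (8, (i : ℕ)) + (1 - g (7, (i : ℕ))), g (9, (i : ℕ))) =
        red ((3 ^ e.p) ^ 21) (unitProd (3 ^ e.p) (W i)) ∧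
      (∀ t < 4, g (10 + t, (i : ℕ)) + (1 - g (14, (i : ℕ))) = fingerprint e.Q ((3 ^ e.p) ^ 20) e.x
        (turned e (toG (turn (3 ^ e.p) (W i))) t (Z.map (vecRes e (S i))))) ∧
      (Z ≠ 0 → g (14, (i : ℕ)) = 1 ∧ g (2, (i : ℕ)) = min (min (min (g (10, (i : ℕ)))
        (g (11, (i : ℕ)))) (g (12, (i : ℕ)))) (g (13, (i : ℕ))))) ?_ ?_ hσ hA hf ?_).2 i
  · obtain ⟨-, -, -, h4, h5⟩ := h
    obtain ⟨h14, h2⟩ := h5 (hne i)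
    have hF := fun t ht => h4 t ht
    simp only [h14, Nat.sub_self, add_zero] at hF
    have e0 := hF 0 (by norm_num)
    have e1 := hF 1 (by norm_num)
    have e2 := hF 2 (by norm_num)
    have e3 := hF 3 (by norm_num)
    norm_num at e0 e1 e2 e3
    rw [h2, e0, e1, e2, e3]
    rfl
  · rintro i Z g h hgh ⟨h1, h2, h3, h4, h5⟩
    refine ⟨?_, ?_, ?_, fun t ht => ?_, fun hZ => ?_⟩
    · rw [hgh _ (by norm_num), hgh _ (by norm_num), h1]
    · rw [hgh _ (by norm_num), h2]
    · rw [hgh _ (by norm_num), hgh _ (by norm_num), hgh _ (by norm_num), h3]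
    · rw [hgh _ (by omega), hgh _ (by norm_num), h4 t ht]
    · rw [hgh _ (by norm_num), hgh _ (by norm_num), hgh _ (by norm_num), hgh _ (by norm_num),
        hgh _ (by norm_num), hgh _ (by norm_num)]
      exact h5 hZ
  · rintro i Z g z hg hd hz - ⟨h1, h2, h3, h4, -⟩
    have hlt := red_lt (M := (3 ^ e.p) ^ 21) (by positivity) (unitProd (3 ^ e.p) (W i))
    obtain ⟨c14, cF, c2, cr⟩ := sem_hashStep hg hd hz h1 h3 hlt.1 hlt.2
      (s := toG (turn (3 ^ e.p) (W i))) (by rw [turn, h2]) h4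
    have hr : ∀ a, 5 ≤ a → a < 10 → hashStep.sem g (a, (i : ℕ)) = g (a, (i : ℕ)) :=
      fun a h h' => cr a (by omega) (by omega) (by omega)
    refine ⟨?_, ?_, ?_, fun t ht => ?_, fun _ => ⟨c14, c2⟩⟩
    · rw [hr _ (by norm_num) (by norm_num), hr _ (by norm_num) (by norm_num), h1]
    · rw [hr _ (by norm_num) (by norm_num), h2]
    · rw [hr _ (by norm_num) (by norm_num), hr _ (by norm_num) (by norm_num),
        hr _ (by norm_num) (by norm_num), h3]
    · rw [c14, cF t ht, Multiset.map_cons, Nat.sub_self, add_zero]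
  · intro i
    refine ⟨hS i, h7 i, h8 i, fun t _ => ?_, fun h => (h rfl).elim⟩
    rw [hf0 _ (by omega), hf0 _ (by norm_num)]
    simp [turned, fingerprint, Nat.mod_eq_of_lt e.hQ.one_lt]

theorem semScan_skip_of_ne {m : ℕ} (σ : PointStream m) (f : State) {a : ℕ} (ha : a ≠ 1) (j : ℕ) :
    semScan .skip σ f (a, j) = f (a, j) := by
  induction σ generalizing f with
  | nil => rfl
  | cons d σ ih =>
    rw [semScan, List.foldl_cons]
    exact (ih _).trans (readState_of_ne _ _ ha _)

/-- The streaming algorithm with a given initialization; it needs only three of the passes. -/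
def algOf (init : Prog) : StreamAlg 6 where
  init := init
  step := ![sumStep, prodStep, hashStep, .skip, .skip, .skip]
  post := fun _ => .skip

theorem clamped_algOf (init : Prog) (j : Fin 6) :
    ((algOf init).step j).Clamped ∧ ((algOf init).post j).Clamped := by
  refine ⟨?_, trivial⟩
  fin_cases j
  exacts [clamped_sumStep, clamped_prodStep, clamped_hashStep, trivial, trivial, trivial]

/-- All passes together leave the hash values in the output array, for any initialization that
provides the clamp, the power of three, the prime, and the point of evaluation. -/
theorem sem_algOf (init : Prog) {e : Params} {m : ℕ} {A : Fin m → Multiset (ℚ × ℚ)}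
    {σ : PointStream m} (hσ : ∀ d ∈ σ, BoundedPt e.U d.2) (hA : ∀ i, ptsOf σ i = A i)
    (hcard : ∀ i, (A i).card = e.n) (hn : 1 ≤ e.n) {f : State} (hf : Base e f)
    (hf0 : ∀ a, 5 ≤ a → ∀ i, f (a, i) = 0) (i : Fin m) :
    (algOf init).sem σ f (2, i) =
      hashVal e.Q (3 ^ e.p) e.x ((A i).map (resVec e.U (3 ^ e.p) (A i))) := by
  obtain ⟨b1, h1⟩ := semScan_sumStep hσ hA hf hf0
  obtain ⟨b2, h2⟩ := semScan_prodStep hσ hA hcard b1 (fun i => (h1 i).1)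
    (fun a ha i => (h1 i).2 a ha)
  have h3 := semScan_hashStep hσ hA (fun i h => by have := hcard i; simp [h] at this; omega) b2
    (fun i => (h2 i).1) (fun i => (h2 i).2.1) (fun i => (h2 i).2.2.1)
    (fun a ha i => (h2 i).2.2.2 a ha) i
  have hsem : (algOf init).sem σ f = semScan .skip σ (semScan .skip σ (semScan .skip σ
      (semScan hashStep σ (semScan prodStep σ (semScan sumStep σ f))))) := rfl
  rw [hsem, semScan_skip_of_ne _ _ (by norm_num), semScan_skip_of_ne _ _ (by norm_num),
    semScan_skip_of_ne _ _ (by norm_num), h3]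
  congr 1
  refine Multiset.map_congr rfl fun z _ => ?_
  rw [vecRes, resVec, hcard i]
  rfl

/-! ### Initialization -/

/-- The parameters `n`, `U`, `m` as expressions. -/
def parE (j : ℕ) : Expr := .cell 0 (.const j)

/-- Finds, in the scratch cell `0`, the least power of three greater than `2 * n * U`. -/
def powerProg : Prog :=
  .seq (put 0 (.const 1)) <|
  .loop (.mul (.const 2) (.mul (parE 0) (parE 1))) <|
    .ite (.sub (.add (.mul (.const 2) (.mul (parE 0) (parE 1))) (.const 1)) (var 0))
      (put 0 (.mul (.const 3) (var 0))) .skip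

theorem clamped_powerProg : powerProg.Clamped :=
  ⟨clamped_put (by norm_num) _, clamped_put (by norm_num) _, trivial⟩

theorem sem_powerProg {f : State} {n U B : ℕ} (hn : f (0, 0) = n) (hU : f (0, 1) = U)
    (hB : f (4, 0) = B) (hnU : 1 ≤ n * U) (hlt : 6 * (n * U) < B) :
    ∃ p, 1 ≤ p ∧ powerProg.sem f (3, 0) = 3 ^ p ∧ 2 * (n * U) < 3 ^ p ∧ 3 ^ p ≤ 6 * (n * U) := by
  rw [powerProg, sem_seq, sem_put (c := 0) (v := 1) hB rfl (by omega)]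
  set g := Function.update f (3, 0) 1 with hg
  have hg0 : g (3, 0) = 1 := by simp [hg]
  have hgn : g (0, 0) = n := by simpa [hg] using hn
  have hgU : g (0, 1) = U := by simpa [hg] using hU
  have hg4 : g (4, 0) = B := by simpa [hg] using hB
  clear_value g
  have h := Prog.loop_rule (e := .mul (.const 2) (.mul (parE 0) (parE 1))) (c := .ite (.sub (.add
      (.mul (.const 2) (.mul (parE 0) (parE 1))) (.const 1)) (var 0))
      (put 0 (.mul (.const 3) (var 0))) .skip) (f := g)
    (fun k h => ∃ p, h (3, 0) = 3 ^ p ∧ 3 ^ p ≤ 6 * (n * U) ∧ k < 3 ^ p) ⟨0, by simpa using hg0, by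
      simp; omega, by simp⟩ (by
      rintro k h hk hh ⟨p, h0, h1, h2⟩
      have hev : (Expr.mul (.const 2) (.mul (parE 0) (parE 1))).ev g = 2 * (n * U) := by
        simp [parE, hgn, hgU]
      rw [hev] at hk
      have hn' : h (0, 0) = n := by rw [hh _ (by simp), hgn]
      have hU' : h (0, 1) = U := by rw [hh _ (by simp), hgU]
      have h4 : h (4, 0) = B := by rw [hh _ (by simp), hg4]
      have hcond : (Expr.sub (.add (.mul (.const 2) (.mul (parE 0) (parE 1))) (.const 1))
          (var 0)).ev h = 2 * (n * U) + 1 - 3 ^ p := by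
        simp [parE, hn', hU', h0]
      by_cases hc : 3 ^ p ≤ 2 * (n * U)
      · rw [sem_ite_pos (by rw [hcond]; omega), sem_put (c := 0) (v := 3 ^ (p + 1)) h4
          (by simp [h0, pow_succ']) (by rw [pow_succ]; omega)]
        refine ⟨p + 1, by simp, ?_, ?_⟩ <;> rw [pow_succ] <;> omega
      · rw [sem_ite_neg (by rw [hcond]; omega)]
        exact ⟨p, h0, h1, by omega⟩)
  have hev : (Expr.mul (.const 2) (.mul (parE 0) (parE 1))).ev g = 2 * (n * U) := by
    simp [parE, hgn, hgU]
  rw [hev] at h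
  obtain ⟨p, h0, h1, h2⟩ := h
  refine ⟨p, ?_, h0, h2, h1⟩
  rcases Nat.eq_zero_or_pos p with rfl | hp
  · rw [pow_zero] at h2
    omega
  · exact hp

/-- Primality by counting the divisors `j < c`. The candidate `j = 0` never counts, since
`c % 0 = c`. -/
theorem count_dvd_eq_one_iff (c : ℕ) : Nat.count (fun j => c % j = 0) c = 1 ↔ c.Prime := by
  rw [Nat.count_eq_card_filter_range]
  rcases Nat.eq_zero_or_pos c with rfl | hc
  · simp [Nat.not_prime_zero]
  have h : (Finset.range c).filter (fun j => c % j = 0) = c.properDivisors := by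
    ext j
    rw [Finset.mem_filter, Finset.mem_range, Nat.mem_properDivisors, ← Nat.dvd_iff_mod_eq_zero,
      and_comm]
  rw [h, ← Nat.properDivisors_eq_singleton_one_iff_prime]
  constructor
  · intro h1
    obtain ⟨a, ha⟩ := Finset.card_eq_one.1 h1
    have hc1 : 1 < c := by
      rcases (by omega : c = 1 ∨ 1 < c) with rfl | h
      · simp at ha
      · exact h
    have := Nat.one_mem_properDivisors_iff_one_lt.2 hc1
    rw [ha, Finset.mem_singleton] at this
    rw [ha, this]
  · intro h1
    rw [h1, Finset.card_singleton]

/-- Counts the proper divisors of the number in the scratch cell `4` into cell `6`. -/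
def divisorProg : Prog :=
  .seq (put 5 (.const 0)) <| .seq (put 6 (.const 0)) <|
  .loop (var 4) <|
    .seq (.ite (.mod (var 4) (var 5)) .skip (put 6 (.add (var 6) (.const 1))))
      (put 5 (.add (var 5) (.const 1)))

theorem clamped_divisorProg : divisorProg.Clamped :=
  ⟨clamped_put (by norm_num) _, clamped_put (by norm_num) _,
    ⟨trivial, clamped_put (by norm_num) _⟩, clamped_put (by norm_num) _⟩

theorem sem_divisorProg {f : State} {c B : ℕ} (hc : f (3, 4) = c) (hB : f (4, 0) = B)
    (hlt : c < B) : divisorProg.sem f (3, 6) = Nat.count (fun j => c % j = 0) c := by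
  rw [divisorProg, sem_seq, sem_seq, sem_put (c := 5) (v := 0) hB rfl (by omega),
    sem_put (c := 6) (v := 0) (B := B) (by simpa using hB) rfl (by omega)]
  set g := Function.update (Function.update f (3, 5) 0) (3, 6) 0 with hg
  have hg5 : g (3, 5) = 0 := by simp [hg]
  have hg6 : g (3, 6) = 0 := by simp [hg]
  have hg4 : g (3, 4) = c := by simpa [hg] using hc
  have hgB : g (4, 0) = B := by simpa [hg] using hB
  clear_value g
  have h := Prog.loop_rule (e := var 4) (c := .seq (.ite (.mod (var 4) (var 5)) .skip
      (put 6 (.add (var 6) (.const 1)))) (put 5 (.add (var 5) (.const 1)))) (f := g)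
    (fun k h => h (3, 5) = k ∧ h (3, 6) = Nat.count (fun j => c % j = 0) k)
    ⟨hg5, by simpa using hg6⟩ (by
      rintro k h hk hh ⟨h5, h6⟩
      rw [ev_var, hg4] at hk
      have h4 : h (3, 4) = c := by rw [hh _ (by simp), hg4]
      have hB' : h (4, 0) = B := by rw [hh _ (by simp), hgB]
      have hle := Nat.count_le (p := fun j => c % j = 0) (n := k)
      rw [sem_seq, Nat.count_succ]
      by_cases hd : c % k = 0
      · rw [sem_ite_neg (by simp [h4, h5, hd]), if_pos hd,
          sem_put (c := 6) (v := Nat.count (fun j => c % j = 0) k + 1) hB' (by simp [h6])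
            (by omega),
          sem_put (c := 5) (v := k + 1) (B := B) (by simpa using hB') (by simp [h5]) (by omega)]
        simp
      · rw [sem_ite_pos (by simpa [h4, h5] using hd), if_neg hd, Prog.sem,
          sem_put (c := 5) (v := k + 1) hB' (by simp [h5]) (by omega)]
        simp [h6])
  rw [ev_var, hg4] at h
  exact h.2

/-- The upper bound for the prime modulus of the fingerprints. By Bertrand's postulate the largest
prime below it exceeds `16 * m ^ 2 * P ^ 40`, hence all codes of residues modulo `P ^ 20`, and it is
large enough for the union bound in `card_bad_le`. -/
def boundE : Expr :=
  .mul (.const 32) (.mul (.mul (parE 2) (parE 2)) (powE (var 0) 40))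

/-- Finds, in the scratch cell `1`, the largest prime up to the bound. -/
def primeProg : Prog :=
  .seq (put 1 (.const 0)) <| .seq (put 4 (.const 0)) <|
  .loop (.add boundE (.const 1)) <|
    .seq divisorProg <| .seq (.ite (eqE (var 6) (.const 1)) (put 1 (var 4)) .skip) <|
    put 4 (.add (var 4) (.const 1))

theorem clamped_primeProg : primeProg.Clamped :=
  ⟨clamped_put (by norm_num) _, clamped_put (by norm_num) _, clamped_divisorProg,
    ⟨clamped_put (by norm_num) _, trivial⟩, clamped_put (by norm_num) _⟩

theorem avoids_primeProg (k : ℕ × ℕ) : primeProg.avoids k ↔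
    (3, 1) ≠ k ∧ (3, 4) ≠ k ∧ (3, 5) ≠ k ∧ (3, 6) ≠ k := by
  simp [primeProg, divisorProg]
  tauto

theorem sem_primeProg {f : State} {m P B N : ℕ} (hm : f (0, 2) = m) (hP : f (3, 0) = P)
    (hB : f (4, 0) = B) (hN : N = 16 * (m ^ 2 * P ^ 40)) (hN0 : N ≠ 0) (hlt : 2 * N + 1 < B) :
    ∃ Q, Q.Prime ∧ primeProg.sem f (3, 1) = Q ∧ N < Q ∧ Q ≤ 2 * N := by
  rw [primeProg, sem_seq, sem_seq, sem_put (c := 1) (v := 0) hB rfl (by omega),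
    sem_put (c := 4) (v := 0) (B := B) (by simpa using hB) rfl (by omega)]
  set g := Function.update (Function.update f (3, 1) 0) (3, 4) 0 with hg
  have hg1 : g (3, 1) = 0 := by simp [hg]
  have hg4 : g (3, 4) = 0 := by simp [hg]
  have hgm : g (0, 2) = m := by simpa [hg] using hm
  have hgP : g (3, 0) = P := by simpa [hg] using hP
  have hgB : g (4, 0) = B := by simpa [hg] using hB
  clear_value g
  have hev : (Expr.add boundE (.const 1)).ev g = 2 * N + 1 := by
    simp only [boundE, parE, ev_add, ev_mul, ev_powE, ev_const, ev_cell, ev_var, hgm, hgP, hN]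
    ring
  have h := Prog.loop_rule (e := .add boundE (.const 1)) (c := .seq divisorProg <| .seq
      (.ite (eqE (var 6) (.const 1)) (put 1 (var 4)) .skip) <| put 4 (.add (var 4) (.const 1)))
      (f := g)
    (fun k h => h (3, 4) = k ∧ (h (3, 1) = 0 ∨ (h (3, 1)).Prime ∧ h (3, 1) < k) ∧
      ∀ q < k, q.Prime → q ≤ h (3, 1))
    ⟨hg4, Or.inl hg1, fun q hq => by omega⟩ (by
      rintro k h hk hh ⟨h4, h1, h2⟩
      rw [hev] at hk
      have hB' : h (4, 0) = B := by rw [hh _ (by simp [divisorProg]), hgB]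
      rw [sem_seq, sem_seq]
      have hcount := sem_divisorProg h4 hB' (by omega)
      have hd : ∀ j, j ≠ (3, 5) → j ≠ (3, 6) → divisorProg.sem h j = h j := fun j h5 h6 =>
        Prog.sem_of_avoids _ _ (by simp [divisorProg, h5.symm, h6.symm]) _
      have d4 : divisorProg.sem h (3, 4) = k := by rw [hd _ (by simp) (by simp), h4]
      have d1 : divisorProg.sem h (3, 1) = h (3, 1) := hd _ (by simp) (by simp)
      have dB : divisorProg.sem h (4, 0) = B := by rw [hd _ (by simp) (by simp), hB']
      generalize divisorProg.sem h = h' at *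
      have hcond : (eqE (var 6) (.const 1)).ev h' ≠ 0 ↔ k.Prime := by
        rw [ev_eqE_ne_zero, ev_var, ev_const, hcount, count_dvd_eq_one_iff]
      by_cases hk' : k.Prime
      · rw [sem_ite_pos (hcond.2 hk'), sem_put (c := 1) (v := k) dB (by simpa using d4) (by omega),
          sem_put (c := 4) (v := k + 1) (B := B) (by simpa using dB) (by simpa using d4)
            (by omega)]
        simp only [Function.update_self, ne_eq, Prod.mk.injEq, OfNat.one_ne_ofNat, and_false,
          not_false_eq_true, Function.update_of_ne]
        exact ⟨trivial, Or.inr ⟨hk', by omega⟩, fun q hq _ => by omega⟩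
      · rw [sem_ite_neg (by rwa [hcond]), Prog.sem,
          sem_put (c := 4) (v := k + 1) dB (by simpa using d4) (by omega)]
        simp only [Function.update_self, ne_eq, Prod.mk.injEq, OfNat.one_ne_ofNat, and_false,
          not_false_eq_true, Function.update_of_ne, d1]
        refine ⟨trivial, h1.imp_right fun h => ⟨h.1, by omega⟩, fun q hq hqp => ?_⟩
        rcases Nat.lt_succ_iff_lt_or_eq.1 hq with hq | rfl
        · exact h2 q hq hqp
        · exact (hk' hqp).elim)
  rw [hev] at h
  obtain ⟨-, h1, h2⟩ := h
  obtain ⟨q, hq, hNq, hq2⟩ := Nat.exists_prime_lt_and_le_two_mul N hN0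
  have hle := h2 q (by omega) hq
  rcases h1 with h1 | ⟨h1, h1'⟩
  · omega
  · exact ⟨_, h1, rfl, by omega, by omega⟩

/-- The clamp, larger than all numbers that the algorithm has to store. -/
def clampVal (n U m : ℕ) : ℕ := (16 * (n * U * m)) ^ 64

/-- The clamp as an expression. -/
def clampE : Expr := powE (.mul (.const 16) (.mul (.mul (parE 0) (parE 1)) (parE 2))) 64

/-- The initialization: the clamp, the power of three, the prime, and a random point of
evaluation. -/
def initProg : Prog :=
  .seq (.assign 4 (.const 0) clampE) <| .seq (.seq powerProg primeProg) <|
  .draw 3 (.const 2) (.sub (var 1) (.const 1))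

theorem le_clampVal (n U m : ℕ) : 16 * (n * U * m) ≤ clampVal n U m :=
  Nat.le_self_pow (by norm_num) _

section ClampVal

variable {n U m : ℕ} (hn : 2 ≤ n) (hU : 1 ≤ U) (hm : 1 ≤ m)

include hn hU hm

/-- The range of the search for a prime stays below the clamp. -/
theorem two_mul_prime_bound_lt {P : ℕ} (hP : P ≤ 6 * (n * U)) :
    2 * (16 * (m ^ 2 * P ^ 40)) + 1 < clampVal n U m := by
  have hnU : 1 ≤ n * U := Nat.mul_pos (by omega) hU
  have h1 : 1 ≤ n * U * m := Nat.mul_pos hnU hm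
  set T := n * U * m
  have hPT : P ≤ 16 * T := hP.trans (by
    have : n * U ≤ T := Nat.le_mul_of_pos_right _ hm
    omega)
  have hmT : m ≤ 16 * T := by
    have : m ≤ T := Nat.le_mul_of_pos_left _ hnU
    omega
  calc 2 * (16 * (m ^ 2 * P ^ 40)) + 1 ≤ 2 * (16 * ((16 * T) ^ 2 * (16 * T) ^ 40)) + 1 := by
        gcongr
    _ < 2 * (16 * T) * ((16 * T) ^ 2 * (16 * T) ^ 40) + (16 * T) ^ 43 := by
        have h2 : 1 < (16 * T) ^ 43 := Nat.one_lt_pow (by norm_num) (by omega)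
        have h3 : 2 * (16 * ((16 * T) ^ 2 * (16 * T) ^ 40)) ≤
            2 * (16 * T) * ((16 * T) ^ 2 * (16 * T) ^ 40) := by
          rw [← mul_assoc]
          gcongr
          omega
        omega
    _ = 3 * (16 * T) ^ 43 := by ring
    _ ≤ (16 * T) * (16 * T) ^ 43 := by gcongr; omega
    _ = (16 * T) ^ 44 := by ring
    _ ≤ clampVal n U m := Nat.pow_le_pow_right (by omega) (by norm_num)

theorem pow_lt_clampVal {P : ℕ} (hP : P ≤ 6 * (n * U)) : P ^ 43 < clampVal n U m := by
  have hnU : 1 ≤ n * U := Nat.mul_pos (by omega) hU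
  have h1 : 1 ≤ n * U * m := Nat.mul_pos hnU hm
  have h2 : n * U ≤ n * U * m := Nat.le_mul_of_pos_right _ hm
  calc P ^ 43 ≤ (16 * (n * U * m)) ^ 43 := by gcongr; omega
    _ < _ := Nat.pow_lt_pow_right (by omega) (by norm_num)

end ClampVal

/-! ### Correctness and space of the algorithm -/

theorem coe_start (n U m : ℕ) : ⇑(start n U m).mem =
    Function.update (Function.update (Function.update (0 : State) (0, 0) n) (0, 1) U) (0, 2) m := by
  simp only [start, Config.charge, Mem.writeList, List.zipIdx_cons, List.zipIdx_nil,
    List.foldl_cons, List.foldl_nil, coe_update_mem]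
  rfl

/-- The algorithm. -/
def hashAlg : StreamAlg 6 := algOf initProg

/-- A factor bounding the work space of the algorithm. -/
def spaceCost : ℕ :=
  (Expr.const 0).weight ^ 2 + clampE.weight ^ 2 + (Prog.seq powerProg primeProg).cost +
    ((Expr.const 2).weight ^ 2 + (Expr.sub (var 1) (.const 1)).weight ^ 2) + hashAlg.passCost

theorem datumLe_of_bounded {n U m : ℕ} (hn : 2 ≤ n) (hU : 1 ≤ U) (hm : 1 ≤ m)
    {d : Fin m × ℚ × ℚ} (hd : BoundedPt U d.2) : DatumLe (clampVal n U m) d := by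
  have hle := le_clampVal n U m
  have h1 : 1 ≤ n * U := Nat.mul_pos (by omega) hU
  have hm' : m ≤ n * U * m := Nat.le_mul_of_pos_left _ h1
  have hU' : U ≤ n * U * m := (Nat.le_mul_of_pos_left _ (by omega)).trans
    (Nat.le_mul_of_pos_right _ hm)
  have hi := d.1.isLt
  have hx := boundedQ_bounds hU hd.1
  have hy := boundedQ_bounds hU hd.2
  have hs : ∀ x : ℚ, (if x < 0 then 1 else 0) ≤ 1 := fun x => by split_ifs <;> omega
  have hsx := hs d.2.1
  have hsy := hs d.2.2
  intro v hv
  simp only [encodeDatum, encodeRat, List.cons_append, List.nil_append, List.mem_cons,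
    List.not_mem_nil, or_false] at hv
  omega

/-- A run of the algorithm amounts to drawing one number `x` uniformly below a prime: the final
configuration is a function of `x`, with bounded space and the hash values as output. -/
theorem run_spec {n U m : ℕ} (hn : 2 ≤ n) (hU : 1 ≤ U) (hm : 1 ≤ m) :
    ∃ p Q', 1 ≤ p ∧ (Q' + 1).Prime ∧ 2 * (n * U) < 3 ^ p ∧ 16 * (m ^ 2 * (3 ^ p) ^ 40) < Q' + 1 ∧
      Q' + 1 < clampVal n U m ∧
      ∀ (A : Fin m → Multiset (ℚ × ℚ)) (σ : PointStream m), (∀ i, (A i).card = n) →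
        (∀ d ∈ σ, BoundedPt U d.2) → (∀ i, ptsOf σ i = A i) →
        ∃ F : Fin (Q' + 1) → Config,
          hashAlg.run n U m σ = (PMF.uniformOfFintype (Fin (Q' + 1))).map F ∧
          (∀ x, (F x).peak ≤ spaceCost * Nat.size (clampVal n U m) + memBound (clampVal n U m) m) ∧
          ∀ x (i : Fin m), (F x).mem (2, i) =
            hashVal (Q' + 1) (3 ^ p) x ((A i).map (resVec U (3 ^ p) (A i))) := by
  set B := clampVal n U m with hBdef
  have hle := le_clampVal n U m
  rw [← hBdef] at hle
  have hnU : 1 ≤ n * U := Nat.mul_pos (by omega) hU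
  have hnU' : n * U ≤ n * U * m := Nat.le_mul_of_pos_right _ hm
  have hn' : n ≤ n * U := Nat.le_mul_of_pos_right _ hU
  have hU' : U ≤ n * U := Nat.le_mul_of_pos_left _ (by omega)
  have hm' : m ≤ n * U * m := Nat.le_mul_of_pos_left _ hnU
  have hB2 : 2 ≤ B := by omega
  -- the memory after the first assignment
  set s₀ := start n U m with hs₀
  have hs₀m := coe_start n U m
  rw [← hs₀] at hs₀m
  have hsmall : Small B m s₀.mem := by
    rw [hs₀m]
    refine Small.update (Small.update (Small.update ⟨by simp, by simp, by simp⟩ ?_ ?_ ?_)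
      ?_ ?_ ?_) ?_ ?_ ?_ <;> omega
  have hclamp : clampE.ev s₀.mem = B := by
    simp [clampE, parE, hs₀m, hBdef, clampVal]
  set s₁ : Config := (s₀.charge (0 + (Expr.const 0).bits s₀.mem + clampE.bits s₀.mem)).write 0 4
    ((Expr.const 0).val s₀.mem) (clampE.val s₀.mem) with hs₁
  have hs₁m : ⇑s₁.mem = Function.update s₀.mem (4, 0) B := by
    simp only [hs₁, Config.write, Config.charge, coe_update_mem, Expr.val_eq_ev, hclamp, ev_const]
  have hinv₁ : Inv B m s₁.mem := by
    have hlab : s₀.mem (1, 0) = 0 := by rw [hs₀m]; simp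
    rw [hs₁m]
    refine ⟨hsmall.update (by norm_num) (by omega) le_rfl, by simp, ?_⟩
    rw [Function.update_of_ne (by simp), hlab]
    omega
  have hpeak₁ : s₁.peak ≤ ((Expr.const 0).weight ^ 2 + clampE.weight ^ 2) * Nat.size B +
      memBound B m := by
    have h1 := (Expr.const 0).bits_le hB2 hsmall.le
    have h2 := clampE.bits_le hB2 hsmall.le
    have h3 := hsmall.bits_le
    have h4 := hinv₁.toSmall.bits_le
    have e0 : s₀.peak = max 0 (0 + s₀.mem.bits) := rfl
    have e1 : s₁.peak = max (max s₀.peak (0 + (Expr.const 0).bits s₀.mem + clampE.bits s₀.mem +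
      s₀.mem.bits)) (0 + s₁.mem.bits) := rfl
    rw [add_mul]
    omega
  -- the memory after the deterministic searches
  have hcl : (Prog.seq powerProg primeProg).Clamped := ⟨clamped_powerProg, clamped_primeProg⟩
  obtain ⟨s₂, he₂, hs₂m, hinv₂, hpeak₂⟩ := Prog.eval_clamped hB2 _ hcl 0 s₁ hinv₁
  have f00 : s₁.mem (0, 0) = n := by rw [hs₁m, hs₀m]; simp
  have f01 : s₁.mem (0, 1) = U := by rw [hs₁m, hs₀m]; simp
  have f02 : s₁.mem (0, 2) = m := by rw [hs₁m, hs₀m]; simp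
  obtain ⟨p, hp, hpow, hPl, hPu⟩ := sem_powerProg f00 f01 hinv₁.clamp hnU (by omega)
  have hN := two_mul_prime_bound_lt hn hU hm hPu
  rw [← hBdef] at hN
  have hPpos : 0 < 3 ^ p := by positivity
  obtain ⟨Q, hQ, hprime, hNQ, hQN⟩ := sem_primeProg (f := powerProg.sem s₁.mem) (m := m)
    (by rw [powerProg.sem_fixed clamped_powerProg _ _ _ (by simp), f02]) hpow
    (by rw [powerProg.sem_fixed clamped_powerProg _ _ _ (by simp), hinv₁.clamp]) rfl
    (by positivity) hN
  obtain ⟨Q', rfl⟩ := Nat.exists_eq_succ_of_ne_zero hQ.ne_zero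
  refine ⟨p, Q', hp, hQ, hPl, hNQ, by omega, fun A σ hcard hσ hA => ?_⟩
  have g1 : s₂.mem (3, 1) = Q' + 1 := by rw [hs₂m, sem_seq, hprime]
  have g0 : s₂.mem (3, 0) = 3 ^ p := by
    rw [hs₂m, sem_seq, Prog.sem_of_avoids _ _ (by simp [avoids_primeProg]), hpow]
  have gn : s₂.mem (0, 0) = n := by rw [hs₂m, Prog.sem_fixed _ hcl _ _ _ (by simp), f00]
  have gz : ∀ a, 5 ≤ a → ∀ i, s₂.mem (a, i) = 0 := by
    intro a ha i
    have h3 : (3, 0) ≠ (a, i) ∧ (3, 1) ≠ (a, i) ∧ (3, 4) ≠ (a, i) ∧ (3, 5) ≠ (a, i) ∧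
      (3, 6) ≠ (a, i) := by simp only [ne_eq, Prod.mk.injEq]; omega
    rw [hs₂m, Prog.sem_of_avoids _ _ (by simp [avoids_primeProg, powerProg, h3]), hs₁m, hs₀m]
    have h4 : a ≠ 4 ∧ a ≠ 0 := by omega
    simp [h4]
  -- the random draw
  have hval : (Expr.sub (var 1) (.const 1)).val s₂.mem = Q' := by
    rw [Expr.val_eq_ev]
    simp [g1]
  set G : ℕ → Config := fun x => (s₂.charge (0 + (Expr.const 2).bits s₂.mem +
    (Expr.sub (var 1) (.const 1)).bits s₂.mem)).write 0 3 ((Expr.const 2).val s₂.mem) x with hG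
  have hinit : initProg.eval 0 s₀ =
      (PMF.uniformOfFintype (Fin (Q' + 1))).map fun x : Fin (Q' + 1) => G x := by
    have hcast : ∀ v, v = Q' →
        (PMF.uniformOfFintype (Fin (v + 1))).map (fun x : Fin (v + 1) => G x) =
        (PMF.uniformOfFintype (Fin (Q' + 1))).map fun x : Fin (Q' + 1) => G x := by
      rintro v rfl
      rfl
    rw [← hcast _ hval]
    simp only [initProg, Prog.eval, PMF.pure_bind] at he₂ ⊢
    rw [← hs₁, he₂, PMF.pure_bind]
    change PMF.map _ (PMF.bind _ (PMF.pure ∘ Fin.val)) = _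
    rw [PMF.bind_pure_comp, PMF.map_comp]
    rfl
  have hGm : ∀ x, ⇑(G x).mem = Function.update s₂.mem (3, 2) x := fun x => by
    simp only [hG, Config.write, Config.charge, coe_update_mem, Expr.val_eq_ev, ev_const]
  have hinv : ∀ x ≤ B, Inv B m (G x).mem := fun x hx => by
    rw [hGm]
    refine ⟨hinv₂.toSmall.update (by norm_num) (by omega) hx, ?_, ?_⟩
    · rw [Function.update_of_ne (by simp), hinv₂.clamp]
    · rw [Function.update_of_ne (by simp)]
      exact hinv₂.label
  have hpeak : ∀ x ≤ B, (G x).peak ≤ (spaceCost - hashAlg.passCost) * Nat.size B +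
      memBound B m := fun x hx => by
    have h1 := (Expr.const 2).bits_le hB2 hinv₂.le
    have h2 := (Expr.sub (var 1) (.const 1)).bits_le hB2 hinv₂.le
    have h3 := hinv₂.toSmall.bits_le
    have h4 := (hinv x hx).toSmall.bits_le
    have e1 : (G x).peak = max (max s₂.peak (0 + (Expr.const 2).bits s₂.mem +
      (Expr.sub (var 1) (.const 1)).bits s₂.mem + s₂.mem.bits)) (0 + (G x).mem.bits) := rfl
    rw [spaceCost, Nat.add_sub_cancel]
    simp only [add_mul] at *
    omega
  have hrun : ∀ x : Fin (Q' + 1), ∃ s' : Config, hashAlg.passes σ (PMF.pure (G x)) = PMF.pure s' ∧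
      s'.peak ≤ spaceCost * Nat.size B + memBound B m ∧ ∀ i : Fin m, s'.mem (2, i) =
        hashVal (Q' + 1) (3 ^ p) x ((A i).map (resVec U (3 ^ p) (A i))) := by
    intro x
    have hxB : (x : ℕ) ≤ B := by have := x.isLt; omega
    obtain ⟨s', h1, h2, h3⟩ := hashAlg.passes_clamped hB2 (fun j => (clamped_algOf _ j).1)
      (fun j => (clamped_algOf _ j).2) σ (fun d hd => datumLe_of_bounded hn hU hm (hσ d hd)) (G x)
      (hinv x hxB)
    refine ⟨s', h1, ?_, fun i => ?_⟩
    · have h4 := hpeak x hxB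
      have h5 : spaceCost * Nat.size B = (spaceCost - hashAlg.passCost) * Nat.size B +
          hashAlg.passCost * Nat.size B := by
        have h6 : hashAlg.passCost ≤ spaceCost := Nat.le_add_left _ _
        rw [← add_mul, Nat.sub_add_cancel h6]
      omega
    · set e : Params := ⟨n, U, p, B, Q' + 1, x, hp, hU, by omega, by omega,
        pow_lt_clampVal hn hU hm hPu, by omega, hQ⟩
      have hbase : Base e (G x).mem := by
        rw [hGm]
        refine ⟨?_, ?_, ?_, ?_, ?_⟩
        · rw [Function.update_of_ne (by simp), gn]
        · rw [Function.update_of_ne (by simp), hinv₂.clamp]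
        · rw [Function.update_of_ne (by simp), g0]
        · rw [Function.update_of_ne (by simp), g1]
        · rw [Function.update_self]
      rw [h2]
      refine sem_algOf initProg (e := e) hσ hA hcard (by change 1 ≤ n; omega) hbase
        (fun a ha i => ?_) i
      rw [hGm, Function.update_of_ne (by simp only [ne_eq, Prod.mk.injEq]; omega), gz a ha]
  choose F hF1 hF2 hF3 using hrun
  refine ⟨F, ?_, hF2, hF3⟩
  change hashAlg.passes σ (initProg.eval 0 s₀) = _
  rw [StreamAlg.passes_bind, hinit, PMF.bind_map]
  rw [← PMF.bind_pure_comp]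
  congr 1
  funext x
  exact hF1 x

theorem memBound_le {B m : ℕ} (hm : 1 ≤ m) (hB : 64 + m ≤ B) :
    memBound B m ≤ 2080 * (m * Nat.size B) := by
  have h := Nat.size_le_size hB
  calc memBound B m ≤ 16 * (65 * m) * (Nat.size B + Nat.size B) := by
        unfold memBound
        gcongr
        omega
    _ = _ := by ring

theorem size_clampVal_le {n U m : ℕ} (hn : 2 ≤ n) (hU : 1 ≤ U) (hm : 1 ≤ m) :
    (Nat.size (clampVal n U m) : ℝ) ≤
      321 * (Real.logb 2 n + Real.logb 2 U + Real.logb 2 m) := by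
  have hn0 : (n : ℝ) ≠ 0 := by positivity
  have hU0 : (U : ℝ) ≠ 0 := by positivity
  have hm0 : (m : ℝ) ≠ 0 := by positivity
  have h1 : 1 ≤ Real.logb 2 n := by
    rw [Real.le_logb_iff_rpow_le (by norm_num) (by positivity), Real.rpow_one]
    exact_mod_cast hn
  have h2 : 0 ≤ Real.logb 2 U := Real.logb_nonneg (by norm_num) (by exact_mod_cast hU)
  have h3 : 0 ≤ Real.logb 2 m := Real.logb_nonneg (by norm_num) (by exact_mod_cast hm)
  have hpos : clampVal n U m ≠ 0 := by unfold clampVal; positivity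
  have hsize : (Nat.size (clampVal n U m) : ℝ) ≤ Real.logb 2 (clampVal n U m : ℕ) + 1 := by
    have hs : Nat.size (clampVal n U m) ≤ Nat.log 2 (clampVal n U m) + 1 :=
      Nat.size_le.2 (Nat.lt_pow_succ_log_self (by norm_num) _)
    have hs' : (Nat.size (clampVal n U m) : ℝ) ≤ Nat.log 2 (clampVal n U m) + 1 := by
      exact_mod_cast hs
    have := Real.natLog_le_logb (clampVal n U m) 2
    push_cast at this
    linarith
  have hlog : Real.logb 2 (clampVal n U m : ℕ) =
      64 * (4 + (Real.logb 2 n + Real.logb 2 U + Real.logb 2 m)) := by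
    have h16 : Real.logb 2 16 = 4 := by
      rw [show (16 : ℝ) = 2 ^ (4 : ℕ) by norm_num, Real.logb_pow,
        Real.logb_self_eq_one (by norm_num)]
      norm_num
    unfold clampVal
    push_cast
    rw [Real.logb_pow, Real.logb_mul (by norm_num) (by positivity),
      Real.logb_mul (by positivity) hm0, Real.logb_mul hn0 hU0, h16]
    norm_num
  rw [hlog] at hsize
  linarith

/-- The precision `P ^ 20` exceeds the heights that occur in `congruent_of_rel`. -/
theorem height_bound {n U P : ℕ} (hn : 1 ≤ n) (hU : 1 ≤ U) (hP : 2 * (n * U) < P) :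
    n * P ^ 2 * (8 * (2 * (U * U)) ^ 8) < P ^ 20 := by
  have hnU : 1 ≤ n * U := Nat.mul_pos hn hU
  have hn' : n ≤ n * U := Nat.le_mul_of_pos_right _ hU
  have hU' : U ≤ n * U := Nat.le_mul_of_pos_left _ hn
  calc n * P ^ 2 * (8 * (2 * (U * U)) ^ 8) ≤
        (n * U) * P ^ 2 * (8 * (2 * ((n * U) * (n * U))) ^ 8) := by gcongr
    _ = 2 ^ 11 * (n * U) ^ 17 * P ^ 2 := by ring
    _ ≤ 2 ^ 17 * (n * U) ^ 17 * P ^ 2 := by gcongr <;> norm_num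
    _ = (2 * (n * U)) ^ 17 * P ^ 2 := by ring
    _ ≤ P ^ 17 * P ^ 2 := by gcongr
    _ = P ^ 19 := by ring
    _ < P ^ 20 := Nat.pow_lt_pow_right (by omega) (by norm_num)

theorem hash_eq_iff {m len : ℕ} (s : Config) {i j : Fin m} (hi : s.mem (2, i) < 2 ^ len)
    (hj : s.mem (2, j) < 2 ^ len) :
    (s.hash len i = s.hash len j) ↔ s.mem (2, i) = s.mem (2, j) := by
  constructor
  · intro h
    refine Nat.eq_of_testBit_eq fun b => ?_
    by_cases hb : b < len
    · exact congrFun h ⟨b, hb⟩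
    · have hle := Nat.pow_le_pow_right (n := 2) (by norm_num) (not_lt.1 hb)
      rw [Nat.testBit_lt_two_pow (hi.trans_le hle), Nat.testBit_lt_two_pow (hj.trans_le hle)]
  · intro h
    funext b
    simp only [Config.hash, h]

theorem hashVal_lt {Q : ℕ} (hQ : 0 < Q) (P x : ℕ) (W : Multiset (ℕ × ℕ)) : hashVal Q P x W < Q :=
  (min_le_right _ _).trans_lt (Nat.mod_lt _ hQ)

open Classical in
/-- A property that fails for at most one `n`-th of the elements of a finite type holds with
probability at least `1 - 1 / n`. -/
theorem one_sub_le_uniform {α : Type*} [Fintype α] [Nonempty α] {n : ℕ} (hn : n ≠ 0)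
    (p : α → Prop) (h : n * (Finset.univ.filter fun x => ¬ p x).card ≤ Fintype.card α) :
    1 - 1 / (n : ENNReal) ≤ (PMF.uniformOfFintype α).toOuterMeasure {x | p x} := by
  rw [PMF.toOuterMeasure_uniformOfFintype_apply]
  have hc : Fintype.card α = (Finset.univ.filter p).card +
      (Finset.univ.filter fun x => ¬ p x).card := by
    rw [Finset.card_filter_add_card_filter_not, Finset.card_univ]
  have hcard : Fintype.card {x | p x} = (Finset.univ.filter p).card := by
    rw [← Fintype.card_subtype]
    rfl
  have h0 : (Fintype.card α : ENNReal) ≠ 0 := by simp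
  have ht : (Fintype.card α : ENNReal) ≠ ⊤ := ENNReal.natCast_ne_top _
  rw [hcard, tsub_le_iff_right]
  calc (1 : ENNReal) = (Fintype.card α : ENNReal) / Fintype.card α := (ENNReal.div_self h0 ht).symm
    _ = ((Finset.univ.filter p).card : ENNReal) / Fintype.card α +
        ((Finset.univ.filter fun x => ¬ p x).card : ENNReal) / Fintype.card α := by
      rw [← ENNReal.add_div, ← Nat.cast_add, ← hc]
    _ ≤ _ := by
      refine add_le_add le_rfl (ENNReal.div_le_of_le_mul ?_)
      rw [one_div, mul_comm, ← div_eq_mul_inv, ENNReal.le_div_iff_mul_le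
        (Or.inl (by simpa using hn)) (Or.inl (ENNReal.natCast_ne_top _)), mul_comm]
      exact_mod_cast h

end GeomHash

theorem mainTheorem3 :
    ∃ (𝒜 : GeomHash.StreamAlg 6) (C : ℝ), ∀ n U m : ℕ, 2 ≤ n → 1 ≤ U → 1 ≤ m →
      ∃ len : ℕ,
        (len : ℝ) ≤ C * (Real.logb 2 n + Real.logb 2 U + Real.logb 2 m) ∧
        ∀ (A : Fin m → Multiset (ℚ × ℚ)) (σ : GeomHash.PointStream m),
          (∀ i, (A i).card = n) →
          (∀ i, ∀ z ∈ A i, z.1 ∈ GeomHash.boundedQ U ∧ z.2 ∈ GeomHash.boundedQ U) →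
          GeomHash.IsStreamOf σ A →
            (∀ s ∈ (𝒜.run n U m σ).support,
              (s.peak : ℝ) ≤ C * (m * Real.logb 2 n *
                (Real.logb 2 n + Real.logb 2 U + Real.logb 2 m))) ∧
            1 - 1 / (n : ENNReal) ≤ (𝒜.run n U m σ).toOuterMeasure
              {s | GeomHash.IsCongruenceHash A (s.hash len)} := by
  refine ⟨GeomHash.hashAlg, (GeomHash.spaceCost + 2080) * 321, fun n U m hn hU hm =>
    ⟨Nat.size (GeomHash.clampVal n U m), ?_, fun A σ hcard hA hσ => ?_⟩⟩
  all_goals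
    have hsize := GeomHash.size_clampVal_le hn hU hm
    have h1 : 1 ≤ Real.logb 2 n := by
      rw [Real.le_logb_iff_rpow_le (by norm_num) (by positivity), Real.rpow_one]
      exact_mod_cast hn
    have h2 : 0 ≤ Real.logb 2 U := Real.logb_nonneg (by norm_num) (by exact_mod_cast hU)
    have h3 : 0 ≤ Real.logb 2 m := Real.logb_nonneg (by norm_num) (by exact_mod_cast hm)
    set L := Real.logb 2 n + Real.logb 2 U + Real.logb 2 m
    have hL : 0 ≤ L := by positivity
    have hK : (0 : ℝ) ≤ GeomHash.spaceCost := Nat.cast_nonneg _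
  · refine hsize.trans ?_
    nlinarith [mul_nonneg hK hL]
  obtain ⟨p, Q', hp, hQ, hP, hNQ, hQB, hrun⟩ := GeomHash.run_spec hn hU hm
  have hbd : ∀ d ∈ σ, GeomHash.BoundedPt U d.2 := by
    intro d hd
    refine hA d.1 d.2 ?_
    rw [← hσ d.1]
    simp only [Multiset.mem_coe, List.mem_map, List.mem_filter, decide_eq_true_eq]
    exact ⟨d, ⟨hd, rfl⟩, rfl⟩
  obtain ⟨F, hF, hpeak, hhash⟩ := hrun A σ hcard hbd hσ
  rw [hF]
  constructor
  · intro s hs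
    rw [PMF.support_map] at hs
    obtain ⟨x, -, rfl⟩ := hs
    have hm1 : (1 : ℝ) ≤ m := by exact_mod_cast hm
    have hpk : ((F x).peak : ℝ) ≤ (GeomHash.spaceCost + 2080) *
        (m * Nat.size (GeomHash.clampVal n U m)) := by
      have hle := GeomHash.le_clampVal n U m
      have h64 : 64 + m ≤ GeomHash.clampVal n U m := by
        have : 1 ≤ n * U * m := Nat.mul_pos (Nat.mul_pos (by omega) hU) hm
        have : m ≤ n * U * m := Nat.le_mul_of_pos_left _ (Nat.mul_pos (by omega) hU)
        have : (16 * (n * U * m)) * (16 * (n * U * m)) ≤ GeomHash.clampVal n U m := by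
          rw [← pow_two]
          exact Nat.pow_le_pow_right (by omega) (by norm_num)
        nlinarith
      have h := (hpeak x).trans (Nat.add_le_add_left (GeomHash.memBound_le hm h64) _)
      have h' : GeomHash.spaceCost * Nat.size (GeomHash.clampVal n U m) ≤
          GeomHash.spaceCost * (m * Nat.size (GeomHash.clampVal n U m)) :=
        Nat.mul_le_mul_left _ (Nat.le_mul_of_pos_left _ hm)
      have := h.trans (Nat.add_le_add_right h' _)
      rw [← add_mul] at this
      exact_mod_cast this
    calc ((F x).peak : ℝ) ≤ _ := hpk
      _ ≤ (GeomHash.spaceCost + 2080) * (m * (321 * L)) := by gcongr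
      _ = (GeomHash.spaceCost + 2080) * 321 * (m * 1 * L) := by ring
      _ ≤ _ := by gcongr
  · classical
    rw [PMF.toOuterMeasure_map_apply]
    refine GeomHash.one_sub_le_uniform (by omega) _ ?_
    rw [Fintype.card_fin]
    have hnU : 1 ≤ n * U := Nat.mul_pos (by omega) hU
    have hn' : n ≤ n * U := Nat.le_mul_of_pos_right _ hU
    have hU' : U ≤ n * U := Nat.le_mul_of_pos_left _ (by omega)
    refine le_trans ?_ (GeomHash.card_bad_le hp hU (by omega) (by omega) (by omega)
      (GeomHash.height_bound (by omega) hU hP) hQ ?_ ?_ A hA hcard)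
    · refine Nat.mul_le_mul_left n (Finset.card_le_card fun x hx => ?_)
      rw [Finset.mem_filter] at hx ⊢
      refine ⟨Finset.mem_univ _, fun h => hx.2 ?_⟩
      intro i j
      have hlt : ∀ i : Fin m,
          (F x).mem (2, (i : ℕ)) < 2 ^ Nat.size (GeomHash.clampVal n U m) := fun i => by
        rw [hhash]
        exact (GeomHash.hashVal_lt hQ.pos _ _ _).trans (hQB.trans (Nat.lt_size_self _))
      rw [GeomHash.hash_eq_iff _ (hlt i) (hlt j), hhash, hhash]
      exact h i j
    · calc ((3 ^ p) ^ 20) ^ 2 = 1 * (1 * (3 ^ p) ^ 40) := by ring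
        _ ≤ 16 * (m ^ 2 * (3 ^ p) ^ 40) := by
          gcongr
          · norm_num
          · exact Nat.one_le_pow _ _ hm
        _ ≤ _ := hNQ.le
    · calc 16 * m ^ 2 * n ^ 2 ≤ 16 * m ^ 2 * (3 ^ p) ^ 2 := by gcongr; omega
        _ ≤ 16 * m ^ 2 * (3 ^ p) ^ 40 := by gcongr <;> omega
        _ = 16 * (m ^ 2 * (3 ^ p) ^ 40) := by ring
        _ ≤ _ := hNQ.le
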